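/- Let $(\xi_k)_{k\ge 0}$ be a sequence of independent standard complex Gaussian random variables (each with density $\frac1\pi e^{-|z|^2}$ with respect to Lebesgue measure $m$ on $\mathbb{C}$), defined on a probability space $(\Omega,\mathbb{P})$, and let \[ F(z)=\sum_{k=0}^{\infty}\xi_k\frac{z^k}{\sqrt{k!}},\qquad z\in\mathbb{C}, \] be the Gaussian entire function. Let $[\mathcal{Z}]$ be the counting measure of the zeros of $F$ (with multiplicity; almost surely all zeros are simple). For $r>0$ let $H_r$ be the hole event that $F$ has no zeros in the disk $\{|z|<r\}$, and let $[\mathcal{Z}_r]$ denote the random measure $[\mathcal{Z}]$ under the conditional probability $\mathbb{P}[\,\cdot\mid H_r]$, where $\mathbb{P}[H_r]>0$. Let $\frac{1}{r^2}[\mathcal{Z}_r]\left(\frac{\cdot}{r}\right)$ be the random Radon measure that puts mass $r^{-2}$ at $z/r$ for every zero $z$, that is, the measure with $\int\phi = \frac{1}{r^2}\sum_{z\in\mathcal{Z}_r}\phi\left(\frac zr\right)$ for every continuous compactly supported $\phi$. Define the Radon measure \[ \mathrm{d}\mu^{\mathbb{C}}_{Z_0}(z)=e\cdot \mathrm{d}m_{\{|z|=1\}}(z)+\mathbf{1}_{\{|w|\ge\sqrt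 e\}}(z)\,\frac{\mathrm{d}m(z)}{\pi}, \] where $m_{\{|z|=1\}}$ is Lebesgue measure on the unit circle, normalized to be a probability measure. Equip the space $\mathcal{R}(\mathbb{C})$ of Radon (positive, locally finite) measures on $\mathbb{C}$ with the vague topology, the coarsest topology for which $\nu\mapsto\int\phi\,\mathrm{d}\nu$ is continuous for every continuous compactly supported $\phi:\mathbb{C}\to\mathbb{R}$, and with its Borel $\sigma$-algebra. Then, as $r\to\infty$, \[ \frac{1}{r^2}[\mathcal{Z}_r]\left(\frac{\cdot}{r}\right)\longrightarrow \mu^{\mathbb{C}}_{Z_0} \] in distribution as random elements of $\mathcal{R}(\mathbb{C})$: the laws of the left-hand side (under $\mathbb{P}[\,\cdot\mid H_r]$) converge weakly to the point mass at $\mu^{\mathbb{C}}_{Z_0}$. -/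

import Mathlib

open MeasureTheory ProbabilityTheory Filter
open scoped CompactlySupported

noncomputable section

/-- The standard complex Gaussian law: density `π⁻¹ exp (-|z|²)` with respect to area measure. -/
def stdComplexGaussian : Measure ℂ :=
  volume.withDensity fun z ↦ ENNReal.ofReal (Real.pi⁻¹ * Real.exp (-‖z‖ ^ 2))

/-- The random Taylor series `F(z) = ∑ ξ_k z^k / √(k!)` (the Gaussian entire function). -/
def gef {Ω : Type*} (ξ : ℕ → Ω → ℂ) (ω : Ω) (z : ℂ) : ℂ :=
  ∑' k : ℕ, ξ k ω * (z ^ k / (Real.sqrt (k.factorial : ℝ) : ℂ))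

/-- The counting measure of the zeros of `f`, each zero being counted with its multiplicity. -/
def zeroCountingMeasure (f : ℂ → ℂ) : Measure ℂ :=
  Measure.sum fun z : {z : ℂ // f z = 0} ↦
    (analyticOrderNatAt f (z : ℂ) : ENNReal) • Measure.dirac (z : ℂ)

/-- The hole event: `F` has no zeros in the open disk `{|z| < r}`. -/
def holeEvent {Ω : Type*} (ξ : ℕ → Ω → ℂ) (r : ℝ) : Set Ω :=
  {ω | ∀ z : ℂ, ‖z‖ < r → gef ξ ω z ≠ 0}

/-- Radon (positive, locally finite Borel) measures on the plane. -/
structure RadonMeasure where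
  toMeasure : Measure ℂ
  locallyFinite : IsLocallyFiniteMeasure toMeasure

namespace RadonMeasure

/-- The vague topology: the coarsest topology for which `ν ↦ ∫ φ dν` is continuous for every
continuous compactly supported `φ : ℂ → ℝ`. -/
instance : TopologicalSpace RadonMeasure :=
  TopologicalSpace.induced (fun ν (φ : C_c(ℂ, ℝ)) ↦ ∫ z, φ z ∂ν.toMeasure) inferInstance

/-- The Borel σ-algebra of the vague topology. -/
instance : MeasurableSpace RadonMeasure := borel RadonMeasure

instance : BorelSpace RadonMeasure := ⟨rfl⟩

open Classical in
/-- A locally finite measure, seen as a Radon measure (and `0` for a measure that is not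
locally finite; for the zeros of `F` this happens with probability zero). -/
def ofMeasure (ν : Measure ℂ) : RadonMeasure :=
  if h : IsLocallyFiniteMeasure ν then ⟨ν, h⟩ else ⟨0, inferInstance⟩

end RadonMeasure

/-- The scaled zero counting measure `r⁻² [Z](·/r)`: it puts mass `r⁻²` at `z / r` for each
zero `z` of `F`. -/
def scaledZeroMeasure {Ω : Type*} (ξ : ℕ → Ω → ℂ) (r : ℝ) (ω : Ω) : RadonMeasure :=
  RadonMeasure.ofMeasure
    (ENNReal.ofReal (1 / r ^ 2) • (zeroCountingMeasure (gef ξ ω)).map fun z ↦ z / (r : ℂ))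

/-- Lebesgue measure on the unit circle, normalized to be a probability measure. -/
def unitCircleMeasure : Measure ℂ :=
  ENNReal.ofReal (1 / (2 * Real.pi)) •
    (volume.restrict (Set.Ioc 0 (2 * Real.pi))).map fun θ : ℝ ↦ Complex.exp (θ * Complex.I)

instance : IsFiniteMeasure unitCircleMeasure := by
  unfold unitCircleMeasure
  exact Measure.smul_finite _ ENNReal.ofReal_ne_top

/-- The limiting measure: mass `e` spread uniformly on the unit circle, plus `π⁻¹` times area
measure on `{|z| ≥ √e}`. -/
def holeLimitMeasure : RadonMeasure where
  toMeasure := ENNReal.ofReal (Real.exp 1) • unitCircleMeasure +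
    ENNReal.ofReal (1 / Real.pi) • volume.restrict {z : ℂ | Real.sqrt (Real.exp 1) ≤ ‖z‖}
  locallyFinite := by
    refine ⟨fun x ↦ ⟨Metric.ball x 1, Metric.ball_mem_nhds x one_pos, ?_⟩⟩
    have h1 : unitCircleMeasure (Metric.ball x 1) < ⊤ := measure_lt_top _ _
    have h2 : (volume.restrict {z : ℂ | Real.sqrt (Real.exp 1) ≤ ‖z‖}) (Metric.ball x 1) < ⊤ :=
      (Measure.restrict_apply_le _ _).trans_lt measure_ball_lt_top
    simp only [Measure.add_apply, Measure.smul_apply, smul_eq_mul]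
    exact ENNReal.add_lt_top.2 ⟨ENNReal.mul_lt_top ENNReal.ofReal_lt_top h1,
      ENNReal.mul_lt_top ENNReal.ofReal_lt_top h2⟩

end

noncomputable section

/-! The proof follows the rescaled potential `u_r(w) = r⁻² log |F(r w)|`, of which the scaled zero
measure is the Laplacian divided by `2π`. Growth of the coefficients gives `u_r(w) ≤ |w|²/2 + δ` on
any fixed disk, outside an event far rarer than the hole. On the hole event, Jensen's formula forces
the mean of `u_r` over the unit circle to be `u_r(0)`. Conditioning costs least when `u_r(0) ≈ 0`
and `u_r ≈ |w|²/2` for `|w| ≥ √e`.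

Probability. The first `N` coefficients determine the values of `F` at `N` points up to an
independent shift, so the joint density of these values is at most `π⁻ᴺ ∏ k! / |Vandermonde|²`
(`lintegral_prod_gef_mul_le`). Take `K = ⌊e r²⌋` random points on the unit circle and one in each
annulus `j/r² ≤ |w|² < (j+1)/r²`, `K ≤ j < N`. Averaging over the points, with Jensen's inequality
for `exp`, gives an exponential moment of a weighted sum of integrals of `log |F|`
(`lintegral_exp_neg_potential_le`); the logarithmic energy is computable because circle means of
`log |z - a|` are explicit. On the hole event this sum is a constant minus `potentialDeficit`. By
Stirling the indices `k ≥ K` contribute only `exp(O(r² log r))`. The remaining factor `∏_{k<K}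
k!/r^{2k}` is, up to similar errors, also a lower bound for the hole probability
(`exists_measure_holeEvent_ge`), obtained by making the coefficients `1 ≤ k < K` small and the
constant term large. The index `e r²` is where `r^{2k}/k!` falls below order one, and it is the
source of the radius `√e`. Dividing the bounds, a deficit of at least `δ r⁴` has conditional
probability tending to `0` (`tendsto_measure_hole_diff_typical`). Since `u_r` is bounded above, a
small deficit gives `u_r(0) → 0` and `u_r → |w|²/2` in `L¹` of the annulus (`neg_le_scaledLog_zero`,
`setIntegral_abs_scaledLog_sub_le`).

Deterministic limit (`tendsto_integral_holeLimitMeasure`). Against a test function harmonic near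
`|w| ≤ √e`, only the annulus where `u_r` is known matters, so the zero measures have the same limit
as area measure over `π` (`tendsto_integral_of_mean_eq`). Hence a disk of radius just above `√e` has
mass about `e`, and by Jensen's formula its moment `∫ log |w|` is about `e · log √e - e/2 = 0`.
There are no zeros in the unit disk, so `log |w| ≥ 0` and the mass in this disk collects on the unit
circle. There a test function may be replaced by the real part of an entire function, to which the
harmonic case applies; the mean value property produces the uniform mass `e`.

Topology. A vague neighbourhood involves finitely many test functions, so a union bound and the
open-set criterion finish the proof. Measurability comes from recovering integrals against the zeros
as limits of integrals of `u_r` (`aemeasurable_scaledZeroMeasure`). -/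

/-! ### The Gaussian law and the growth of the coefficients -/

theorem lintegral_exp_neg_half_sq_norm :
    ∫⁻ z : ℂ, ENNReal.ofReal (Real.exp (-(1 / 2) * ‖z‖ ^ 2)) = ENNReal.ofReal (2 * Real.pi) := by
  have h := GaussianFourier.integral_rexp_neg_mul_sq_norm (V := ℂ) (b := 1 / 2) (by norm_num)
  have h2 : ∫ z : ℂ, Real.exp (-(1 / 2) * ‖z‖ ^ 2) = 2 * Real.pi := by
    rw [h, Complex.finrank_real_complex]
    norm_num
    ring
  have hi : Integrable (fun z : ℂ ↦ Real.exp (-(1 / 2) * ‖z‖ ^ 2)) := by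
    by_contra hc
    rw [integral_undef hc] at h2
    have := Real.pi_pos
    linarith
  rw [← h2, ofReal_integral_eq_lintegral_ofReal hi (ae_of_all _ fun z ↦ (Real.exp_pos _).le)]

theorem measurable_gaussianDensity :
    Measurable fun z : ℂ ↦ ENNReal.ofReal (Real.pi⁻¹ * Real.exp (-‖z‖ ^ 2)) := by
  fun_prop

/-- On the tail, `‖z‖² ≥ a²/2 + ‖z‖²/2`: half of the exponent gives the decay, the other half stays
integrable. -/
theorem stdComplexGaussian_tail {a : ℝ} (ha : 0 ≤ a) :
    stdComplexGaussian {z | a ≤ ‖z‖} ≤ ENNReal.ofReal (2 * Real.exp (-a ^ 2 / 2)) := by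
  have hm : MeasurableSet {z : ℂ | a ≤ ‖z‖} := measurableSet_le measurable_const measurable_norm
  rw [stdComplexGaussian, withDensity_apply _ hm]
  calc ∫⁻ z in {z : ℂ | a ≤ ‖z‖}, ENNReal.ofReal (Real.pi⁻¹ * Real.exp (-‖z‖ ^ 2))
      ≤ ∫⁻ z in {z : ℂ | a ≤ ‖z‖}, ENNReal.ofReal (Real.pi⁻¹ * Real.exp (-a ^ 2 / 2)) *
          ENNReal.ofReal (Real.exp (-(1 / 2) * ‖z‖ ^ 2)) := by
        refine setLIntegral_mono' hm fun z hz ↦ ?_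
        have hz' : a ≤ ‖z‖ := hz
        rw [← ENNReal.ofReal_mul (by positivity), mul_assoc, ← Real.exp_add]
        refine ENNReal.ofReal_le_ofReal (mul_le_mul_of_nonneg_left (Real.exp_le_exp.2 ?_)
          (by positivity))
        nlinarith
    _ ≤ ∫⁻ z, ENNReal.ofReal (Real.pi⁻¹ * Real.exp (-a ^ 2 / 2)) *
          ENNReal.ofReal (Real.exp (-(1 / 2) * ‖z‖ ^ 2)) := setLIntegral_le_lintegral _ _
    _ = ENNReal.ofReal (2 * Real.exp (-a ^ 2 / 2)) := by
        rw [lintegral_const_mul _ (by fun_prop), lintegral_exp_neg_half_sq_norm,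
          ← ENNReal.ofReal_mul (by positivity)]
        congr 1
        field_simp

/-- The density on the ball is at least its boundary value, and the ball has area `π a²`. For
bounded `a` this is of order `a²`, as the lower bound for the hole probability requires. -/
theorem stdComplexGaussian_ball_ge {a : ℝ} (ha : 0 ≤ a) :
    ENNReal.ofReal (a ^ 2 * Real.exp (-a ^ 2)) ≤ stdComplexGaussian (Metric.ball 0 a) := by
  rw [stdComplexGaussian, withDensity_apply _ measurableSet_ball]
  calc ENNReal.ofReal (a ^ 2 * Real.exp (-a ^ 2))
      = ∫⁻ z in Metric.ball (0 : ℂ) a, ENNReal.ofReal (Real.pi⁻¹ * Real.exp (-a ^ 2)) := by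
        rw [setLIntegral_const, Complex.volume_ball, ← ENNReal.ofReal_pow ha]
        have : (NNReal.pi : ENNReal) = ENNReal.ofReal Real.pi := by
          rw [← NNReal.coe_real_pi, ENNReal.ofReal_coe_nnreal]
        rw [this, ← ENNReal.ofReal_mul (by positivity), ← ENNReal.ofReal_mul (by positivity)]
        congr 1
        field_simp
    _ ≤ _ := by
        refine setLIntegral_mono' measurableSet_ball fun z hz ↦ ENNReal.ofReal_le_ofReal
          (mul_le_mul_of_nonneg_left (Real.exp_le_exp.2 ?_) (by positivity))
        have hz' : ‖z‖ < a := by simpa using hz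
        have := norm_nonneg z
        nlinarith

theorem stdComplexGaussian_norm_gt_pos (a : ℝ) : stdComplexGaussian {z | a < ‖z‖} ≠ 0 := by
  intro h
  have hm : MeasurableSet {z : ℂ | a < ‖z‖} := measurableSet_lt measurable_const measurable_norm
  have ho : IsOpen {z : ℂ | a < ‖z‖} := isOpen_lt continuous_const continuous_norm
  rw [stdComplexGaussian, withDensity_apply_eq_zero measurable_gaussianDensity] at h
  have hu : {x : ℂ | ENNReal.ofReal (Real.pi⁻¹ * Real.exp (-‖x‖ ^ 2)) ≠ 0} = Set.univ := by
    ext x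
    simp only [ne_eq, ENNReal.ofReal_eq_zero, not_le, Set.mem_ofPred_eq, Set.mem_univ, iff_true]
    positivity
  rw [hu, Set.univ_inter] at h
  refine (ho.measure_ne_zero volume ⟨((|a| + 1 : ℝ) : ℂ), ?_⟩) h
  simp only [Set.mem_ofPred_eq, Complex.norm_real, Real.norm_eq_abs]
  rw [abs_of_nonneg (by positivity)]
  linarith [le_abs_self a]

/-- The Taylor coefficients grow at most linearly: `‖ξ_k‖ ≤ c (k + 1)`. -/
def linearGrowthEvent {Ω : Type*} (ξ : ℕ → Ω → ℂ) (c : ℝ) : Set Ω :=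
  {ω | ∀ k : ℕ, ‖ξ k ω‖ ≤ c * (k + 1)}

/-- Since `(k+1)² ≥ k+1`, the series is dominated by a geometric one of ratio `x = exp(-c²/2)`, and
`c ≥ 2` makes `x ≤ 1/2`. -/
theorem tsum_exp_neg_sq_le {c : ℝ} (hc : 2 ≤ c) :
    ∑' k : ℕ, ENNReal.ofReal (2 * Real.exp (-(c * (k + 1)) ^ 2 / 2)) ≤
      ENNReal.ofReal (4 * Real.exp (-c ^ 2 / 2)) := by
  set x := Real.exp (-c ^ 2 / 2) with hx
  have hx0 : 0 < x := Real.exp_pos _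
  have hx1 : x ≤ 1 / 2 := by
    have h1 : x ≤ Real.exp (-1) := Real.exp_le_exp.2 (by nlinarith)
    have h2 : Real.exp (-1) ≤ 1 / 2 := by
      rw [Real.exp_neg, one_div]
      exact inv_anti₀ (by norm_num) (by have := Real.add_one_le_exp (1 : ℝ); linarith)
    linarith
  have hs : HasSum (fun k : ℕ ↦ 2 * x * x ^ k) (2 * x * (1 - x)⁻¹) :=
    (hasSum_geometric_of_lt_one hx0.le (by linarith)).mul_left _
  calc ∑' k : ℕ, ENNReal.ofReal (2 * Real.exp (-(c * (k + 1)) ^ 2 / 2))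
      ≤ ∑' k : ℕ, ENNReal.ofReal (2 * x * x ^ k) := by
        refine ENNReal.tsum_le_tsum fun k ↦ ENNReal.ofReal_le_ofReal ?_
        rw [mul_assoc, hx, ← Real.exp_nat_mul, ← Real.exp_add]
        refine mul_le_mul_of_nonneg_left (Real.exp_le_exp.2 ?_) (by norm_num)
        have : (0 : ℝ) ≤ k := k.cast_nonneg
        nlinarith [sq_nonneg c, mul_nonneg this (sq_nonneg c),
          mul_nonneg (mul_nonneg this this) (sq_nonneg c)]
    _ = ENNReal.ofReal (2 * x * (1 - x)⁻¹) := by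
        rw [← ENNReal.ofReal_tsum_of_nonneg (fun k ↦ by positivity) hs.summable, hs.tsum_eq]
    _ ≤ _ := by
        refine ENNReal.ofReal_le_ofReal ?_
        have : (1 - x)⁻¹ ≤ 2 := by
          rw [inv_le_comm₀ (by linarith) (by norm_num)]
          linarith
        nlinarith

/-! ### The Gaussian entire function: convergence, growth, measurability -/

section Series

variable {Ω : Type*} {ξ : ℕ → Ω → ℂ}

/-- Square and use `y^k / k! ≤ exp y` at `y = (x/q)²`. A value `q < 1` leaves a geometric factor
that absorbs linear growth of the coefficients; letting `q` approach `1` makes the exponent nearly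
the sharp `x²/2`. -/
theorem pow_div_sqrt_factorial_le {x q : ℝ} (hq : 0 < q) (k : ℕ) :
    x ^ k / Real.sqrt (k.factorial : ℝ) ≤ q ^ k * Real.exp (x ^ 2 / (2 * q ^ 2)) := by
  have h := Real.pow_div_factorial_le_exp ((x / q) ^ 2) (by positivity) k
  have hf : (0 : ℝ) < k.factorial := by positivity
  have h2 : ((x / q) ^ k / Real.sqrt (k.factorial : ℝ)) ^ 2 ≤
      (Real.exp (x ^ 2 / (2 * q ^ 2))) ^ 2 := by
    rw [div_pow, Real.sq_sqrt hf.le, ← Real.exp_nat_mul, ← pow_mul, mul_comm k 2, pow_mul]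
    refine h.trans (Real.exp_le_exp.2 (le_of_eq ?_))
    push_cast
    field_simp
  have h3 := abs_le_of_sq_le_sq h2 (Real.exp_pos _).le
  have h4 := (le_abs_self _).trans h3
  calc x ^ k / Real.sqrt (k.factorial : ℝ)
      = q ^ k * ((x / q) ^ k / Real.sqrt (k.factorial : ℝ)) := by
        rw [div_pow]
        field_simp
    _ ≤ _ := mul_le_mul_of_nonneg_left h4 (by positivity)

theorem norm_gef_term_le {c q : ℝ} (hq : 0 < q) {ω : Ω}
    (hω : ω ∈ linearGrowthEvent ξ c) (z : ℂ) (k : ℕ) :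
    ‖ξ k ω * (z ^ k / (Real.sqrt (k.factorial : ℝ) : ℂ))‖ ≤
      c * Real.exp (‖z‖ ^ 2 / (2 * q ^ 2)) * (((k : ℝ) + 1) * q ^ k) := by
  rw [norm_mul, norm_div, norm_pow, Complex.norm_real, Real.norm_of_nonneg (Real.sqrt_nonneg _)]
  have h1 := hω k
  have h2 := pow_div_sqrt_factorial_le (x := ‖z‖) hq k
  calc ‖ξ k ω‖ * (‖z‖ ^ k / Real.sqrt (k.factorial : ℝ))
      ≤ (c * (k + 1)) * (q ^ k * Real.exp (‖z‖ ^ 2 / (2 * q ^ 2))) :=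
        mul_le_mul h1 h2 (by positivity) ((norm_nonneg _).trans h1)
    _ = _ := by ring

theorem summable_succ_mul_geometric {q : ℝ} (hq : 0 < q) (hq1 : q < 1) :
    Summable fun k : ℕ ↦ ((k : ℝ) + 1) * q ^ k := by
  have h1 := summable_pow_mul_geometric_of_norm_lt_one (R := ℝ) 1
    (r := q) (by rwa [Real.norm_of_nonneg hq.le])
  have h2 := summable_geometric_of_lt_one hq.le hq1
  refine (h1.add h2).congr fun k ↦ ?_
  ring

theorem gef_summable {c : ℝ} {ω : Ω} (hω : ω ∈ linearGrowthEvent ξ c) (z : ℂ) :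
    Summable fun k : ℕ ↦ ξ k ω * (z ^ k / (Real.sqrt (k.factorial : ℝ) : ℂ)) :=
  Summable.of_norm_bounded
    ((summable_succ_mul_geometric (q := 1 / 2) (by norm_num) (by norm_num)).mul_left _)
    (norm_gef_term_le (by norm_num) hω z)

theorem norm_gef_le {c q : ℝ} (hq : 0 < q) (hq1 : q < 1) {ω : Ω}
    (hω : ω ∈ linearGrowthEvent ξ c) (z : ℂ) :
    ‖gef ξ ω z‖ ≤
      c * (∑' k : ℕ, ((k : ℝ) + 1) * q ^ k) * Real.exp (‖z‖ ^ 2 / (2 * q ^ 2)) := by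
  have h := tsum_of_norm_bounded
    ((summable_succ_mul_geometric hq hq1).hasSum.mul_left (c * Real.exp (‖z‖ ^ 2 / (2 * q ^ 2))))
    (norm_gef_term_le hq hω z)
  refine h.trans (le_of_eq ?_)
  ring

theorem differentiable_gef {c : ℝ} {ω : Ω} (hω : ω ∈ linearGrowthEvent ξ c) :
    Differentiable ℂ (gef ξ ω) := by
  intro z
  have hc : 0 ≤ c := by
    have := (norm_nonneg _).trans (hω 0)
    simpa using this
  have hd : DifferentiableOn ℂ (gef ξ ω) (Metric.ball 0 (‖z‖ + 1)) := by
    refine Complex.differentiableOn_tsum_of_summable_norm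
      (u := fun k : ℕ ↦ c * Real.exp ((‖z‖ + 1) ^ 2 / (2 * (1 / 2) ^ 2)) *
        (((k : ℝ) + 1) * (1 / 2) ^ k))
      ((summable_succ_mul_geometric (q := 1 / 2) (by norm_num) (by norm_num)).mul_left _)
      (fun k ↦ ?_) Metric.isOpen_ball fun k w hw ↦ ?_
    · exact ((differentiable_id.pow k).div_const _ |>.const_mul _).differentiableOn
    · refine (norm_gef_term_le (q := 1 / 2) (by norm_num) hω w k).trans ?_
      have hw' : ‖w‖ < ‖z‖ + 1 := by simpa using hw
      gcongr
  exact hd.differentiableAt (Metric.isOpen_ball.mem_nhds (by simp))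

theorem gef_zero (ω : Ω) : gef ξ ω 0 = ξ 0 ω := by
  unfold gef
  rw [tsum_eq_single 0 (fun k hk ↦ by simp [hk])]
  simp

variable [MeasurableSpace Ω] {P : Measure Ω}

theorem measurableSet_linearGrowthEvent (hmeas : ∀ k, Measurable (ξ k)) (c : ℝ) :
    MeasurableSet (linearGrowthEvent ξ c) := by
  unfold linearGrowthEvent
  rw [Set.ofPred_forall]
  exact MeasurableSet.iInter fun k ↦ measurableSet_le (hmeas k).norm measurable_const

theorem measure_norm_ge_le (hmeas : ∀ k, Measurable (ξ k))
    (hlaw : ∀ k, P.map (ξ k) = stdComplexGaussian) (k : ℕ) {a : ℝ} (ha : 0 ≤ a) :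
    P {ω | a ≤ ‖ξ k ω‖} ≤ ENNReal.ofReal (2 * Real.exp (-a ^ 2 / 2)) := by
  have := stdComplexGaussian_tail ha
  rwa [← hlaw k, Measure.map_apply (hmeas k) (measurableSet_le measurable_const measurable_norm)]
    at this

theorem measure_compl_linearGrowthEvent_le (hmeas : ∀ k, Measurable (ξ k))
    (hlaw : ∀ k, P.map (ξ k) = stdComplexGaussian) {c : ℝ} (hc : 2 ≤ c) :
    P (linearGrowthEvent ξ c)ᶜ ≤ ENNReal.ofReal (4 * Real.exp (-c ^ 2 / 2)) := by
  refine le_trans ?_ (tsum_exp_neg_sq_le hc)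
  calc P (linearGrowthEvent ξ c)ᶜ ≤ P (⋃ k : ℕ, {ω | c * (k + 1) ≤ ‖ξ k ω‖}) := by
        refine measure_mono fun ω hω ↦ ?_
        simp only [linearGrowthEvent, Set.mem_compl_iff, Set.mem_ofPred_eq, not_forall, not_le] at hω
        obtain ⟨k, hk⟩ := hω
        exact Set.mem_iUnion.2 ⟨k, hk.le⟩
    _ ≤ ∑' k : ℕ, P {ω | c * (k + 1) ≤ ‖ξ k ω‖} := measure_iUnion_le _
    _ ≤ _ := ENNReal.tsum_le_tsum fun k ↦ measure_norm_ge_le hmeas hlaw k (by positivity)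

theorem ae_exists_mem_linearGrowthEvent (hmeas : ∀ k, Measurable (ξ k))
    (hlaw : ∀ k, P.map (ξ k) = stdComplexGaussian) :
    ∀ᵐ ω ∂P, ∃ c : ℝ, 0 ≤ c ∧ ω ∈ linearGrowthEvent ξ c := by
  have h0 : Tendsto (fun n : ℕ ↦ ENNReal.ofReal (4 * Real.exp (-(n + 2 : ℝ) ^ 2 / 2))) atTop
      (nhds 0) := by
    rw [← ENNReal.ofReal_zero]
    refine ENNReal.tendsto_ofReal ?_
    have h1 : Tendsto (fun n : ℕ ↦ (n : ℝ)) atTop atTop := tendsto_natCast_atTop_atTop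
    have h2 : Tendsto (fun n : ℕ ↦ 4 * Real.exp (-(n : ℝ))) atTop (nhds (4 * 0)) :=
      ((Real.tendsto_exp_neg_atTop_nhds_zero).comp h1).const_mul 4
    rw [mul_zero] at h2
    refine squeeze_zero (fun n ↦ by positivity) (fun n ↦ ?_) h2
    refine mul_le_mul_of_nonneg_left (Real.exp_le_exp.2 ?_) (by norm_num)
    have : (0 : ℝ) ≤ n := n.cast_nonneg
    nlinarith
  rw [ae_iff]
  refine le_antisymm (ge_of_tendsto' h0 fun n ↦ ?_) zero_le
  refine le_trans (measure_mono fun ω hω ↦ ?_)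
    (measure_compl_linearGrowthEvent_le hmeas hlaw (c := (n : ℝ) + 2) (by
      have : (0 : ℝ) ≤ n := n.cast_nonneg
      linarith))
  intro h
  exact hω ⟨_, by positivity, h⟩

theorem measurable_gef_uncurry (hmeas : ∀ k, Measurable (ξ k)) :
    Measurable fun p : Ω × ℂ ↦ gef ξ p.1 p.2 := by
  unfold gef
  refine Measurable.tsum fun k ↦ ?_
  exact ((hmeas k).comp measurable_fst).mul ((measurable_snd.pow_const k).div_const _)

theorem ae_gef_zero_ne_zero (hmeas : ∀ k, Measurable (ξ k))
    (hlaw : ∀ k, P.map (ξ k) = stdComplexGaussian) :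
    ∀ᵐ ω ∂P, gef ξ ω 0 ≠ 0 := by
  simp_rw [gef_zero]
  have h : ∀ᵐ z ∂(P.map (ξ 0)), z ≠ 0 := by
    rw [hlaw 0]
    have : ∀ᵐ z : ℂ, z ≠ 0 := by
      rw [ae_iff]
      simp
    exact (withDensity_absolutelyContinuous _ _).ae_le this
  exact ae_of_ae_map (hmeas 0).aemeasurable h

end Series

/-! ### Joint density of the values at finitely many points -/

theorem lintegral_fin_prod_eq_prod {α : Type*} [MeasurableSpace α] :
    ∀ {n : ℕ} (μ : Fin n → Measure α) [∀ i, SigmaFinite (μ i)] (g : Fin n → α → ENNReal)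
      (_ : ∀ i, Measurable (g i)),
      ∫⁻ y, ∏ i, g i (y i) ∂Measure.pi μ = ∏ i, ∫⁻ x, g i x ∂μ i := by
  intro n
  induction n with
  | zero =>
    intro μ _ g _
    simp
  | succ n ih =>
    intro μ _ g hg
    rw [← ((measurePreserving_piFinSuccAbove μ 0).symm).lintegral_comp_emb
      (MeasurableEquiv.measurableEmbedding _)]
    have h1 : ∀ p : α × (Fin n → α),
        ∏ i, g i ((MeasurableEquiv.piFinSuccAbove (fun _ ↦ α) 0).symm p i) =
          g 0 p.1 * ∏ i : Fin n, g i.succ (p.2 i) := by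
      intro p
      rw [Fin.prod_univ_succ]
      simp [MeasurableEquiv.piFinSuccAbove, Fin.insertNthEquiv]
    simp_rw [h1]
    have hm : Measurable fun y : Fin n → α ↦ ∏ i : Fin n, g i.succ (y i) :=
      Finset.measurable_prod _ fun i _ ↦ (hg i.succ).comp (measurable_pi_apply i)
    rw [lintegral_prod_mul (hg 0).aemeasurable hm.aemeasurable, Fin.prod_univ_succ]
    congr 1
    exact ih (fun i ↦ μ i.succ) (fun i ↦ g i.succ) fun i ↦ hg i.succ

/-- Domination passes to products one coordinate at a time, so the induction is run on integrals of
nonnegative functions. It lets Lebesgue measure over `π` replace the Gaussian law of the low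
coefficients. -/
theorem Measure_pi_le_smul_pi {α : Type*} [MeasurableSpace α] {n : ℕ} {μ ν : Measure α}
    [SigmaFinite μ] [SigmaFinite ν] {c : ENNReal} (h : μ ≤ c • ν) :
    Measure.pi (fun _ : Fin n ↦ μ) ≤ c ^ n • Measure.pi (fun _ : Fin n ↦ ν) := by
  refine Measure.le_iff.2 fun s hs ↦ ?_
  have h1 : ∀ (m : ℕ) (f : (Fin m → α) → ENNReal), Measurable f →
      ∫⁻ x, f x ∂Measure.pi (fun _ : Fin m ↦ μ) ≤
        c ^ m * ∫⁻ x, f x ∂Measure.pi (fun _ : Fin m ↦ ν) := by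
    intro m
    induction m with
    | zero =>
      intro f _
      rw [Measure.pi_of_empty (fun _ : Fin 0 ↦ μ), Measure.pi_of_empty (fun _ : Fin 0 ↦ ν), pow_zero,
        one_mul]
    | succ m ih =>
      intro f hf
      have hfm : Measurable fun p : α × (Fin m → α) ↦
          f ((MeasurableEquiv.piFinSuccAbove (fun _ ↦ α) 0).symm p) :=
        hf.comp (MeasurableEquiv.measurable _)
      rw [← ((measurePreserving_piFinSuccAbove (fun _ : Fin (m + 1) ↦ μ) 0).symm).lintegral_comp_emb
        (MeasurableEquiv.measurableEmbedding _),
        ← ((measurePreserving_piFinSuccAbove (fun _ : Fin (m + 1) ↦ ν) 0).symm).lintegral_comp_emb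
        (MeasurableEquiv.measurableEmbedding _), lintegral_prod _ hfm.aemeasurable,
        lintegral_prod _ hfm.aemeasurable]
      calc _ ≤ ∫⁻ x, c ^ m * ∫⁻ y, f ((MeasurableEquiv.piFinSuccAbove (fun _ ↦ α) 0).symm (x, y))
              ∂Measure.pi (fun _ : Fin m ↦ ν) ∂μ :=
            lintegral_mono fun x ↦ ih _ (hfm.comp measurable_prodMk_left)
        _ ≤ ∫⁻ x, c ^ m * ∫⁻ y, f ((MeasurableEquiv.piFinSuccAbove (fun _ ↦ α) 0).symm (x, y))
              ∂Measure.pi (fun _ : Fin m ↦ ν) ∂(c • ν) := lintegral_mono' h le_rfl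
        _ = _ := by
            rw [lintegral_smul_measure, lintegral_const_mul _ hfm.lintegral_prod_right', pow_succ,
              smul_eq_mul, ← mul_assoc, mul_comm c]
  have h2 := h1 n (s.indicator 1) (measurable_one.indicator hs)
  rwa [lintegral_indicator_one hs, lintegral_indicator_one hs] at h2

theorem stdComplexGaussian_le_smul_volume :
    stdComplexGaussian ≤ ENNReal.ofReal Real.pi⁻¹ • volume := by
  rw [← withDensity_const]
  refine withDensity_mono (ae_of_all _ fun z ↦ ENNReal.ofReal_le_ofReal ?_)
  have : Real.exp (-‖z‖ ^ 2) ≤ 1 := Real.exp_le_one_iff.2 (by nlinarith [sq_nonneg ‖z‖])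
  have h2 : (0 : ℝ) ≤ Real.pi⁻¹ := by positivity
  nlinarith

/-- The matrix of the map from the first `N` coefficients to the values at the points `z`. -/
def valueMatrix {N : ℕ} (z : Fin N → ℂ) : Matrix (Fin N) (Fin N) ℂ :=
  Matrix.vandermonde z *
    Matrix.diagonal fun k : Fin N ↦ ((Real.sqrt ((k : ℕ).factorial : ℝ) : ℂ))⁻¹

theorem valueMatrix_mulVec {N : ℕ} (z x : Fin N → ℂ) (j : Fin N) :
    (valueMatrix z).mulVec x j =
      ∑ k : Fin N, x k * (z j ^ (k : ℕ) / (Real.sqrt ((k : ℕ).factorial : ℝ) : ℂ)) := by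
  simp only [valueMatrix, Matrix.mulVec, dotProduct, Matrix.mul_diagonal,
    Matrix.vandermonde_apply]
  refine Finset.sum_congr rfl fun k _ ↦ ?_
  ring

theorem normSq_det_valueMatrix {N : ℕ} (z : Fin N → ℂ) :
    Complex.normSq (valueMatrix z).det =
      (∏ i : Fin N, ∏ j > i, ‖z j - z i‖ ^ 2) / ∏ k ∈ Finset.range N, (k.factorial : ℝ) := by
  rw [valueMatrix, Matrix.det_mul, Matrix.det_vandermonde, Matrix.det_diagonal, map_mul,
    map_prod, map_prod, ← Fin.prod_univ_eq_prod_range (fun k ↦ (k.factorial : ℝ)) N, div_eq_mul_inv]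
  congr 1
  · refine Finset.prod_congr rfl fun i _ ↦ ?_
    rw [map_prod]
    exact Finset.prod_congr rfl fun j _ ↦ Complex.normSq_eq_norm_sq _
  · rw [← Finset.prod_inv_distrib]
    refine Finset.prod_congr rfl fun k _ ↦ ?_
    rw [map_inv₀, Complex.normSq_ofReal, Real.mul_self_sqrt (by positivity)]

/-- Linear change of variables over `ℝ`, where the Jacobian of a complex matrix is `|det|²`; the
shift `b` disappears by translation invariance. Multiplying by the squared Vandermonde product,
rather than dividing by it, admits coincident points. -/
theorem lintegral_comp_valueMatrix_mul {N : ℕ} (z b : Fin N → ℂ) {g : ℂ → ENNReal}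
    (hg : Measurable g) :
    (∫⁻ x : Fin N → ℂ, ∏ j, g ((valueMatrix z).mulVec x j + b j)) *
        ENNReal.ofReal (∏ i : Fin N, ∏ j > i, ‖z j - z i‖ ^ 2) ≤
      ENNReal.ofReal (∏ k ∈ Finset.range N, (k.factorial : ℝ)) * (∫⁻ x, g x) ^ N := by
  set A := valueMatrix z with hA
  have hfac : 0 < ∏ k ∈ Finset.range N, (k.factorial : ℝ) :=
    Finset.prod_pos fun k _ ↦ by positivity
  by_cases hdet : A.det = 0
  · have h0 := normSq_det_valueMatrix z
    rw [← hA, hdet, map_zero, eq_comm, div_eq_zero_iff, or_iff_left hfac.ne'] at h0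
    rw [h0]
    simp
  let f : (Fin N → ℂ) →ₗ[ℝ] (Fin N → ℂ) := (Matrix.toLin' A).restrictScalars ℝ
  have hf : LinearMap.det f = Complex.normSq A.det := by
    rw [LinearMap.det_restrictScalars, LinearMap.det_toLin', Algebra.norm_complex_apply]
  have hpos : 0 < Complex.normSq A.det := Complex.normSq_pos.2 hdet
  have hmap := Measure.map_linearMap_addHaar_eq_smul_addHaar
    (volume : Measure (Fin N → ℂ)) (f := f) (by rw [hf]; exact hpos.ne')
  rw [hf, abs_of_pos (inv_pos.2 hpos)] at hmap
  have hG : Measurable fun y : Fin N → ℂ ↦ ∏ j, g (y j + b j) :=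
    Finset.measurable_prod _ fun j _ ↦ hg.comp ((measurable_pi_apply j).add_const _)
  have h1 : ∫⁻ x : Fin N → ℂ, ∏ j, g (A.mulVec x j + b j) =
      ENNReal.ofReal (Complex.normSq A.det)⁻¹ * (∫⁻ x, g x) ^ N := by
    have hfm : Measurable f := f.continuous_of_finiteDimensional.measurable
    calc ∫⁻ x : Fin N → ℂ, ∏ j, g (A.mulVec x j + b j)
        = ∫⁻ y, ∏ j, g (y j + b j) ∂(Measure.map f volume) := by
          rw [lintegral_map hG hfm]
          rfl
      _ = ENNReal.ofReal (Complex.normSq A.det)⁻¹ * ∫⁻ y : Fin N → ℂ, ∏ j, g (y j + b j) := by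
          rw [hmap, lintegral_smul_measure, smul_eq_mul]
      _ = _ := by
          rw [volume_pi, lintegral_fin_prod_eq_prod (fun _ ↦ volume) (fun j x ↦ g (x + b j))
            fun j ↦ hg.comp (measurable_id.add_const _)]
          simp_rw [lintegral_add_right_eq_self]
          simp
  rw [h1, normSq_det_valueMatrix z, inv_div, mul_right_comm, ← ENNReal.ofReal_mul (by positivity)]
  gcongr
  have hv : (∏ i : Fin N, ∏ j > i, ‖z j - z i‖ ^ 2) ≠ 0 := by
    intro h
    have h0 := normSq_det_valueMatrix z
    rw [h, zero_div, ← hA] at h0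
    exact hpos.ne' h0
  rw [div_mul_cancel₀ _ hv]

variable {Ω : Type*} [MeasurableSpace Ω] {P : Measure Ω}
  {ξ : ℕ → Ω → ℂ}

theorem indepFun_low_high (hmeas : ∀ k, Measurable (ξ k)) (hindep : iIndepFun ξ P) (N : ℕ) :
    IndepFun (fun ω (i : Fin N) ↦ ξ i ω) (fun ω (k : ℕ) ↦ ξ (k + N) ω) P := by
  have h := indep_iSup_of_disjoint (fun i ↦ (hmeas i).comap_le) hindep.iIndep
    (S := Set.Iio N) (T := Set.Ici N) (by
      rw [Set.disjoint_left]
      intro i hi hi'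
      exact absurd (Set.mem_Iio.1 hi) (not_lt.2 (Set.mem_Ici.1 hi')))
  rw [IndepFun_iff_Indep]
  refine indep_of_indep_of_le_left (indep_of_indep_of_le_right h ?_) ?_
  · rw [MeasurableSpace.pi, MeasurableSpace.comap_iSup]
    refine iSup_le fun k ↦ ?_
    rw [MeasurableSpace.comap_comp]
    exact le_iSup₂_of_le (k + N) (Nat.le_add_left N k) le_rfl
  · rw [MeasurableSpace.pi, MeasurableSpace.comap_iSup]
    refine iSup_le fun k ↦ ?_
    rw [MeasurableSpace.comap_comp]
    exact le_iSup₂_of_le (k : ℕ) k.2 le_rfl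

variable [IsProbabilityMeasure P]

theorem map_low_eq_pi (hmeas : ∀ k, Measurable (ξ k))
    (hlaw : ∀ k, P.map (ξ k) = stdComplexGaussian) (hindep : iIndepFun ξ P) (N : ℕ) :
    P.map (fun ω (i : Fin N) ↦ ξ i ω) = Measure.pi fun _ : Fin N ↦ stdComplexGaussian := by
  have h : iIndepFun (fun i : Fin N ↦ ξ i) P := hindep.precomp Fin.val_injective
  rw [(iIndepFun_iff_map_fun_eq_pi_map (f := fun i : Fin N ↦ ξ i)
    fun i ↦ (hmeas i).aemeasurable).1 h]
  simp_rw [hlaw]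

theorem isProbabilityMeasure_stdComplexGaussian (hmeas : ∀ k, Measurable (ξ k))
    (hlaw : ∀ k, P.map (ξ k) = stdComplexGaussian) :
    IsProbabilityMeasure stdComplexGaussian := by
  rw [← hlaw 0]
  exact Measure.isProbabilityMeasure_map (hmeas 0).aemeasurable

/-- The joint density of the values of `F` at `N` points is at most `π⁻ᴺ |det|⁻²`. -/
theorem lintegral_prod_gef_mul_le (hmeas : ∀ k, Measurable (ξ k))
    (hlaw : ∀ k, P.map (ξ k) = stdComplexGaussian) (hindep : iIndepFun ξ P)
    {N : ℕ} (z : Fin N → ℂ) {g : ℂ → ENNReal} (hg : Measurable g) :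
    (∫⁻ ω, ∏ j, g (gef ξ ω (z j)) ∂P) *
        ENNReal.ofReal (∏ i : Fin N, ∏ j > i, ‖z j - z i‖ ^ 2) ≤
      ENNReal.ofReal (∏ k ∈ Finset.range N, (k.factorial : ℝ)) *
        (ENNReal.ofReal Real.pi⁻¹ * ∫⁻ x, g x) ^ N := by
  have := isProbabilityMeasure_stdComplexGaussian hmeas hlaw
  set V := ENNReal.ofReal (∏ i : Fin N, ∏ j > i, ‖z j - z i‖ ^ 2)
  set X : Ω → Fin N → ℂ := fun ω i ↦ ξ i ω with hX
  set Y : Ω → ℕ → ℂ := fun ω k ↦ ξ (k + N) ω with hY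
  have hXm : Measurable X := measurable_pi_lambda _ fun i ↦ hmeas i
  have hYm : Measurable Y := measurable_pi_lambda _ fun i ↦ hmeas (i + N)
  -- The contribution of the coefficients of index at least `N` to the values: a random shift
  -- independent of the first `N` coefficients.
  let b : (ℕ → ℂ) → Fin N → ℂ := fun y j ↦
    ∑' k : ℕ, y k * (z j ^ (k + N) / (Real.sqrt ((k + N).factorial : ℝ) : ℂ))
  have hbm : ∀ j, Measurable fun y ↦ b y j := fun j ↦
    Measurable.tsum fun k ↦ (measurable_pi_apply k).mul_const _
  let Φ : (Fin N → ℂ) × (ℕ → ℂ) → ENNReal := fun p ↦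
    ∏ j, g ((valueMatrix z).mulVec p.1 j + b p.2 j)
  have hΦ : Measurable Φ := by
    refine Finset.measurable_prod _ fun j _ ↦ hg.comp (Measurable.add ?_ ?_)
    · simp_rw [valueMatrix_mulVec]
      exact Finset.measurable_sum _ fun k _ ↦
        ((measurable_pi_apply k).comp measurable_fst).mul_const _
    · exact (hbm j).comp measurable_snd
  have h1 : ∫⁻ ω, ∏ j, g (gef ξ ω (z j)) ∂P = ∫⁻ ω, Φ (X ω, Y ω) ∂P := by
    refine lintegral_congr_ae ?_
    filter_upwards [ae_exists_mem_linearGrowthEvent hmeas hlaw] with ω hω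
    obtain ⟨c, -, hc⟩ := hω
    refine Finset.prod_congr rfl fun j _ ↦ ?_
    congr 1
    rw [valueMatrix_mulVec, gef, ← (gef_summable hc (z j)).sum_add_tsum_nat_add N,
      Finset.sum_range]
  -- Conditioning on the high coefficients `y`: the values become an affine image of the low ones,
  -- and the bound obtained for each `y` does not depend on it.
  have h2 : ∫⁻ ω, Φ (X ω, Y ω) ∂P = ∫⁻ y, ∫⁻ x, Φ (x, y) ∂(P.map X) ∂(P.map Y) := by
    have := Measure.isProbabilityMeasure_map (μ := P) hXm.aemeasurable
    have := Measure.isProbabilityMeasure_map (μ := P) hYm.aemeasurable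
    rw [← lintegral_prod_symm _ hΦ.aemeasurable,
      ← (indepFun_iff_map_prod_eq_prod_map_map hXm.aemeasurable hYm.aemeasurable).1
        (indepFun_low_high hmeas hindep N), lintegral_map hΦ (hXm.prodMk hYm)]
  rw [h1, h2, ← lintegral_mul_const _ hΦ.lintegral_prod_left']
  calc ∫⁻ y, (∫⁻ x, Φ (x, y) ∂(P.map X)) * V ∂(P.map Y)
      ≤ ∫⁻ _, ENNReal.ofReal (∏ k ∈ Finset.range N, (k.factorial : ℝ)) *
        (ENNReal.ofReal Real.pi⁻¹ * ∫⁻ x, g x) ^ N ∂(P.map Y) := by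
        refine lintegral_mono fun y ↦ ?_
        have h3 : ∫⁻ x, Φ (x, y) ∂(P.map X) ≤
            ENNReal.ofReal Real.pi⁻¹ ^ N * ∫⁻ x, Φ (x, y) := by
          rw [map_low_eq_pi hmeas hlaw hindep N, ← smul_eq_mul, ← lintegral_smul_measure]
          exact lintegral_mono' (Measure_pi_le_smul_pi stdComplexGaussian_le_smul_volume) le_rfl
        calc (∫⁻ x, Φ (x, y) ∂(P.map X)) * V
            ≤ (ENNReal.ofReal Real.pi⁻¹ ^ N * ∫⁻ x, Φ (x, y)) * V := by gcongr
          _ = ENNReal.ofReal Real.pi⁻¹ ^ N * ((∫⁻ x, Φ (x, y)) * V) := mul_assoc _ _ _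
          _ ≤ ENNReal.ofReal Real.pi⁻¹ ^ N *
              (ENNReal.ofReal (∏ k ∈ Finset.range N, (k.factorial : ℝ)) * (∫⁻ x, g x) ^ N) :=
            mul_le_mul_right (lintegral_comp_valueMatrix_mul z (b y) hg) _
          _ = _ := by
            rw [mul_pow]
            ring
    _ = _ := by
        have := Measure.isProbabilityMeasure_map (μ := P) hYm.aemeasurable
        rw [lintegral_const, measure_univ, mul_one]

/-! ### The uniform measure on the circle and circular means of logarithms -/

theorem measurable_exp_mul_I : Measurable fun θ : ℝ ↦ Complex.exp (θ * Complex.I) := by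
  fun_prop

instance isProbabilityMeasure_unitCircleMeasure : IsProbabilityMeasure unitCircleMeasure := by
  refine ⟨?_⟩
  have h2 : (0 : ℝ) < 2 * Real.pi := by positivity
  rw [unitCircleMeasure, Measure.smul_apply, Measure.map_apply measurable_exp_mul_I .univ,
    Set.preimage_univ, Measure.restrict_apply_univ, Real.volume_Ioc, smul_eq_mul, sub_zero,
    ← ENNReal.ofReal_mul (by positivity), one_div, inv_mul_cancel₀ h2.ne', ENNReal.ofReal_one]

theorem ae_unitCircleMeasure_norm_eq_one : ∀ᵐ z ∂unitCircleMeasure, ‖z‖ = 1 := by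
  refine Measure.ae_smul_measure ?_ _
  rw [ae_map_iff measurable_exp_mul_I.aemeasurable
    (measurableSet_eq_fun measurable_norm measurable_const)]
  exact ae_of_all _ fun θ ↦ Complex.norm_exp_ofReal_mul_I θ

theorem circleMap_zero_one (θ : ℝ) : circleMap 0 1 θ = Complex.exp (θ * Complex.I) := by
  simp [circleMap]

instance nullSingletonClass_unitCircleMeasure : NullSingletonClass unitCircleMeasure := by
  refine ⟨fun c ↦ ?_⟩
  rw [unitCircleMeasure, Measure.smul_apply,
    Measure.map_apply measurable_exp_mul_I (measurableSet_singleton c)]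
  have h : ((fun θ : ℝ ↦ Complex.exp (θ * Complex.I)) ⁻¹' {c}).Countable := by
    have := (Set.countable_singleton c).preimage_circleMap 0 one_ne_zero
    simpa only [circleMap_zero_one, Set.preimage] using this
  have h0 := h.measure_zero (volume.restrict (Set.Ioc 0 (2 * Real.pi)))
  rw [h0, smul_zero]

theorem integral_unitCircleMeasure {f : ℂ → ℝ} (hf : Measurable f) :
    ∫ z, f z ∂unitCircleMeasure = Real.circleAverage f 0 1 := by
  have h2 : (0 : ℝ) ≤ 2 * Real.pi := by positivity
  rw [unitCircleMeasure, integral_smul_measure, integral_map measurable_exp_mul_I.aemeasurable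
    hf.aestronglyMeasurable, Real.circleAverage_def, intervalIntegral.integral_of_le h2,
    ENNReal.toReal_ofReal (by positivity), one_div]
  simp_rw [circleMap_zero_one]

theorem integrable_unitCircleMeasure {f : ℂ → ℝ} (hf : Measurable f)
    (h : CircleIntegrable f 0 1) : Integrable f unitCircleMeasure := by
  have h2 : (0 : ℝ) ≤ 2 * Real.pi := by positivity
  rw [unitCircleMeasure]
  refine Integrable.smul_measure ?_ ENNReal.ofReal_ne_top
  rw [integrable_map_measure hf.aestronglyMeasurable measurable_exp_mul_I.aemeasurable]
  have h3 := (intervalIntegrable_iff_integrableOn_Ioc_of_le h2).1 h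
  refine h3.congr_fun (fun θ _ ↦ ?_) measurableSet_Ioc
  simp [circleMap_zero_one]

/-- In Jensen's formula the difference is a sum over the zeros of `log (1/|u|)` with multiplicities,
and `|u| ≤ 1`. -/
theorem log_norm_le_circleAverage {f : ℂ → ℂ} (hf : Differentiable ℂ f) (h0 : f 0 ≠ 0) :
    Real.log ‖f 0‖ ≤ Real.circleAverage (fun z ↦ Real.log ‖f z‖) 0 1 := by
  have ha : AnalyticOnNhd ℂ f (Metric.closedBall 0 |1|) := fun z _ ↦ hf.analyticAt z
  rw [ha.circleAverage_log_norm one_ne_zero h0]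
  refine le_add_of_nonneg_left (finsum_nonneg fun u ↦ ?_)
  by_cases hu : u ∈ Metric.closedBall (0 : ℂ) |1|
  · have h1 : 0 ≤ MeromorphicOn.divisor f (Metric.closedBall 0 |1|) u :=
      (MeromorphicOn.AnalyticOnNhd.divisor_nonneg ha) u
    refine mul_nonneg (by exact_mod_cast h1) ?_
    rw [one_mul, zero_sub, norm_neg]
    rw [Metric.mem_closedBall, dist_zero_right, abs_one] at hu
    rcases eq_or_ne u 0 with rfl | hu0
    · simp
    · exact Real.log_nonneg (by rw [one_le_inv₀ (norm_pos_iff.2 hu0)]; exact hu)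
  · rw [Function.locallyFinsuppWithin.apply_eq_zero_of_notMem _ hu]
    simp

theorem circleIntegrable_log_norm {f : ℂ → ℂ} (hf : Differentiable ℂ f) (c : ℂ) (R : ℝ) :
    CircleIntegrable (fun z ↦ Real.log ‖f z‖) c R :=
  MeromorphicOn.circleIntegrable_log_norm fun z _ ↦ (hf.analyticAt z).meromorphicAt

theorem measurable_log_norm {f : ℂ → ℂ} (hf : Differentiable ℂ f) :
    Measurable fun z ↦ Real.log ‖f z‖ :=
  Real.measurable_log.comp hf.continuous.norm.measurable

/-- Turns a lower bound for an integral of `log` into an `L¹` bound once the argument is bounded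
above. It also covers `x = 0`, where `log 0 = 0`. -/
theorem abs_log_le {x B : ℝ} (hx : 0 ≤ x) (hB : 1 ≤ B) (hxB : x ≤ B) :
    |Real.log x| ≤ 2 * Real.log B - Real.log x := by
  have h1 : Real.log x ≤ Real.log B := by
    rcases hx.eq_or_lt with rfl | h
    · simpa using Real.log_nonneg hB
    · exact Real.log_le_log h hxB
  have := Real.log_nonneg hB
  rw [abs_le]
  constructor <;> linarith

section Mixture

variable {τ : Measure ℂ} {m ρ : ℝ}

theorem ae_mconv_unitCircleMeasure {p : ℝ → Prop} (hp : MeasurableSet {x | p x})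
    (hτ : ∀ᵐ w ∂τ, p ‖w‖) : ∀ᵐ w ∂(τ ∗ₘ unitCircleMeasure), p ‖w‖ := by
  have hp' : MeasurableSet {w : ℂ | p ‖w‖} := measurable_norm hp
  rw [Measure.mconv, ae_map_iff measurable_mul.aemeasurable hp', Measure.ae_prod_iff_ae_ae]
  · filter_upwards [hτ] with w hw
    filter_upwards [ae_unitCircleMeasure_norm_eq_one] with z hz
    rwa [norm_mul, hz, mul_one]
  · exact measurable_mul hp'

/-- For fixed `w ≠ 0` only one point of the circle is sent to `c`. Atomlessness will make
independent sample points distinct. -/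
theorem nullSingletonClass_mconv_unitCircleMeasure (hτ : ∀ᵐ w ∂τ, w ≠ 0) : NullSingletonClass (τ ∗ₘ unitCircleMeasure) := by
  refine ⟨fun c ↦ ?_⟩
  rw [Measure.mconv, Measure.map_apply measurable_mul (measurableSet_singleton c),
    Measure.measure_prod_null (measurable_mul (measurableSet_singleton c))]
  filter_upwards [hτ] with w hw0
  have : Prod.mk w ⁻¹' ((fun p : ℂ × ℂ ↦ p.1 * p.2) ⁻¹' {c}) ⊆ {c / w} := by
    intro y hy
    have hy' : w * y = c := hy
    rw [Set.mem_singleton_iff, ← hy', mul_div_cancel_left₀ _ hw0]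
  exact measure_mono_null this (measure_singleton _)

variable [IsProbabilityMeasure τ]

/-- Integrability of `log ‖f‖` against a mixture of circles, for `f` entire with `f 0 ≠ 0`. -/
theorem integrable_log_norm_mconv {f : ℂ → ℂ} (hf : Differentiable ℂ f) (h0 : f 0 ≠ 0)
    (hτ : ∀ᵐ w ∂τ, ‖w‖ ≤ ρ) :
    Integrable (fun z ↦ Real.log ‖f z‖) (τ ∗ₘ unitCircleMeasure) := by
  obtain ⟨B₀, hB₀⟩ := (isCompact_closedBall (0 : ℂ) ρ).exists_bound_of_continuousOn
    hf.continuous.continuousOn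
  set B := max 1 B₀
  have hB : 1 ≤ B := le_max_left _ _
  have hm := measurable_log_norm hf
  rw [integrable_mconv_iff hm.aestronglyMeasurable]
  have hd : ∀ w : ℂ, Differentiable ℂ fun y ↦ f (w * y) := fun w ↦
    hf.comp (differentiable_id.const_mul w)
  have hi : ∀ w : ℂ, Integrable (fun y ↦ Real.log ‖f (w * y)‖) unitCircleMeasure := fun w ↦
    integrable_unitCircleMeasure (measurable_log_norm (hd w)) (circleIntegrable_log_norm (hd w) 0 1)
  refine ⟨ae_of_all _ hi, ?_⟩
  refine Integrable.mono' (integrable_const (2 * Real.log B - Real.log ‖f 0‖)) ?_ ?_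
  · exact ((hm.norm.comp measurable_mul).stronglyMeasurable.integral_prod_right'
      (ν := unitCircleMeasure)).aestronglyMeasurable
  filter_upwards [hτ] with w hw
  rw [Real.norm_of_nonneg (integral_nonneg fun _ ↦ norm_nonneg _)]
  calc ∫ y, ‖Real.log ‖f (w * y)‖‖ ∂unitCircleMeasure
      ≤ ∫ y, (2 * Real.log B - Real.log ‖f (w * y)‖) ∂unitCircleMeasure := by
        refine integral_mono_ae (hi w).norm ((integrable_const _).sub (hi w)) ?_
        filter_upwards [ae_unitCircleMeasure_norm_eq_one] with y hy
        refine abs_log_le (norm_nonneg _) hB ((hB₀ _ ?_).trans (le_max_right _ _))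
        rw [mem_closedBall_zero_iff, norm_mul, hy, mul_one]
        exact hw
    _ = 2 * Real.log B - ∫ y, Real.log ‖f (w * y)‖ ∂unitCircleMeasure := by
        rw [integral_sub (integrable_const _) (hi w), integral_const, probReal_univ, one_smul]
    _ ≤ _ := by
        rw [integral_unitCircleMeasure (measurable_log_norm (hd w))]
        have := log_norm_le_circleAverage (hd w) (by simpa using h0)
        simp only [mul_zero] at this
        linarith

theorem integrable_log_norm_mul_sub (w a : ℂ) :
    Integrable (fun y ↦ Real.log ‖w * y - a‖) unitCircleMeasure := by
  have hd : Differentiable ℂ fun y : ℂ ↦ w * y - a := (differentiable_id.const_mul w).sub_const a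
  exact integrable_unitCircleMeasure (measurable_log_norm hd) (circleIntegrable_log_norm hd 0 1)

/-- This is `max (log ‖w‖) (log ‖a‖)` for `a ≠ 0`, the potential of the circle of radius `‖w‖` at
`a`: after scaling, the mean of `log ‖y - b‖` over the unit circle is `log⁺ ‖b‖`. -/
theorem integral_log_norm_mul_sub {w : ℂ} (hw : w ≠ 0) (a : ℂ) :
    ∫ y, Real.log ‖w * y - a‖ ∂unitCircleMeasure =
      Real.log ‖w‖ + Real.posLog ‖a / w‖ := by
  have hi := integrable_log_norm_mul_sub 1 (a / w)
  simp only [one_mul] at hi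
  have h1 : (fun y ↦ Real.log ‖w * y - a‖) =ᵐ[unitCircleMeasure]
      fun y ↦ Real.log ‖w‖ + Real.log ‖y - a / w‖ := by
    -- At this point `log 0 = 0` breaks the product rule for the logarithm, so it is discarded as a
    -- null set.
    have h2 : ∀ᵐ y ∂unitCircleMeasure, y ≠ a / w := by
      rw [ae_iff]
      simp
    filter_upwards [h2] with y hy
    rw [← Real.log_mul (norm_ne_zero_iff.2 hw) (norm_ne_zero_iff.2 (sub_ne_zero.2 hy)), ← norm_mul,
      mul_sub, mul_div_cancel₀ _ hw]
  rw [integral_congr_ae h1, integral_add (integrable_const _) hi, integral_const, probReal_univ,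
    one_smul, integral_unitCircleMeasure (by fun_prop), circleAverage_log_norm_sub_const_eq_posLog]

/-- Every circle contributes at least `log ‖w‖ ≥ log m ≥ 0`, whatever the position of `a`. Together
with `‖z - a‖ ≤ 2ρ` this also controls the absolute value through `abs_log_le`. -/
theorem integrable_log_norm_sub_mconv (hm : 1 ≤ m) (hτ : ∀ᵐ w ∂τ, m ≤ ‖w‖ ∧ ‖w‖ ≤ ρ)
    {a : ℂ} (ha : ‖a‖ ≤ ρ) :
    Integrable (fun z ↦ Real.log ‖z - a‖) (τ ∗ₘ unitCircleMeasure) ∧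
      ∫ z, ‖Real.log ‖z - a‖‖ ∂(τ ∗ₘ unitCircleMeasure) ≤ 2 * Real.log (2 * ρ) ∧
      Real.log m ≤ ∫ z, Real.log ‖z - a‖ ∂(τ ∗ₘ unitCircleMeasure) := by
  have hmeas : Measurable fun z : ℂ ↦ Real.log ‖z - a‖ := by fun_prop
  have hρ : 1 ≤ ρ := by
    obtain ⟨w, hw1, hw2⟩ := hτ.exists
    linarith
  have hbd : ∀ᵐ w ∂τ, ∫ y, ‖Real.log ‖w * y - a‖‖ ∂unitCircleMeasure ≤ 2 * Real.log (2 * ρ) := by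
    filter_upwards [hτ] with w hw
    calc ∫ y, ‖Real.log ‖w * y - a‖‖ ∂unitCircleMeasure
        ≤ ∫ y, (2 * Real.log (2 * ρ) - Real.log ‖w * y - a‖) ∂unitCircleMeasure := by
          refine integral_mono_ae (integrable_log_norm_mul_sub w a).norm
            ((integrable_const _).sub (integrable_log_norm_mul_sub w a)) ?_
          filter_upwards [ae_unitCircleMeasure_norm_eq_one] with y hy
          refine abs_log_le (norm_nonneg _) (by linarith) ((norm_sub_le _ _).trans ?_)
          rw [norm_mul, hy, mul_one]
          linarith [hw.2]
      _ ≤ _ := by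
          rw [integral_sub (integrable_const _) (integrable_log_norm_mul_sub w a), integral_const,
            probReal_univ, one_smul,
            integral_log_norm_mul_sub (norm_pos_iff.1 (by linarith [hw.1]))]
          have h1 : 0 ≤ Real.log ‖w‖ := Real.log_nonneg (by linarith [hw.1])
          have h2 : 0 ≤ Real.posLog ‖a / w‖ := Real.posLog_nonneg
          linarith
  have hint : Integrable (fun z ↦ Real.log ‖z - a‖) (τ ∗ₘ unitCircleMeasure) := by
    rw [integrable_mconv_iff hmeas.aestronglyMeasurable]
    refine ⟨ae_of_all _ fun w ↦ integrable_log_norm_mul_sub w a,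
      Integrable.mono' (integrable_const (2 * Real.log (2 * ρ))) ?_ ?_⟩
    · exact ((hmeas.norm.comp measurable_mul).stronglyMeasurable.integral_prod_right'
        (ν := unitCircleMeasure)).aestronglyMeasurable
    · filter_upwards [hbd] with w hw
      rwa [Real.norm_of_nonneg (integral_nonneg fun _ ↦ norm_nonneg _)]
  refine ⟨hint, ?_, ?_⟩
  · rw [integral_mconv hint.norm]
    refine (integral_mono_of_nonneg (ae_of_all _ fun w ↦ integral_nonneg fun _ ↦ norm_nonneg _)
      (integrable_const _) hbd).trans (le_of_eq ?_)
    rw [integral_const, probReal_univ, one_smul]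
  · rw [integral_mconv hint]
    calc Real.log m = ∫ _, Real.log m ∂τ := by rw [integral_const, probReal_univ, one_smul]
      _ ≤ _ := by
        refine integral_mono_ae (integrable_const _)
          ((integrable_mconv_iff hmeas.aestronglyMeasurable).1 hint |>.2.mono' ?_ ?_) ?_
        · exact ((hmeas.comp measurable_mul).stronglyMeasurable.integral_prod_right'
            (ν := unitCircleMeasure)).aestronglyMeasurable
        · exact ae_of_all _ fun w ↦ norm_integral_le_integral_norm _
        · filter_upwards [hτ] with w hw
          rw [integral_log_norm_mul_sub (norm_pos_iff.1 (by linarith [hw.1]))]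
          have h1 : Real.log m ≤ Real.log ‖w‖ := Real.log_le_log (by linarith) hw.1
          have h2 : 0 ≤ Real.posLog ‖a / w‖ := Real.posLog_nonneg
          linarith

end Mixture

/-- Jensen's inequality for the exponential, as a bound for a lower integral. -/
theorem ofReal_exp_integral_le_lintegral {α : Type*} [MeasurableSpace α] {μ : Measure α}
    [IsProbabilityMeasure μ] {h : α → ℝ} (hh : Integrable h μ) :
    ENNReal.ofReal (Real.exp (∫ x, h x ∂μ)) ≤ ∫⁻ x, ENNReal.ofReal (Real.exp (h x)) ∂μ := by
  by_cases hi : Integrable (fun x ↦ Real.exp (h x)) μ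
  · rw [← ofReal_integral_eq_lintegral_ofReal hi (ae_of_all _ fun x ↦ (Real.exp_pos _).le)]
    exact ENNReal.ofReal_le_ofReal (convexOn_exp.map_integral_le Real.continuous_exp.continuousOn
      isClosed_univ (ae_of_all _ fun _ ↦ Set.mem_univ _) hh hi)
  · have : ∫⁻ x, ENNReal.ofReal (Real.exp (h x)) ∂μ = ⊤ := by
      by_contra hne
      refine hi ⟨(Real.measurable_exp.comp_aemeasurable hh.aemeasurable).aestronglyMeasurable, ?_⟩
      rw [hasFiniteIntegral_iff_ofReal (ae_of_all _ fun x ↦ (Real.exp_pos _).le)]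
      exact lt_top_iff_ne_top.2 hne
    rw [this]
    exact le_top

/-! ### Logarithmic energy of random points and the exponential moment -/

section Pairs

variable {N : ℕ} {σ : Fin N → Measure ℂ} [∀ i, IsProbabilityMeasure (σ i)]

theorem map_pair_pi {i j : Fin N} (hij : i ≠ j) :
    (Measure.pi σ).map (fun w ↦ (w i, w j)) = (σ i).prod (σ j) := by
  have h := (iIndepFun_pi (μ := σ) (X := fun _ ↦ id) fun i ↦ aemeasurable_id).indepFun hij
  have h2 := h.map_prod_eq_prod_map_map (measurable_pi_apply i).aemeasurable
    (measurable_pi_apply j).aemeasurable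
  rw [h2]
  congr 1
  · exact (measurePreserving_eval σ i).map_eq
  · exact (measurePreserving_eval σ j).map_eq

/-- Distinctness is needed because `exp (2 log x) = x²` fails at `x = 0` under the convention `log 0
= 0`. -/
theorem ae_pi_ne [∀ i, NullSingletonClass (σ i)] {i j : Fin N} (hij : i ≠ j) :
    ∀ᵐ w ∂Measure.pi σ, w i ≠ w j := by
  have hd : MeasurableSet {p : ℂ × ℂ | p.1 ≠ p.2} :=
    (measurableSet_eq_fun measurable_fst measurable_snd).compl
  have h : ∀ᵐ p ∂((Measure.pi σ).map (fun w ↦ (w i, w j))), p.1 ≠ p.2 := by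
    rw [map_pair_pi hij, Measure.ae_prod_iff_ae_ae hd]
    refine ae_of_all _ fun x ↦ ?_
    rw [ae_iff]
    have : {a : ℂ | ¬ x ≠ a} = {x} := by
      ext a
      simp [eq_comm]
    rw [this, measure_singleton]
  exact ae_of_ae_map ((measurable_pi_apply i).prodMk (measurable_pi_apply j)).aemeasurable h

end Pairs

section Energy

variable {N : ℕ} {τ : Fin N → Measure ℂ} [∀ i, IsProbabilityMeasure (τ i)] {m : Fin N → ℝ} {ρ : ℝ}

/-- With `w i` frozen, averaging over the rotations of `w j` alone already gives `log (m j)`. It is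
applied with `i < j`, the larger index carrying the larger sample radius. -/
theorem integral_log_norm_sub_pi_ge (hm : ∀ i, 1 ≤ m i)
    (hτ : ∀ i, ∀ᵐ w ∂τ i, m i ≤ ‖w‖ ∧ ‖w‖ ≤ ρ) {i j : Fin N} (hij : i ≠ j) :
    Integrable (fun w : Fin N → ℂ ↦ Real.log ‖w j - w i‖)
        (Measure.pi fun i ↦ τ i ∗ₘ unitCircleMeasure) ∧
      Real.log (m j) ≤ ∫ w : Fin N → ℂ, Real.log ‖w j - w i‖
        ∂(Measure.pi fun i ↦ τ i ∗ₘ unitCircleMeasure) := by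
  set σ : Fin N → Measure ℂ := fun i ↦ τ i ∗ₘ unitCircleMeasure
  have hmeas : Measurable fun p : ℂ × ℂ ↦ Real.log ‖p.2 - p.1‖ := by fun_prop
  have hpair : Measurable fun w : Fin N → ℂ ↦ (w i, w j) :=
    (measurable_pi_apply i).prodMk (measurable_pi_apply j)
  have hsupp : ∀ᵐ a ∂σ i, ‖a‖ ≤ ρ :=
    ae_mconv_unitCircleMeasure (p := fun x ↦ x ≤ ρ) measurableSet_Iic
      ((hτ i).mono fun w hw ↦ hw.2)
  have hint : Integrable (fun p : ℂ × ℂ ↦ Real.log ‖p.2 - p.1‖) ((σ i).prod (σ j)) := by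
    rw [integrable_prod_iff hmeas.aestronglyMeasurable]
    refine ⟨hsupp.mono fun a ha ↦ (integrable_log_norm_sub_mconv (hm j) (hτ j) ha).1,
      Integrable.mono' (integrable_const (2 * Real.log (2 * ρ))) ?_
        (hsupp.mono fun a ha ↦ ?_)⟩
    · exact (hmeas.norm.stronglyMeasurable.integral_prod_right' (ν := σ j)).aestronglyMeasurable
    · rw [Real.norm_of_nonneg (integral_nonneg fun _ ↦ norm_nonneg _)]
      exact (integrable_log_norm_sub_mconv (hm j) (hτ j) ha).2.1
  have hmap := map_pair_pi (σ := σ) hij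
  refine ⟨?_, ?_⟩
  · have := hint
    rw [← hmap, integrable_map_measure hmeas.aestronglyMeasurable hpair.aemeasurable] at this
    exact this
  · have h1 : ∫ w : Fin N → ℂ, Real.log ‖w j - w i‖ ∂(Measure.pi σ) =
        ∫ p : ℂ × ℂ, Real.log ‖p.2 - p.1‖ ∂((σ i).prod (σ j)) := by
      rw [← hmap, integral_map hpair.aemeasurable hmeas.aestronglyMeasurable]
    rw [h1, integral_prod _ hint]
    calc Real.log (m j) = ∫ _, Real.log (m j) ∂σ i := by
          rw [integral_const, probReal_univ, one_smul]
      _ ≤ _ := by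
          refine integral_mono_ae (integrable_const _) hint.integral_prod_left
            (hsupp.mono fun a ha ↦ ?_)
          exact (integrable_log_norm_sub_mconv (hm j) (hτ j) ha).2.2

end Energy

/-- The function `ζ ↦ ‖ζ‖ ^ (-2 s)`, cut off outside the disk of radius `B`. -/
def truncatedPower (s B : ℝ) : ℂ → ENNReal :=
  (Metric.closedBall 0 B).indicator fun ζ ↦ ENNReal.ofReal (Real.exp (-2 * s * Real.log ‖ζ‖))

theorem measurable_truncatedPower (s B : ℝ) : Measurable (truncatedPower s B) :=
  Measurable.indicator (by fun_prop) measurableSet_closedBall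

/-- Polar coordinates: `s < 1` gives integrability at the origin, and the cutoff at `B` at infinity.
-/
theorem lintegral_truncatedPower_le {s B : ℝ} (hs : s < 1) (hB : 0 < B) :
    ENNReal.ofReal Real.pi⁻¹ * ∫⁻ ζ, truncatedPower s B ζ ≤
      ENNReal.ofReal (B ^ (2 * (1 - s)) / (1 - s)) := by
  have hs' : 0 < 1 - s := by linarith
  let f : ℝ → ℝ := (Set.Iic B).indicator fun y ↦ y ^ (-2 * s)
  have h1 : ∫⁻ ζ, truncatedPower s B ζ = ∫⁻ ζ : ℂ, ENNReal.ofReal (f ‖ζ‖) := by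
    -- At `ζ = 0` the exponential of the logarithm and the real power can disagree by convention; a
    -- single point is negligible.
    refine lintegral_congr_ae ?_
    have h0 : ∀ᵐ ζ : ℂ, ζ ≠ 0 := by
      rw [ae_iff]
      simp
    filter_upwards [h0] with ζ hζ
    have hζ' : 0 < ‖ζ‖ := norm_pos_iff.2 hζ
    by_cases hb : ‖ζ‖ ≤ B
    · have hb2 : ζ ∈ Metric.closedBall (0 : ℂ) B := by simpa using hb
      have hb3 : ‖ζ‖ ∈ Set.Iic B := hb
      simp only [truncatedPower, f, Set.indicator_of_mem hb2, Set.indicator_of_mem hb3]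
      rw [Real.rpow_def_of_pos hζ', mul_comm (Real.log ‖ζ‖)]
    · have hb2 : ζ ∉ Metric.closedBall (0 : ℂ) B := by simpa using hb
      have hb3 : ‖ζ‖ ∉ Set.Iic B := hb
      simp only [truncatedPower, f, Set.indicator_of_notMem hb2, Set.indicator_of_notMem hb3,
        ENNReal.ofReal_zero]
  have hf0 : ∀ y, 0 ≤ y → 0 ≤ f y := fun y hy ↦
    Set.indicator_apply_nonneg fun _ ↦ Real.rpow_nonneg hy _
  have hEq : Set.EqOn (fun y : ℝ ↦ y ^ (Module.finrank ℝ ℂ - 1) • f y)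
      ((Set.Ioc 0 B).indicator fun y ↦ y ^ (1 - 2 * s)) (Set.Ioi 0) := by
    intro y hy
    have hy' : 0 < y := hy
    rw [Complex.finrank_real_complex]
    by_cases hb : y ≤ B
    · have hb3 : y ∈ Set.Iic B := hb
      have hb4 : y ∈ Set.Ioc 0 B := ⟨hy', hb⟩
      simp only [f, Set.indicator_of_mem hb3, Set.indicator_of_mem hb4, smul_eq_mul]
      rw [sub_eq_add_neg, Real.rpow_add hy', Real.rpow_one]
      norm_num
    · have hb3 : y ∉ Set.Iic B := hb
      have hb4 : y ∉ Set.Ioc 0 B := fun h ↦ hb h.2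
      simp only [f, Set.indicator_of_notMem hb3, Set.indicator_of_notMem hb4, smul_zero]
  have hint : IntervalIntegrable (fun y : ℝ ↦ y ^ (1 - 2 * s)) volume 0 B :=
    intervalIntegral.intervalIntegrable_rpow' (by linarith)
  have hint2 : IntegrableOn (fun y : ℝ ↦ y ^ (1 - 2 * s)) (Set.Ioc 0 B) :=
    (intervalIntegrable_iff_integrableOn_Ioc_of_le hB.le).1 hint
  have h2 : Integrable (fun ζ : ℂ ↦ f ‖ζ‖) := by
    rw [integrable_fun_norm_addHaar volume (f := f)]
    refine IntegrableOn.congr_fun ?_ (fun y hy ↦ (hEq hy).symm) measurableSet_Ioi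
    exact ((integrable_indicator_iff measurableSet_Ioc).2 hint2).integrableOn
  have h3 : ∫ ζ : ℂ, f ‖ζ‖ = Real.pi * (B ^ (2 * (1 - s)) / (1 - s)) := by
    rw [integral_fun_norm_addHaar volume f, setIntegral_congr_fun measurableSet_Ioi hEq,
      setIntegral_indicator measurableSet_Ioc, Complex.finrank_real_complex,
      Set.inter_eq_right.2 Set.Ioc_subset_Ioi_self, ← intervalIntegral.integral_of_le hB.le,
      integral_rpow (Or.inl (by linarith)), Measure.real, Complex.volume_ball]
    simp only [ENNReal.ofReal_one, one_pow, one_mul, ENNReal.coe_toReal, NNReal.coe_real_pi,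
      smul_eq_mul, nsmul_eq_mul]
    rw [Real.zero_rpow (by linarith), show 1 - 2 * s + 1 = 2 * (1 - s) by ring]
    push_cast
    field_simp
    ring
  rw [h1, ← ofReal_integral_eq_lintegral_ofReal h2 (ae_of_all _ fun ζ ↦ hf0 _ (norm_nonneg _)), h3,
    ← ENNReal.ofReal_mul (by positivity), inv_mul_cancel_left₀ Real.pi_ne_zero]

section

variable {N : ℕ} {τ : Fin N → Measure ℂ} [∀ i, IsProbabilityMeasure (τ i)] {m : Fin N → ℝ} {ρ : ℝ}

/-- Almost everywhere the integrand on the right is the exponential of pair energies minus `2 s`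
times the logarithms of `‖f‖`. Jensen's inequality moves the average into the exponent, where pairs
are bounded below by `integral_log_norm_sub_pi_ge`. The cutoff is inactive because `‖f‖ ≤ B` on the
support. -/
theorem ofReal_exp_energy_sub_le {f : ℂ → ℂ} (hf : Differentiable ℂ f) (h0 : f 0 ≠ 0)
    {r s B : ℝ} (hr : 0 < r) (hfB : ∀ w : ℂ, ‖w‖ ≤ ρ → ‖f (r * w)‖ ≤ B)
    (hm : ∀ i, 1 ≤ m i) (hτ : ∀ i, ∀ᵐ w ∂τ i, m i ≤ ‖w‖ ∧ ‖w‖ ≤ ρ) :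
    ENNReal.ofReal (Real.exp (∑ i : Fin N, ∑ j ∈ Finset.Ioi i, 2 * (Real.log r + Real.log (m j)))) *
        ENNReal.ofReal (Real.exp (-2 * s * ∑ j, ∫ w, Real.log ‖f (r * w)‖
          ∂(τ j ∗ₘ unitCircleMeasure))) ≤
      ∫⁻ w, (∏ j, truncatedPower s B (f (r * w j))) *
          ENNReal.ofReal (∏ i : Fin N, ∏ j > i, ‖(r : ℂ) * w j - r * w i‖ ^ 2)
        ∂(Measure.pi fun i ↦ τ i ∗ₘ unitCircleMeasure) := by
  set σ : Fin N → Measure ℂ := fun i ↦ τ i ∗ₘ unitCircleMeasure with hσ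
  have hne : ∀ i, ∀ᵐ w ∂τ i, w ≠ 0 := fun i ↦ (hτ i).mono fun w hw ↦
    norm_pos_iff.1 (by linarith [hw.1, hm i])
  have : ∀ i, NullSingletonClass (σ i) := fun i ↦
    nullSingletonClass_mconv_unitCircleMeasure (hne i)
  have hd : Differentiable ℂ fun w ↦ f (r * w) := hf.comp (differentiable_id.const_mul _)
  have hFi : ∀ j, Integrable (fun w ↦ Real.log ‖f (r * w)‖) (σ j) := fun j ↦
    integrable_log_norm_mconv hd (by simpa using h0) ((hτ j).mono fun w hw ↦ hw.2)
  have hEi := fun (i j : Fin N) (hij : i ≠ j) ↦ integral_log_norm_sub_pi_ge (N := N) hm hτ hij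
  have hI1 : ∀ i : Fin N, ∀ j ∈ Finset.Ioi i, Integrable (fun w : Fin N → ℂ ↦
      2 * (Real.log r + Real.log ‖w j - w i‖)) (Measure.pi σ) := fun i j hj ↦
    ((integrable_const _).add (hEi i j (Finset.mem_Ioi.1 hj).ne).1).const_mul 2
  have hI2 : ∀ j : Fin N, Integrable (fun w : Fin N → ℂ ↦ Real.log ‖f (r * w j)‖)
      (Measure.pi σ) := fun j ↦
    integrable_comp_eval (μ := σ) (i := j) (f := fun w ↦ Real.log ‖f (r * w)‖) (hFi j)
  have hV2 : ∀ j : Fin N, ∫ w : Fin N → ℂ, Real.log ‖f (r * w j)‖ ∂(Measure.pi σ) =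
      ∫ w, Real.log ‖f (r * w)‖ ∂σ j := fun j ↦
    integral_comp_eval (μ := σ) (i := j) (f := fun w ↦ Real.log ‖f (r * w)‖)
      (hFi j).aestronglyMeasurable
  set h : (Fin N → ℂ) → ℝ := fun w ↦
    (∑ i : Fin N, ∑ j ∈ Finset.Ioi i, 2 * (Real.log r + Real.log ‖w j - w i‖)) +
      -2 * s * ∑ j, Real.log ‖f (r * w j)‖ with hh
  have hIs : Integrable (fun w : Fin N → ℂ ↦
      ∑ i : Fin N, ∑ j ∈ Finset.Ioi i, 2 * (Real.log r + Real.log ‖w j - w i‖)) (Measure.pi σ) :=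
    integrable_finsetSum _ fun i _ ↦ integrable_finsetSum _ fun j hj ↦ hI1 i j hj
  have hIf : Integrable (fun w : Fin N → ℂ ↦ -2 * s * ∑ j, Real.log ‖f (r * w j)‖)
      (Measure.pi σ) := (integrable_finsetSum _ fun j _ ↦ hI2 j).const_mul _
  have hint : Integrable h (Measure.pi σ) := hIs.add hIf
  have hge : (∑ i : Fin N, ∑ j ∈ Finset.Ioi i, 2 * (Real.log r + Real.log (m j))) +
      -2 * s * ∑ j, ∫ w, Real.log ‖f (r * w)‖ ∂σ j ≤ ∫ w, h w ∂(Measure.pi σ) := by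
    rw [hh, integral_add hIs hIf, integral_const_mul, integral_finsetSum _ fun j _ ↦ hI2 j,
      integral_finsetSum _ fun i _ ↦ integrable_finsetSum _ fun j hj ↦ hI1 i j hj]
    simp_rw [hV2]
    gcongr with i _
    rw [integral_finsetSum _ fun j hj ↦ hI1 i j hj]
    refine Finset.sum_le_sum fun j hj ↦ ?_
    have hE := hEi i j (Finset.mem_Ioi.1 hj).ne
    rw [integral_const_mul, integral_add (integrable_const _) hE.1, integral_const, probReal_univ,
      one_smul]
    linarith [hE.2]
  rw [← ENNReal.ofReal_mul (Real.exp_pos _).le, ← Real.exp_add]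
  refine (ENNReal.ofReal_le_ofReal (Real.exp_le_exp.2 hge)).trans
    ((ofReal_exp_integral_le_lintegral hint).trans (lintegral_mono_ae ?_))
  have hae1 : ∀ᵐ w ∂Measure.pi σ, ∀ i : Fin N, ∀ j : Fin N, i ≠ j → w i ≠ w j := by
    rw [ae_all_iff]
    intro i
    rw [ae_all_iff]
    intro j
    by_cases hij : i = j
    · exact ae_of_all _ fun w h ↦ absurd hij h
    · filter_upwards [ae_pi_ne (σ := σ) hij] with w hw _ using hw
  have hae2 : ∀ᵐ w ∂Measure.pi σ, ∀ j : Fin N, ‖w j‖ ≤ ρ := by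
    rw [ae_all_iff]
    intro j
    have h1 : ∀ᵐ a ∂σ j, ‖a‖ ≤ ρ :=
      ae_mconv_unitCircleMeasure (p := fun x ↦ x ≤ ρ) measurableSet_Iic
        ((hτ j).mono fun w hw ↦ hw.2)
    exact (measurePreserving_eval σ j).quasiMeasurePreserving.ae h1
  filter_upwards [hae1, hae2] with w hw1 hw2
  refine le_of_eq ?_
  rw [hh]
  simp only
  rw [Real.exp_add, ENNReal.ofReal_mul (Real.exp_pos _).le, mul_comm]
  congr 1
  · rw [Finset.mul_sum, Real.exp_sum, ENNReal.ofReal_prod_of_nonneg fun j _ ↦ (Real.exp_pos _).le]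
    refine Finset.prod_congr rfl fun j _ ↦ ?_
    rw [truncatedPower, Set.indicator_of_mem]
    simpa using hfB _ (hw2 j)
  · congr 1
    rw [Real.exp_sum]
    refine Finset.prod_congr rfl fun i _ ↦ ?_
    rw [Real.exp_sum]
    refine Finset.prod_congr rfl fun j hj ↦ ?_
    have hwn : 0 < ‖w j - w i‖ :=
      norm_pos_iff.2 (sub_ne_zero.2 (hw1 j i (Finset.mem_Ioi.1 hj).ne'))
    rw [← mul_sub, norm_mul, Complex.norm_real, Real.norm_of_nonneg hr.le,
      ← Real.log_mul hr.ne' hwn.ne', mul_comm 2, Real.exp_mul, Real.exp_log (by positivity)]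
    norm_cast

/-- The index `j` occurs once for each `i < j`; this produces the exponent `2 k` of the radius `m
k`. -/
theorem sum_Ioi_eq_sum_mul (N : ℕ) (a : ℕ → ℝ) :
    ∑ i : Fin N, ∑ j ∈ Finset.Ioi i, a j = ∑ k ∈ Finset.range N, (k : ℝ) * a k := by
  rw [Finset.sum_comm' (t' := Finset.univ) (s' := fun j ↦ Finset.Iio j) (by simp)]
  rw [← Fin.sum_univ_eq_sum_range (fun k ↦ (k : ℝ) * a k) N]
  refine Finset.sum_congr rfl fun j _ ↦ ?_
  rw [Finset.sum_const, Fin.card_Iio, nsmul_eq_mul]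

end

variable {Ω : Type*} [MeasurableSpace Ω] {P : Measure Ω} [IsProbabilityMeasure P]
  {ξ : ℕ → Ω → ℂ}

/-- The main large deviation bound: an exponential moment of the weighted logarithmic potential
`∑ ∫ log ‖F (r w)‖ dσ_j(w)`, where `σ_j` is a mixture of centred circles of radii at least `m_j`. -/
theorem lintegral_exp_neg_potential_le (hmeas : ∀ k, Measurable (ξ k))
    (hlaw : ∀ k, P.map (ξ k) = stdComplexGaussian) (hindep : iIndepFun ξ P)
    {N : ℕ} {τ : Fin N → Measure ℂ} [∀ i, IsProbabilityMeasure (τ i)] {m : ℕ → ℝ} {ρ : ℝ}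
    (hm : ∀ i, 1 ≤ m i) (hτ : ∀ i : Fin N, ∀ᵐ w ∂τ i, m i ≤ ‖w‖ ∧ ‖w‖ ≤ ρ)
    {r s B : ℝ} (hr : 0 < r) (hs : s < 1) (hB : 0 < B) {G : Set Ω} (hG : MeasurableSet G)
    (hGF : ∀ ω ∈ G, Differentiable ℂ (gef ξ ω) ∧ gef ξ ω 0 ≠ 0 ∧
      ∀ w : ℂ, ‖w‖ ≤ ρ → ‖gef ξ ω (r * w)‖ ≤ B) :
    ∫⁻ ω in G, ENNReal.ofReal (Real.exp (-2 * s * ∑ j, ∫ w, Real.log ‖gef ξ ω (r * w)‖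
        ∂(τ j ∗ₘ unitCircleMeasure))) ∂P ≤
      ENNReal.ofReal (∏ k ∈ Finset.range N,
        ((k.factorial : ℝ) / (r * m k) ^ (2 * k) * (B ^ (2 * (1 - s)) / (1 - s)))) := by
  have hs' : 0 < 1 - s := by linarith
  set σ : Fin N → Measure ℂ := fun i ↦ τ i ∗ₘ unitCircleMeasure with hσ
  set E : ℝ := ∑ i : Fin N, ∑ j ∈ Finset.Ioi i, 2 * (Real.log r + Real.log (m j)) with hE
  have hEexp : Real.exp E = ∏ k ∈ Finset.range N, (r * m k) ^ (2 * k) := by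
    rw [hE, sum_Ioi_eq_sum_mul N fun k ↦ 2 * (Real.log r + Real.log (m k)), Real.exp_sum]
    refine Finset.prod_congr rfl fun k _ ↦ ?_
    have hmk : 0 < m k := by linarith [hm k]
    rw [← Real.log_mul hr.ne' hmk.ne', ← mul_assoc, mul_comm _ (Real.log _), Real.exp_mul,
      Real.exp_log (by positivity), mul_comm _ (2 : ℝ)]
    exact_mod_cast Real.rpow_natCast (r * m k) (2 * k)
  set LHS := ∫⁻ ω in G, ENNReal.ofReal (Real.exp (-2 * s * ∑ j, ∫ w, Real.log ‖gef ξ ω (r * w)‖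
        ∂(τ j ∗ₘ unitCircleMeasure))) ∂P with hLHS
  let Ψ : Ω → (Fin N → ℂ) → ENNReal := fun ω w ↦
    (∏ j, truncatedPower s B (gef ξ ω (r * w j))) *
      ENNReal.ofReal (∏ i : Fin N, ∏ j > i, ‖(r : ℂ) * w j - r * w i‖ ^ 2)
  have hΨ : Measurable (Function.uncurry Ψ) := by
    refine Measurable.mul (Finset.measurable_prod _ fun j _ ↦
      (measurable_truncatedPower s B).comp ((measurable_gef_uncurry hmeas).comp
        (measurable_fst.prodMk (((measurable_pi_apply j).comp measurable_snd).const_mul _)))) ?_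
    refine ENNReal.measurable_ofReal.comp (Finset.measurable_prod _ fun i _ ↦
      Finset.measurable_prod _ fun j _ ↦ ?_)
    exact ((((measurable_pi_apply j).comp measurable_snd).const_mul _).sub
      (((measurable_pi_apply i).comp measurable_snd).const_mul _)).norm.pow_const 2
  have h1 : ENNReal.ofReal (Real.exp E) * LHS ≤
      ∫⁻ ω in G, ∫⁻ w, Ψ ω w ∂(Measure.pi σ) ∂P := by
    rw [hLHS, ← lintegral_const_mul' _ _ ENNReal.ofReal_ne_top]
    refine setLIntegral_mono' hG fun ω hω ↦ ?_
    obtain ⟨hd, h0, hb⟩ := hGF ω hω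
    exact ofReal_exp_energy_sub_le (m := fun i : Fin N ↦ m i) hd h0 hr hb (fun i ↦ hm i) hτ
  have h2 : ∫⁻ ω in G, ∫⁻ w, Ψ ω w ∂(Measure.pi σ) ∂P ≤
      ∫⁻ ω, ∫⁻ w, Ψ ω w ∂(Measure.pi σ) ∂P := setLIntegral_le_lintegral _ _
  -- After Tonelli the sample points are fixed while `ω` varies, which is the setting of the density
  -- bound.
  have h3 : ∫⁻ ω, ∫⁻ w, Ψ ω w ∂(Measure.pi σ) ∂P = ∫⁻ w, ∫⁻ ω, Ψ ω w ∂P ∂(Measure.pi σ) :=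
    lintegral_lintegral_swap hΨ.aemeasurable
  have h4 : ∫⁻ w, ∫⁻ ω, Ψ ω w ∂P ∂(Measure.pi σ) ≤
      ENNReal.ofReal (∏ k ∈ Finset.range N, (k.factorial : ℝ)) *
        ENNReal.ofReal (B ^ (2 * (1 - s)) / (1 - s)) ^ N := by
    calc ∫⁻ w, ∫⁻ ω, Ψ ω w ∂P ∂(Measure.pi σ)
        ≤ ∫⁻ _, ENNReal.ofReal (∏ k ∈ Finset.range N, (k.factorial : ℝ)) *
          ENNReal.ofReal (B ^ (2 * (1 - s)) / (1 - s)) ^ N ∂(Measure.pi σ) := by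
          refine lintegral_mono fun w ↦ ?_
          change ∫⁻ ω, (∏ j, truncatedPower s B (gef ξ ω (r * w j))) * _ ∂P ≤ _
          rw [lintegral_mul_const' _ _ ENNReal.ofReal_ne_top]
          refine (lintegral_prod_gef_mul_le hmeas hlaw hindep (fun j ↦ (r : ℂ) * w j)
            (measurable_truncatedPower s B)).trans ?_
          gcongr
          exact lintegral_truncatedPower_le hs hB
      _ = _ := by rw [lintegral_const, measure_univ, mul_one]
  have h5 := h1.trans (h2.trans (h3.le.trans h4))
  have hpos : 0 < Real.exp E := Real.exp_pos E
  have h6 : LHS ≤ ENNReal.ofReal (Real.exp E)⁻¹ *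
      (ENNReal.ofReal (∏ k ∈ Finset.range N, (k.factorial : ℝ)) *
        ENNReal.ofReal (B ^ (2 * (1 - s)) / (1 - s)) ^ N) := by
    calc LHS = ENNReal.ofReal (Real.exp E)⁻¹ * (ENNReal.ofReal (Real.exp E) * LHS) := by
          rw [← mul_assoc, ← ENNReal.ofReal_mul (by positivity), inv_mul_cancel₀ hpos.ne',
            ENNReal.ofReal_one, one_mul]
      _ ≤ _ := by gcongr
  refine h6.trans (le_of_eq ?_)
  rw [← ENNReal.ofReal_pow (by positivity), ← ENNReal.ofReal_mul (by positivity),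
    ← ENNReal.ofReal_mul (by positivity), hEexp, Finset.prod_mul_distrib, Finset.prod_div_distrib,
    Finset.prod_const, Finset.card_range]
  congr 1
  ring

/-! ### Factorials and a lower bound for the hole probability -/

/-- Stirling's upper bound with the crude factor `e k`. The induction step is `(1 + 1/k)^(k+1) ≥ e`,
from `1 - x ≤ exp (-x)` at `x = 1/(k+1)`. -/
theorem factorial_mul_exp_le {k : ℕ} (hk : 1 ≤ k) :
    (k.factorial : ℝ) * Real.exp k ≤ Real.exp 1 * k * (k : ℝ) ^ k := by
  induction k, hk using Nat.le_induction with
  | base => simp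
  | succ k hk ih =>
    have hk0 : (0 : ℝ) < k := by exact_mod_cast hk
    rw [Nat.factorial_succ]
    push_cast
    rw [Real.exp_add]
    have h1 : Real.exp 1 * (k : ℝ) ^ (k + 1) ≤ ((k : ℝ) + 1) ^ (k + 1) := by
      have h2 : (k : ℝ) / (k + 1) ≤ Real.exp (-(1 / ((k : ℝ) + 1))) := by
        have := Real.add_one_le_exp (-(1 / ((k : ℝ) + 1)))
        refine le_trans (le_of_eq ?_) this
        field_simp
        ring
      have h3 := pow_le_pow_left₀ (by positivity) h2 (k + 1)
      rw [← Real.exp_nat_mul, div_pow, div_le_iff₀ (by positivity)] at h3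
      have h4 : ((k + 1 : ℕ) : ℝ) * -(1 / ((k : ℝ) + 1)) = -1 := by
        push_cast
        field_simp
      rw [h4, Real.exp_neg] at h3
      have h5 := mul_le_mul_of_nonneg_left h3 (Real.exp_pos 1).le
      rwa [← mul_assoc, mul_inv_cancel₀ (Real.exp_pos 1).ne', one_mul] at h5
    calc ((k : ℝ) + 1) * k.factorial * (Real.exp k * Real.exp 1)
        = (k + 1) * Real.exp 1 * (k.factorial * Real.exp k) := by ring
      _ ≤ (k + 1) * Real.exp 1 * (Real.exp 1 * k * (k : ℝ) ^ k) := by gcongr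
      _ = (k + 1) * Real.exp 1 * (Real.exp 1 * (k : ℝ) ^ (k + 1)) := by ring
      _ ≤ (k + 1) * Real.exp 1 * ((k : ℝ) + 1) ^ (k + 1) := by gcongr
      _ = _ := by ring

theorem pow_self_div_factorial_le_exp (k : ℕ) : (k : ℝ) ^ k / k.factorial ≤ Real.exp k :=
  Real.pow_div_factorial_le_exp k k.cast_nonneg k

/-- At `K = ⌊e L⌋` the ratio `L^K / K!` is at most `e`, and each later index multiplies it by at
most `L/(K+1) < 1/e`. So the series of `F` on `|z| < r` needs no constraint on its terms beyond `e
r²`, apart from linear growth. -/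
theorem pow_div_factorial_floor_add_le {L : ℝ} (hL : 1 ≤ L) (n : ℕ) :
    L ^ (⌊Real.exp 1 * L⌋₊ + n) / ((⌊Real.exp 1 * L⌋₊ + n).factorial : ℝ) ≤
      Real.exp 1 * Real.exp (-n) := by
  set K := ⌊Real.exp 1 * L⌋₊ with hK
  have he : (1 : ℝ) ≤ Real.exp 1 := by
    have := Real.add_one_le_exp (1 : ℝ)
    linarith
  have hK1 : 1 ≤ K := Nat.le_floor (by push_cast; nlinarith)
  have hK0 : (0 : ℝ) < K := by exact_mod_cast hK1
  have hKL : Real.exp 1 * L < K + 1 := Nat.lt_floor_add_one _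
  induction n with
  | zero =>
    simp only [add_zero, Nat.cast_zero, neg_zero, Real.exp_zero, mul_one]
    have h1 : L ^ K / (K.factorial : ℝ) = (L / K) ^ K * ((K : ℝ) ^ K / K.factorial) := by
      rw [div_pow]
      field_simp
    calc L ^ K / (K.factorial : ℝ) = (L / K) ^ K * ((K : ℝ) ^ K / K.factorial) := h1
      _ ≤ (L / K) ^ K * Real.exp K := by
        gcongr
        exact pow_self_div_factorial_le_exp K
      _ = (Real.exp 1 * L / K) ^ K := by
        rw [← Real.exp_one_pow K, ← mul_pow]
        congr 1
        ring
      -- From `e L < K + 1` one gets `e L / K ≤ 1 + 1/K ≤ exp (1/K)`.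
      _ ≤ (Real.exp (1 / K)) ^ K := by
        gcongr
        rw [div_le_iff₀ hK0]
        have := Real.add_one_le_exp (1 / (K : ℝ))
        have h2 : (1 / (K : ℝ) + 1) * K = K + 1 := by
          field_simp
          ring
        nlinarith
      _ = Real.exp 1 := by
        rw [← Real.exp_nat_mul]
        congr 1
        field_simp
  | succ n ih =>
    have h1 : L ^ (K + (n + 1)) / ((K + (n + 1)).factorial : ℝ) =
        L ^ (K + n) / ((K + n).factorial : ℝ) * (L / (K + n + 1)) := by
      rw [← add_assoc, Nat.factorial_succ, pow_succ]
      push_cast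
      field_simp
    rw [h1]
    push_cast
    rw [neg_add, Real.exp_add, ← mul_assoc]
    refine mul_le_mul ih ?_ (by positivity) (by positivity)
    rw [Real.exp_neg, div_le_iff₀ (by positivity), ← div_eq_inv_mul, le_div_iff₀ (by positivity)]
    have : (0 : ℝ) ≤ n := n.cast_nonneg
    nlinarith

/-- A bound for `∑_{k ≥ K} ‖ξ_k‖ r^k / √(k!)` on the event where the tail grows linearly. -/
def tailConstant : ℝ := 4 * Real.exp (1 / 2) * ∑' n : ℕ, ((n : ℝ) + 1) * Real.exp (-(1 / 2)) ^ n

section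

variable {Ω : Type*} {ξ : ℕ → Ω → ℂ}

/-- The constant term dominates: the fewer than `K + 1` middle terms sum to at most `1`, and the
tail is at most `tailConstant`, uniformly in `r`. Counting the linear growth from index `K` keeps
the probability of the tail condition independent of `r`. -/
theorem mem_holeEvent_of_small_coefficients {r : ℝ} (hr : 1 ≤ r) {ω : Ω}
    (h0 : tailConstant + 1 < ‖ξ 0 ω‖)
    (h1 : ∀ k ∈ Finset.Ico 1 ⌊Real.exp 1 * r ^ 2⌋₊, ‖ξ k ω‖ * r ^ k / Real.sqrt (k.factorial : ℝ) ≤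
      1 / (⌊Real.exp 1 * r ^ 2⌋₊ + 1))
    (h2 : ω ∈ linearGrowthEvent (fun k ↦ ξ (k + ⌊Real.exp 1 * r ^ 2⌋₊)) 4) :
    ω ∈ holeEvent ξ r := by
  set K := ⌊Real.exp 1 * r ^ 2⌋₊ with hK
  have hr0 : 0 < r := by linarith
  have he : (1 : ℝ) ≤ Real.exp 1 := by
    have := Real.add_one_le_exp (1 : ℝ)
    linarith
  have hK1 : 1 ≤ K := Nat.le_floor (by push_cast; nlinarith)
  have hq : Real.exp (-(1 / 2)) < 1 := by
    rw [Real.exp_lt_one_iff]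
    norm_num
  have hsum := summable_succ_mul_geometric (Real.exp_pos (-(1 / 2))) hq
  intro z hz
  let t : ℕ → ℂ := fun k ↦ ξ k ω * (z ^ k / (Real.sqrt (k.factorial : ℝ) : ℂ))
  have hnorm : ∀ k, ‖t k‖ ≤ ‖ξ k ω‖ * r ^ k / Real.sqrt (k.factorial : ℝ) := by
    intro k
    simp only [t]
    rw [norm_mul, norm_div, norm_pow, Complex.norm_real, Real.norm_of_nonneg (Real.sqrt_nonneg _),
      mul_div_assoc]
    gcongr
  have htail : ∀ n, ‖t (n + K)‖ ≤
      4 * Real.exp (1 / 2) * (((n : ℝ) + 1) * Real.exp (-(1 / 2)) ^ n) := by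
    intro n
    have hr2 : (1 : ℝ) ≤ r ^ 2 := by nlinarith
    have h3 := pow_div_factorial_floor_add_le hr2 n
    rw [← hK] at h3
    have h4 : r ^ (n + K) / Real.sqrt ((n + K).factorial : ℝ) ≤
        Real.exp (1 / 2) * Real.exp (-(1 / 2)) ^ n := by
      refine le_of_sq_le_sq ?_ (by positivity)
      rw [div_pow, Real.sq_sqrt (by positivity), ← pow_mul, mul_comm (n + K) 2, pow_mul, add_comm n K]
      refine h3.trans (le_of_eq ?_)
      rw [mul_pow, ← Real.exp_nat_mul, ← Real.exp_nat_mul, ← Real.exp_nat_mul]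
      congr 2
      · norm_num
      · push_cast
        ring
    calc ‖t (n + K)‖ ≤ ‖ξ (n + K) ω‖ * r ^ (n + K) / Real.sqrt ((n + K).factorial : ℝ) := hnorm _
      _ = ‖ξ (n + K) ω‖ * (r ^ (n + K) / Real.sqrt ((n + K).factorial : ℝ)) := mul_div_assoc _ _ _
      _ ≤ (4 * (n + 1)) * (Real.exp (1 / 2) * Real.exp (-(1 / 2)) ^ n) :=
          mul_le_mul (h2 n) h4 (by positivity) (by positivity)
      _ = _ := by ring
  have hs : Summable t := (summable_nat_add_iff K).1
    (Summable.of_norm_bounded (hsum.mul_left _) htail)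
  have h5 : gef ξ ω z = t 0 + ∑ k ∈ Finset.Ico 1 K, t k + ∑' n, t (n + K) := by
    have h6 : gef ξ ω z = ∑' k, t k := rfl
    rw [h6, ← hs.sum_add_tsum_nat_add K, Finset.range_eq_Ico, Finset.sum_eq_sum_Ico_succ_bot hK1]
  have h6 : ‖∑' n, t (n + K)‖ ≤ tailConstant := by
    have := tsum_of_norm_bounded (hsum.hasSum.mul_left (4 * Real.exp (1 / 2))) htail
    exact this
  have h7 : ‖∑ k ∈ Finset.Ico 1 K, t k‖ ≤ 1 := by
    calc ‖∑ k ∈ Finset.Ico 1 K, t k‖ ≤ ∑ k ∈ Finset.Ico 1 K, ‖t k‖ := norm_sum_le _ _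
      _ ≤ ∑ k ∈ Finset.Ico 1 K, (1 / ((K : ℝ) + 1)) :=
          Finset.sum_le_sum fun k hk ↦ (hnorm k).trans (h1 k hk)
      _ ≤ 1 := by
          rw [Finset.sum_const, Nat.card_Ico, nsmul_eq_mul, mul_one_div,
            div_le_one (by positivity)]
          have : ((K - 1 : ℕ) : ℝ) ≤ K := by exact_mod_cast Nat.sub_le K 1
          linarith
  have h8 : t 0 = ξ 0 ω := by simp [t]
  intro h9
  rw [h5, h8] at h9
  have h10 : ξ 0 ω = -(∑ k ∈ Finset.Ico 1 K, t k + ∑' n, t (n + K)) := by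
    linear_combination h9
  have h11 := congrArg norm h10
  rw [norm_neg] at h11
  have := norm_add_le (∑ k ∈ Finset.Ico 1 K, t k) (∑' n, t (n + K))
  linarith

theorem holeEvent_anti {r r' : ℝ} (h : r ≤ r') : holeEvent ξ r' ⊆ holeEvent ξ r :=
  fun _ hω z hz ↦ hω z (hz.trans_le h)

variable [MeasurableSpace Ω] {P : Measure Ω} [IsProbabilityMeasure P]

/-- Lower bound for the hole probability, up to factors `exp (O(r² log r))`. -/
theorem exists_measure_holeEvent_ge (hmeas : ∀ k, Measurable (ξ k))
    (hlaw : ∀ k, P.map (ξ k) = stdComplexGaussian) (hindep : iIndepFun ξ P) :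
    ∃ c : ℝ, 0 < c ∧ ∀ r : ℝ, 1 ≤ r →
      ENNReal.ofReal (c * ∏ k ∈ Finset.range ⌊Real.exp 1 * r ^ 2⌋₊,
        ((k.factorial : ℝ) / (r ^ 2) ^ k / ((⌊Real.exp 1 * r ^ 2⌋₊ + 1) ^ 2 * Real.exp 3))) ≤
      P (holeEvent ξ r) := by
  have := isProbabilityMeasure_stdComplexGaussian hmeas hlaw
  set p0 : ENNReal := stdComplexGaussian {z | tailConstant + 1 < ‖z‖} with hp0
  have hp0pos : 0 < p0.toReal :=
    ENNReal.toReal_pos (stdComplexGaussian_norm_gt_pos _) (measure_ne_top _ _)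
  refine ⟨p0.toReal / 2, by positivity, fun r hr ↦ ?_⟩
  set K := ⌊Real.exp 1 * r ^ 2⌋₊ with hK
  have hr0 : 0 < r := by linarith
  have hr2 : 1 ≤ r ^ 2 := by nlinarith
  have he : (1 : ℝ) ≤ Real.exp 1 := by
    have := Real.add_one_le_exp (1 : ℝ)
    linarith
  have hK1 : 1 ≤ K := Nat.le_floor (by push_cast; nlinarith)
  -- The radius for which `‖ξ k‖ ≤ a k` makes the `k`-th term at most `1/(K+1)` on the disk of
  -- radius `r`.
  let a : ℕ → ℝ := fun k ↦ Real.sqrt (k.factorial : ℝ) / (r ^ k * (K + 1))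
  have ha0 : ∀ k, 0 < a k := fun k ↦ by positivity
  have ha2 : ∀ k, (a k) ^ 2 = (k.factorial : ℝ) / (r ^ 2) ^ k / (K + 1) ^ 2 := by
    intro k
    simp only [a]
    rw [div_pow, Real.sq_sqrt (by positivity), mul_pow, ← pow_mul, mul_comm k 2, pow_mul, div_div]
  -- Below `e r²`, Stirling bounds these radii, so each ball costs its area up to the factor `exp
  -- (-3)`; this is the `exp 3` in the statement.
  have ha3 : ∀ k ∈ Finset.Ico 1 K, (a k) ^ 2 ≤ 3 := by
    intro k hk
    obtain ⟨hk1, hkK⟩ := Finset.mem_Ico.1 hk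
    have hk0 : (0 : ℝ) < k := by exact_mod_cast hk1
    have hkL : (k : ℝ) ≤ Real.exp 1 * r ^ 2 :=
      (Nat.cast_le.2 hkK.le).trans (Nat.floor_le (by positivity))
    have h1 : (k.factorial : ℝ) ≤ Real.exp 1 * k * (r ^ 2) ^ k := by
      have h2 := factorial_mul_exp_le hk1
      have h3 : (k : ℝ) ^ k ≤ Real.exp k * (r ^ 2) ^ k := by
        rw [← Real.exp_one_pow k, ← mul_pow]
        gcongr
      have h4 : (k.factorial : ℝ) * Real.exp k ≤ Real.exp 1 * k * (r ^ 2) ^ k * Real.exp k := by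
        refine h2.trans ?_
        calc Real.exp 1 * k * (k : ℝ) ^ k ≤ Real.exp 1 * k * (Real.exp k * (r ^ 2) ^ k) := by gcongr
          _ = _ := by ring
      exact le_of_mul_le_mul_right h4 (Real.exp_pos _)
    rw [ha2, div_div, div_le_iff₀ (by positivity)]
    have h5 : Real.exp 1 * k ≤ 3 * (K + 1) ^ 2 := by
      have h6 : (k : ℝ) ≤ K := by exact_mod_cast hkK.le
      have := Real.exp_one_lt_three
      nlinarith
    calc (k.factorial : ℝ) ≤ Real.exp 1 * k * (r ^ 2) ^ k := h1
      _ ≤ 3 * (K + 1) ^ 2 * (r ^ 2) ^ k := by gcongr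
      _ = _ := by ring
  let S : Fin K → Set ℂ := fun i ↦
    if (i : ℕ) = 0 then {z | tailConstant + 1 < ‖z‖} else Metric.ball 0 (a i)
  have hS : ∀ i, MeasurableSet (S i) := by
    intro i
    simp only [S]
    split_ifs
    · exact measurableSet_lt measurable_const measurable_norm
    · exact measurableSet_ball
  set X : Ω → Fin K → ℂ := fun ω i ↦ ξ i ω with hX
  set Y : Ω → ℕ → ℂ := fun ω k ↦ ξ (k + K) ω with hY
  have hXm : Measurable X := measurable_pi_lambda _ fun i ↦ hmeas i
  let T : Set (ℕ → ℂ) := {y | ∀ k : ℕ, ‖y k‖ ≤ 4 * (k + 1)}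
  have hT : MeasurableSet T := by
    simp only [T]
    rw [Set.ofPred_forall]
    exact MeasurableSet.iInter fun k ↦
      measurableSet_le (measurable_pi_apply k).norm measurable_const
  have hsub : X ⁻¹' (Set.univ.pi S) ∩ Y ⁻¹' T ⊆ holeEvent ξ r := by
    rintro ω ⟨h1, h2⟩
    have h1' : ∀ i : Fin K, ξ i ω ∈ S i := fun i ↦ h1 i (Set.mem_univ i)
    refine mem_holeEvent_of_small_coefficients hr ?_ ?_ h2
    · have := h1' ⟨0, hK1⟩
      simpa [S] using this
    · intro k hk
      obtain ⟨hk1, hkK⟩ := Finset.mem_Ico.1 hk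
      have h3 := h1' ⟨k, hkK⟩
      have hk0 : k ≠ 0 := by omega
      simp only [S, hk0, if_false, mem_ball_zero_iff] at h3
      calc ‖ξ k ω‖ * r ^ k / Real.sqrt (k.factorial : ℝ)
          ≤ a k * r ^ k / Real.sqrt (k.factorial : ℝ) := by gcongr
        _ = _ := by
          simp only [a]
          field_simp
          rw [hK]
  have hP : P (X ⁻¹' (Set.univ.pi S) ∩ Y ⁻¹' T) =
      P (X ⁻¹' (Set.univ.pi S)) * P (Y ⁻¹' T) :=
    (indepFun_low_high hmeas hindep K).measure_inter_preimage_eq_mul _ _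
      (MeasurableSet.univ_pi hS) hT
  have hPX : P (X ⁻¹' (Set.univ.pi S)) = ∏ i : Fin K, stdComplexGaussian (S i) := by
    rw [← Measure.map_apply hXm (MeasurableSet.univ_pi hS), map_low_eq_pi hmeas hlaw hindep K,
      Measure.pi_pi]
  have hPY : ENNReal.ofReal (1 / 2) ≤ P (Y ⁻¹' T) := by
    have h1 := measure_compl_linearGrowthEvent_le (P := P) (ξ := fun k ↦ ξ (k + K))
      (fun k ↦ hmeas (k + K)) (fun k ↦ hlaw (k + K)) (c := 4) (by norm_num)
    have h2 : P (Y ⁻¹' T)ᶜ ≤ ENNReal.ofReal (1 / 2) := by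
      refine h1.trans (ENNReal.ofReal_le_ofReal ?_)
      have h3 : Real.exp (-(4 : ℝ) ^ 2 / 2) ≤ 1 / 9 := by
        rw [show -(4 : ℝ) ^ 2 / 2 = -8 by norm_num, Real.exp_neg, one_div]
        refine inv_anti₀ (by norm_num) ?_
        have := Real.add_one_le_exp (8 : ℝ)
        linarith
      linarith
    have hYm : MeasurableSet (Y ⁻¹' T) := (measurable_pi_lambda _ fun i ↦ hmeas (i + K)) hT
    rw [prob_compl_eq_one_sub hYm, tsub_le_iff_right] at h2
    have h4 : (1 : ENNReal) = ENNReal.ofReal (1 / 2) + ENNReal.ofReal (1 / 2) := by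
      rw [← ENNReal.ofReal_add (by norm_num) (by norm_num)]
      norm_num
    rw [h4] at h2
    exact (ENNReal.add_le_add_iff_left ENNReal.ofReal_ne_top).1 h2
  let b : ℕ → ℝ := fun k ↦ (k.factorial : ℝ) / (r ^ 2) ^ k / ((K + 1) ^ 2 * Real.exp 3)
  have hb0 : ∀ k, 0 ≤ b k := fun k ↦ by positivity
  have hPX2 : ENNReal.ofReal (p0.toReal * ∏ k ∈ Finset.range K, b k) ≤
      ∏ i : Fin K, stdComplexGaussian (S i) := by
    -- Including the factor at `k = 0`, which is at most `1`, only decreases the product and lets it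
    -- run over `range K`.
    have h1 : p0.toReal * ∏ k ∈ Finset.range K, b k ≤
        p0.toReal * ∏ k ∈ Finset.Ico 1 K, b k := by
      have hprod : 0 ≤ ∏ k ∈ Finset.Ico 1 K, b k := Finset.prod_nonneg fun k _ ↦ hb0 k
      rw [Finset.range_eq_Ico, Finset.prod_eq_prod_Ico_succ_bot hK1]
      have hb00 : b 0 ≤ 1 := by
        simp only [b, Nat.factorial_zero, Nat.cast_one, pow_zero, div_one]
        rw [div_le_one (by positivity)]
        have h2 : (1 : ℝ) ≤ Real.exp 3 := Real.one_le_exp (by norm_num)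
        have h3 : (0 : ℝ) ≤ K := K.cast_nonneg
        nlinarith
      refine mul_le_mul_of_nonneg_left ?_ hp0pos.le
      nlinarith
    refine (ENNReal.ofReal_le_ofReal h1).trans ?_
    let G : ℕ → ENNReal := fun k ↦ stdComplexGaussian
      (if k = 0 then {z | tailConstant + 1 < ‖z‖} else Metric.ball 0 (a k))
    have h2 : ∏ i : Fin K, stdComplexGaussian (S i) = ∏ k ∈ Finset.range K, G k :=
      Fin.prod_univ_eq_prod_range G K
    rw [h2, Finset.range_eq_Ico, Finset.prod_eq_prod_Ico_succ_bot hK1,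
      ENNReal.ofReal_mul ENNReal.toReal_nonneg, ENNReal.ofReal_toReal (measure_ne_top _ _),
      ENNReal.ofReal_prod_of_nonneg fun k _ ↦ hb0 k]
    refine mul_le_mul' (le_of_eq (by simp [G])) (Finset.prod_le_prod' fun k hk ↦ ?_)
    have hk0 : k ≠ 0 := by
      have := (Finset.mem_Ico.1 hk).1
      omega
    simp only [G, hk0, if_false]
    refine le_trans (ENNReal.ofReal_le_ofReal ?_) (stdComplexGaussian_ball_ge (ha0 k).le)
    have h3 : b k = (a k) ^ 2 * Real.exp (-3) := by
      simp only [b]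
      rw [ha2, Real.exp_neg]
      field_simp
    rw [h3]
    gcongr
    exact ha3 k hk
  calc ENNReal.ofReal (p0.toReal / 2 * ∏ k ∈ Finset.range K, b k)
      = ENNReal.ofReal (p0.toReal * ∏ k ∈ Finset.range K, b k) * ENNReal.ofReal (1 / 2) := by
        rw [← ENNReal.ofReal_mul' (by norm_num)]
        congr 1
        ring
    _ ≤ P (X ⁻¹' (Set.univ.pi S)) * P (Y ⁻¹' T) := by
        rw [hPX]
        exact mul_le_mul' hPX2 hPY
    _ ≤ P (holeEvent ξ r) := hP ▸ measure_mono hsub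

theorem measure_holeEvent_ne_zero (hmeas : ∀ k, Measurable (ξ k))
    (hlaw : ∀ k, P.map (ξ k) = stdComplexGaussian) (hindep : iIndepFun ξ P) (r : ℝ) :
    P (holeEvent ξ r) ≠ 0 := by
  obtain ⟨c, hc, h⟩ := exists_measure_holeEvent_ge hmeas hlaw hindep
  have h1 := (h (max 1 r) (le_max_left _ _)).trans
    (measure_mono (holeEvent_anti (ξ := ξ) (le_max_right 1 r)))
  refine fun h0 ↦ ?_
  rw [h0, nonpos_iff_eq_zero, ENNReal.ofReal_eq_zero] at h1
  refine absurd h1 (not_le.2 (mul_pos hc (Finset.prod_pos fun k _ ↦ ?_)))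
  have : 0 < max 1 r := lt_max_of_lt_left one_pos
  positivity

end

/-! ### Annuli, sample laws and the deficit bound -/

/-- The half-open annulus `{a ≤ |w|² < b}`. -/
def shell (a b : ℝ) : Set ℂ := {w | a ≤ ‖w‖ ^ 2 ∧ ‖w‖ ^ 2 < b}

theorem measurableSet_shell (a b : ℝ) : MeasurableSet (shell a b) :=
  (measurableSet_le measurable_const (measurable_norm.pow_const 2)).inter
    (measurableSet_lt (measurable_norm.pow_const 2) measurable_const)

theorem volume_ball_sqrt {a : ℝ} (ha : 0 ≤ a) :
    volume {w : ℂ | ‖w‖ ^ 2 < a} = ENNReal.ofReal (Real.pi * a) := by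
  have h : {w : ℂ | ‖w‖ ^ 2 < a} = Metric.ball 0 (Real.sqrt a) := by
    ext w
    rw [mem_ball_zero_iff, Real.lt_sqrt (norm_nonneg w)]
    rfl
  rw [h, Complex.volume_ball, ← ENNReal.ofReal_pow (Real.sqrt_nonneg a), Real.sq_sqrt ha,
    ← NNReal.coe_real_pi, ENNReal.ofReal_mul NNReal.pi.coe_nonneg, ENNReal.ofReal_coe_nnreal,
    mul_comm]

theorem volume_shell {a b : ℝ} (ha : 0 ≤ a) (hab : a ≤ b) :
    volume (shell a b) = ENNReal.ofReal (Real.pi * (b - a)) := by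
  have h : shell a b = {w : ℂ | ‖w‖ ^ 2 < b} \ {w : ℂ | ‖w‖ ^ 2 < a} := by
    ext w
    simp only [shell, Set.mem_ofPred_eq, Set.mem_sdiff, not_lt]
    exact and_comm
  have hm : MeasurableSet {w : ℂ | ‖w‖ ^ 2 < a} :=
    measurableSet_lt (measurable_norm.pow_const 2) measurable_const
  have hsub : {w : ℂ | ‖w‖ ^ 2 < a} ⊆ {w : ℂ | ‖w‖ ^ 2 < b} := fun w hw ↦ lt_of_lt_of_le hw hab
  rw [h, measure_sdiff hsub hm.nullMeasurableSet
    (by rw [volume_ball_sqrt ha]; exact ENNReal.ofReal_ne_top),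
    volume_ball_sqrt ha, volume_ball_sqrt (ha.trans hab), ← ENNReal.ofReal_sub _ (by positivity),
    mul_sub]

theorem measurePreserving_mul_right {y : ℂ} (hy : ‖y‖ = 1) :
    MeasurePreserving (fun w : ℂ ↦ w * y) volume volume := by
  have h := (rotation (Circle.exp y.arg)).measurePreserving
  have h2 : (fun w : ℂ ↦ w * y) = rotation (Circle.exp y.arg) := by
    ext w
    have h3 := Complex.norm_mul_exp_arg_mul_I y
    rw [hy, Complex.ofReal_one, one_mul] at h3
    rw [rotation_apply, Circle.coe_exp, h3, mul_comm]
  rw [h2]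
  exact h

/-- Area on an annulus is rotation invariant, so it is itself a mixture of centred circles. -/
theorem restrict_shell_mconv (c : ENNReal) (a b : ℝ) :
    (c • volume.restrict (shell a b)) ∗ₘ unitCircleMeasure = c • volume.restrict (shell a b) := by
  have : SFinite (c • volume.restrict (shell a b)) := inferInstance
  refine Measure.ext fun s hs ↦ ?_
  set τ := c • volume.restrict (shell a b) with hτ
  have hind : Measurable (s.indicator (1 : ℂ → ENNReal)) := measurable_one.indicator hs
  rw [← lintegral_indicator_one hs, ← lintegral_indicator_one hs, Measure.lintegral_mconv hind,
    lintegral_lintegral_swap (f := fun x y ↦ s.indicator (1 : ℂ → ENNReal) (x * y))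
      (hind.comp measurable_mul).aemeasurable]
  have h : ∀ᵐ y ∂unitCircleMeasure, ∫⁻ x, s.indicator 1 (x * y) ∂τ =
      ∫⁻ x, s.indicator 1 x ∂τ := by
    filter_upwards [ae_unitCircleMeasure_norm_eq_one] with y hy
    have h1 := (measurePreserving_mul_right hy).restrict_preimage (measurableSet_shell a b)
    have h2 : (fun w : ℂ ↦ w * y) ⁻¹' shell a b = shell a b := by
      ext w
      simp [shell, hy]
    rw [h2] at h1
    have h3 := h1.smul_measure c
    exact h3.lintegral_comp hind
  rw [lintegral_congr_ae h, lintegral_const, measure_univ, mul_one]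

/-- The uniform law on the annulus `{j / L ≤ |w|² < (j + 1) / L}`. -/
def shellLaw (L : ℝ) (j : ℕ) : Measure ℂ :=
  ENNReal.ofReal (L / Real.pi) • volume.restrict (shell (j / L) ((j + 1) / L))

theorem shellLaw_mconv (L : ℝ) (j : ℕ) : shellLaw L j ∗ₘ unitCircleMeasure = shellLaw L j :=
  restrict_shell_mconv _ _ _

theorem isProbabilityMeasure_shellLaw {L : ℝ} (hL : 0 < L) (j : ℕ) :
    IsProbabilityMeasure (shellLaw L j) := by
  refine ⟨?_⟩
  rw [shellLaw, Measure.smul_apply, Measure.restrict_apply_univ,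
    volume_shell (by positivity) (by gcongr; linarith), smul_eq_mul,
    ← ENNReal.ofReal_mul (by positivity), ← ENNReal.ofReal_one]
  congr 1
  field_simp
  ring

theorem ae_shellLaw (L : ℝ) (j : ℕ) : ∀ᵐ w ∂shellLaw L j, w ∈ shell (j / L) ((j + 1) / L) :=
  Measure.ae_smul_measure (ae_restrict_mem (measurableSet_shell _ _)) _

/-- Consecutive annuli tile, and each has area `π / L`, so the normalised averages add up to one
integral with weight `L / π`. -/
theorem sum_integral_shellLaw {L : ℝ} (hL : 0 < L) {f : ℂ → ℝ} {K N : ℕ} (hKN : K ≤ N)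
    (hf : ∀ j ∈ Finset.Ico K N, Integrable f (shellLaw L j)) :
    IntegrableOn f (shell (K / L) (N / L)) ∧
    ∑ j ∈ Finset.Ico K N, ∫ w, f w ∂shellLaw L j =
      L / Real.pi * ∫ w in shell (K / L) (N / L), f w := by
  have hc : 0 < L / Real.pi := by positivity
  induction N, hKN using Nat.le_induction with
  | base =>
    have : shell (K / L) (K / L) = ∅ := by
      ext w
      simp [shell]
    simp [this]
  | succ N hKN ih =>
    obtain ⟨ih1, ih2⟩ := ih fun j hj ↦ hf j (by
      rw [Finset.mem_Ico] at hj ⊢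
      omega)
    have hu : shell (K / L) ((N + 1 : ℕ) / L) = shell (K / L) (N / L) ∪ shell (N / L) ((N + 1) / L) := by
      ext w
      simp only [shell, Set.mem_ofPred_eq, Set.mem_union]
      have h1 : (K : ℝ) / L ≤ N / L := by gcongr
      have h2 : (N : ℝ) / L ≤ (N + 1) / L := by gcongr; linarith
      push_cast
      constructor
      · rintro ⟨h3, h4⟩
        rcases lt_or_ge (‖w‖ ^ 2) (N / L) with h5 | h5
        · exact Or.inl ⟨h3, h5⟩
        · exact Or.inr ⟨h5, h4⟩
      · rintro (⟨h3, h4⟩ | ⟨h3, h4⟩)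
        · exact ⟨h3, h4.trans_le h2⟩
        · exact ⟨h1.trans h3, h4⟩
    have hd : Disjoint (shell (K / L) (N / L)) (shell (N / L) ((N + 1) / L)) := by
      rw [Set.disjoint_left]
      intro w hw hw'
      exact absurd hw.2 (not_lt.2 hw'.1)
    have hi := hf N (by rw [Finset.mem_Ico]; omega)
    have hi' : IntegrableOn f (shell (N / L) ((N + 1) / L)) := by
      have h3 := (integrable_smul_measure (μ := volume.restrict (shell (N / L) ((N + 1) / L)))
        (f := f) (c := ENNReal.ofReal (L / Real.pi)) (by simpa using hc)
        ENNReal.ofReal_ne_top).1 hi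
      exact h3
    refine ⟨?_, ?_⟩
    · rw [hu]
      exact ih1.union hi'
    · rw [Finset.sum_Ico_succ_top hKN, ih2, hu, setIntegral_union hd (measurableSet_shell _ _) ih1 hi',
        mul_add, shellLaw, integral_smul_measure, ENNReal.toReal_ofReal hc.le, smul_eq_mul]

/-- Jensen's formula: zeros on the circle itself contribute `log 1 = 0`, so a hole in the open disk
suffices. -/
theorem integral_log_norm_unitCircle_of_hole {f : ℂ → ℂ} (hf : Differentiable ℂ f)
    (h0 : ∀ z, ‖z‖ < 1 → f z ≠ 0) :
    ∫ z, Real.log ‖f z‖ ∂unitCircleMeasure = Real.log ‖f 0‖ := by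
  rw [integral_unitCircleMeasure (measurable_log_norm hf)]
  have ha : AnalyticOnNhd ℂ f (Metric.closedBall 0 |1|) := fun z _ ↦ hf.analyticAt z
  rw [ha.circleAverage_log_norm one_ne_zero (h0 0 (by simp)), add_eq_right]
  refine finsum_eq_zero_of_forall_eq_zero fun u ↦ ?_
  by_cases hu : u ∈ Metric.closedBall (0 : ℂ) |1|
  · rw [Metric.mem_closedBall, dist_zero_right, abs_one] at hu
    rcases hu.lt_or_eq with h | h
    · rw [MeromorphicOn.AnalyticOnNhd.divisor_apply ha (by simpa using hu),
        ((hf.analyticAt u).analyticOrderAt_eq_zero).2 (h0 u h)]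
      simp
    · simp [h]
  · rw [Function.locallyFinsuppWithin.apply_eq_zero_of_notMem _ hu]
    simp

/-- The laws of the sample points: uniform on the unit circle for `j < K`, and uniform on the
annulus `{j / L ≤ |w|² < (j + 1) / L}` otherwise (after averaging over rotations). -/
def sampleLaw (L : ℝ) (K j : ℕ) : Measure ℂ :=
  if j < K then Measure.dirac 1 else shellLaw L j

theorem isProbabilityMeasure_sampleLaw {L : ℝ} (hL : 0 < L) (K j : ℕ) :
    IsProbabilityMeasure (sampleLaw L K j) := by
  unfold sampleLaw
  split_ifs
  · infer_instance
  · exact isProbabilityMeasure_shellLaw hL j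

/-- Lower bounds for the radii of the sample points. -/
def sampleRadius (L : ℝ) (K j : ℕ) : ℝ :=
  if j < K then 1 else Real.sqrt (j / L)

theorem le_floor_exp_one_mul {L : ℝ} (hL : 1 ≤ L) : L ≤ ⌊Real.exp 1 * L⌋₊ := by
  have h1 : Real.exp 1 * L < ⌊Real.exp 1 * L⌋₊ + 1 := Nat.lt_floor_add_one _
  have h2 := Real.add_one_le_exp (1 : ℝ)
  nlinarith

theorem one_le_sampleRadius {L : ℝ} (hL : 1 ≤ L) (j : ℕ) :
    1 ≤ sampleRadius L ⌊Real.exp 1 * L⌋₊ j := by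
  unfold sampleRadius
  split_ifs with h
  · exact le_rfl
  · rw [Real.one_le_sqrt, one_le_div (by linarith)]
    exact (le_floor_exp_one_mul hL).trans (by exact_mod_cast not_lt.1 h)

/-- The last annulus may stick out of radius `ρ` because of the ceiling, but it stays within `ρ +
1`. This is why growth is controlled up to `ρ + 1`. -/
theorem succ_div_le_sq {L ρ : ℝ} (hL : 1 ≤ L) (hρ : 0 ≤ ρ) {j : ℕ} (hj : j < ⌈ρ ^ 2 * L⌉₊) :
    ((j : ℝ) + 1) / L ≤ (ρ + 1) ^ 2 := by
  have h1 : (⌈ρ ^ 2 * L⌉₊ : ℝ) < ρ ^ 2 * L + 1 := Nat.ceil_lt_add_one (by positivity)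
  have h2 : (j : ℝ) + 1 ≤ ⌈ρ ^ 2 * L⌉₊ := by exact_mod_cast hj
  rw [div_le_iff₀ (by linarith)]
  nlinarith

theorem ae_sampleLaw {L ρ : ℝ} (hL : 1 ≤ L) (hρ : 0 ≤ ρ) (j : Fin ⌈ρ ^ 2 * L⌉₊) (K : ℕ) :
    ∀ᵐ w ∂sampleLaw L K j, sampleRadius L K j ≤ ‖w‖ ∧ ‖w‖ ≤ ρ + 1 := by
  unfold sampleLaw sampleRadius
  split_ifs with h
  · rw [ae_dirac_eq]
    simp [hρ]
  · filter_upwards [ae_shellLaw L j] with w hw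
    refine ⟨Real.sqrt_le_iff.2 ⟨norm_nonneg w, hw.1⟩, ?_⟩
    refine le_of_sq_le_sq ?_ (by positivity)
    exact hw.2.le.trans (succ_div_le_sq hL hρ j.2)

section

variable {Ω : Type*} {ξ : ℕ → Ω → ℂ}

/-- The deficit of the logarithmic potential on the hole event, compared with its extremal
value `|w|² / 2`, integrated over the unit circle and the annulus `√e ≤ |w| ≤ ρ`. -/
def potentialDeficit (ξ : ℕ → Ω → ℂ) (ρ r : ℝ) (ω : Ω) : ℝ :=
  -(⌊Real.exp 1 * r ^ 2⌋₊ : ℝ) * Real.log ‖gef ξ ω 0‖ +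
    ∑ j ∈ Finset.Ico ⌊Real.exp 1 * r ^ 2⌋₊ ⌈ρ ^ 2 * r ^ 2⌉₊,
      ((j : ℝ) / 2 - ∫ w, Real.log ‖gef ξ ω (r * w)‖ ∂shellLaw (r ^ 2) j)

theorem floor_le_ceil {ρ L : ℝ} (hρ : 2 ≤ ρ) (hL : 0 ≤ L) :
    ⌊Real.exp 1 * L⌋₊ ≤ ⌈ρ ^ 2 * L⌉₊ := by
  have h : Real.exp 1 * L ≤ ρ ^ 2 * L := by
    have := Real.exp_one_lt_three
    gcongr
    nlinarith
  exact (Nat.floor_le_floor h).trans (Nat.floor_le_ceil _)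

/-- The hole enters here: the first `K` terms are means over the unit circle and collapse to `log
|F(0)|`. On the `j`-th annulus the reference value `j/2` is `|r w|²/2` at the inner edge. -/
theorem sum_potential_eq_of_hole {ρ r : ℝ} (hρ : 2 ≤ ρ) (hr : 1 ≤ r) {ω : Ω}
    (hω : ω ∈ holeEvent ξ r) (hd : Differentiable ℂ (gef ξ ω)) :
    ∑ j : Fin ⌈ρ ^ 2 * r ^ 2⌉₊, ∫ w, Real.log ‖gef ξ ω (r * w)‖
        ∂(sampleLaw (r ^ 2) ⌊Real.exp 1 * r ^ 2⌋₊ j ∗ₘ unitCircleMeasure) =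
      ∑ j ∈ Finset.Ico ⌊Real.exp 1 * r ^ 2⌋₊ ⌈ρ ^ 2 * r ^ 2⌉₊, ((j : ℝ) / 2) -
        potentialDeficit ξ ρ r ω := by
  set K := ⌊Real.exp 1 * r ^ 2⌋₊ with hK
  set N := ⌈ρ ^ 2 * r ^ 2⌉₊ with hN
  have hKN : K ≤ N := floor_le_ceil hρ (by positivity)
  have hr0 : 0 < r := by linarith
  have h1 : ∫ w, Real.log ‖gef ξ ω (r * w)‖ ∂unitCircleMeasure = Real.log ‖gef ξ ω 0‖ := by
    have h2 := integral_log_norm_unitCircle_of_hole (f := fun w ↦ gef ξ ω (r * w))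
      (hd.comp (differentiable_id.const_mul _)) (fun z hz ↦ hω _ (by
        rw [norm_mul, Complex.norm_real, Real.norm_of_nonneg hr0.le]
        nlinarith))
    simpa using h2
  rw [Fin.sum_univ_eq_sum_range (fun j ↦ ∫ w, Real.log ‖gef ξ ω (r * w)‖
    ∂(sampleLaw (r ^ 2) K j ∗ₘ unitCircleMeasure)) N, ← Finset.sum_range_add_sum_Ico _ hKN]
  have h3 : ∑ j ∈ Finset.range K, ∫ w, Real.log ‖gef ξ ω (r * w)‖
      ∂(sampleLaw (r ^ 2) K j ∗ₘ unitCircleMeasure) = K * Real.log ‖gef ξ ω 0‖ := by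
    rw [Finset.sum_congr rfl (g := fun _ ↦ Real.log ‖gef ξ ω 0‖), Finset.sum_const,
      Finset.card_range, nsmul_eq_mul]
    intro j hj
    rw [sampleLaw, if_pos (Finset.mem_range.1 hj), Measure.dirac_one_mconv, h1]
  have h4 : ∑ j ∈ Finset.Ico K N, ∫ w, Real.log ‖gef ξ ω (r * w)‖
      ∂(sampleLaw (r ^ 2) K j ∗ₘ unitCircleMeasure) =
      ∑ j ∈ Finset.Ico K N, ∫ w, Real.log ‖gef ξ ω (r * w)‖ ∂shellLaw (r ^ 2) j := by
    refine Finset.sum_congr rfl fun j hj ↦ ?_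
    rw [sampleLaw, if_neg (not_lt.2 (Finset.mem_Ico.1 hj).1), shellLaw_mconv]
  rw [h3, h4, potentialDeficit, Finset.sum_sub_distrib]
  ring

variable [MeasurableSpace Ω] {P : Measure Ω} [IsProbabilityMeasure P]

/-- For `k ≥ K` the squared radius `(r m_k)²` is exactly `k`, and Stirling bounds `e^k k! / k^k` by
`e k`. Only the indices below `K`, which also govern the hole probability, remain significant. -/
theorem prod_factorial_div_le {r : ℝ} (hr : 1 ≤ r) {N : ℕ}
    (hKN : ⌊Real.exp 1 * r ^ 2⌋₊ ≤ N) :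
    Real.exp (∑ j ∈ Finset.Ico ⌊Real.exp 1 * r ^ 2⌋₊ N, (j : ℝ)) * ∏ k ∈ Finset.range N,
        ((k.factorial : ℝ) / (r * sampleRadius (r ^ 2) ⌊Real.exp 1 * r ^ 2⌋₊ k) ^ (2 * k)) ≤
      (Real.exp 1 * N) ^ N *
        ∏ k ∈ Finset.range ⌊Real.exp 1 * r ^ 2⌋₊, ((k.factorial : ℝ) / (r ^ 2) ^ k) := by
  set K := ⌊Real.exp 1 * r ^ 2⌋₊ with hK
  have hr0 : 0 < r := by linarith
  have hr2 : 1 ≤ r ^ 2 := by nlinarith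
  have hK1 : 1 ≤ K := by
    have h := hr2.trans (le_floor_exp_one_mul hr2)
    exact_mod_cast h
  rw [← Finset.prod_range_mul_prod_Ico _ hKN, Real.exp_sum]
  have h1 : ∏ k ∈ Finset.range K, ((k.factorial : ℝ) / (r * sampleRadius (r ^ 2) K k) ^ (2 * k)) =
      ∏ k ∈ Finset.range K, ((k.factorial : ℝ) / (r ^ 2) ^ k) := by
    refine Finset.prod_congr rfl fun k hk ↦ ?_
    rw [sampleRadius, if_pos (Finset.mem_range.1 hk), mul_one, pow_mul]
  have h2 : (∏ k ∈ Finset.Ico K N, Real.exp (k : ℝ)) *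
      ∏ k ∈ Finset.Ico K N, ((k.factorial : ℝ) / (r * sampleRadius (r ^ 2) K k) ^ (2 * k)) ≤
      (Real.exp 1 * N) ^ N := by
    rw [← Finset.prod_mul_distrib]
    have hN1 : (1 : ℝ) ≤ N := by exact_mod_cast hK1.trans hKN
    have heN : 1 ≤ Real.exp 1 * N := by
      have := Real.add_one_le_exp (1 : ℝ)
      nlinarith
    calc _ ≤ ∏ _k ∈ Finset.Ico K N, (Real.exp 1 * (N : ℝ)) := by
          refine Finset.prod_le_prod (fun k _ ↦ ?_) fun k hk ↦ ?_
          · have : 0 ≤ sampleRadius (r ^ 2) K k := by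
              have := one_le_sampleRadius hr2 k
              rw [← hK] at this
              linarith
            positivity
          · obtain ⟨hk1, hk2⟩ := Finset.mem_Ico.1 hk
            have hk0 : 0 < k := hK1.trans hk1
            have hk0' : (0 : ℝ) < k := by exact_mod_cast hk0
            rw [sampleRadius, if_neg (not_lt.2 hk1), pow_mul, mul_pow, Real.sq_sqrt (by positivity),
              mul_div_cancel₀ _ (by positivity)]
            rw [← mul_div_assoc, div_le_iff₀ (by positivity), mul_comm]
            refine (factorial_mul_exp_le hk0).trans ?_
            gcongr
      _ ≤ (Real.exp 1 * N) ^ N := by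
          rw [Finset.prod_const, Nat.card_Ico]
          exact pow_le_pow_right₀ heN (Nat.sub_le _ _)
  rw [h1, mul_left_comm, mul_comm ((Real.exp 1 * (N : ℝ)) ^ N)]
  exact mul_le_mul_of_nonneg_left h2 (Finset.prod_nonneg fun k _ ↦ by positivity)

/-- Markov's inequality for the exponential moment of the potential at the sample laws. -/
theorem measure_hole_inter_deficit_le (hmeas : ∀ k, Measurable (ξ k))
    (hlaw : ∀ k, P.map (ξ k) = stdComplexGaussian) (hindep : iIndepFun ξ P)
    {ρ r s B δ : ℝ} (hρ : 2 ≤ ρ) (hr : 1 ≤ r) (hs0 : 0 ≤ s) (hs : s < 1) (hB : 0 < B)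
    {G : Set Ω} (hG : MeasurableSet G)
    (hGF : ∀ ω ∈ G, Differentiable ℂ (gef ξ ω) ∧ gef ξ ω 0 ≠ 0 ∧
      ∀ w : ℂ, ‖w‖ ≤ ρ + 1 → ‖gef ξ ω (r * w)‖ ≤ B) :
    P (holeEvent ξ r ∩ G ∩ {ω | δ * r ^ 4 ≤ potentialDeficit ξ ρ r ω}) ≤
      ENNReal.ofReal (Real.exp (-2 * s * δ * r ^ 4) *
        (B ^ (2 * (1 - s)) / (1 - s) * (Real.exp 1 * ⌈ρ ^ 2 * r ^ 2⌉₊)) ^ ⌈ρ ^ 2 * r ^ 2⌉₊ *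
        ∏ k ∈ Finset.range ⌊Real.exp 1 * r ^ 2⌋₊, ((k.factorial : ℝ) / (r ^ 2) ^ k)) := by
  set K := ⌊Real.exp 1 * r ^ 2⌋₊ with hK
  set N := ⌈ρ ^ 2 * r ^ 2⌉₊ with hN
  have hKN : K ≤ N := floor_le_ceil hρ (by positivity)
  have hr0 : 0 < r := by linarith
  have hr2 : 1 ≤ r ^ 2 := by nlinarith
  have hs' : 0 < 1 - s := by linarith
  have : ∀ i : Fin N, IsProbabilityMeasure (sampleLaw (r ^ 2) K i) := fun i ↦
    isProbabilityMeasure_sampleLaw (by positivity) K i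
  set S : ℝ := ∑ j ∈ Finset.Ico K N, (j : ℝ) with hS
  have hS0 : 0 ≤ S := Finset.sum_nonneg fun j _ ↦ j.cast_nonneg
  let Φ : Ω → ℝ := fun ω ↦ ∑ j : Fin N, ∫ w, Real.log ‖gef ξ ω (r * w)‖
    ∂(sampleLaw (r ^ 2) K j ∗ₘ unitCircleMeasure)
  have hΦ : Measurable Φ := by
    refine Finset.measurable_sum _ fun j _ ↦ ?_
    have h1 : Measurable fun p : Ω × ℂ ↦ Real.log ‖gef ξ p.1 (r * p.2)‖ :=
      Real.measurable_log.comp ((measurable_gef_uncurry hmeas).comp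
        (measurable_fst.prodMk (measurable_snd.const_mul _))).norm
    exact (h1.stronglyMeasurable.integral_prod_right'
      (ν := sampleLaw (r ^ 2) K j ∗ₘ unitCircleMeasure)).measurable
  have hmain := lintegral_exp_neg_potential_le (τ := fun j : Fin N ↦ sampleLaw (r ^ 2) K j)
    (m := sampleRadius (r ^ 2) K) hmeas hlaw hindep (one_le_sampleRadius hr2)
    (fun i ↦ ae_sampleLaw hr2 (by linarith) i K) hr0 hs hB hG hGF
  -- On the event the exponent is `-s S + 2 s · deficit`; `S ≥ 0` and `s ≤ 1` allow replacing `-s S`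
  -- by `-S`, the form cancelled by `prod_factorial_div_le`.
  set ε : ENNReal := ENNReal.ofReal (Real.exp (2 * s * δ * r ^ 4 - S)) with hε
  have hΨ : Measurable fun ω ↦ ENNReal.ofReal (Real.exp (-2 * s * Φ ω)) := by fun_prop
  have hmk := mul_meas_ge_le_lintegral₀ (μ := P.restrict G) hΨ.aemeasurable ε
  have hsub : holeEvent ξ r ∩ G ∩ {ω | δ * r ^ 4 ≤ potentialDeficit ξ ρ r ω} ⊆
      {ω | ε ≤ ENNReal.ofReal (Real.exp (-2 * s * Φ ω))} ∩ G := by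
    rintro ω ⟨⟨h1, h2⟩, h3⟩
    refine ⟨?_, h2⟩
    have h4 : Φ ω = _ := sum_potential_eq_of_hole hρ hr h1 (hGF ω h2).1
    have h3' : δ * r ^ 4 ≤ potentialDeficit ξ ρ r ω := h3
    rw [← Finset.sum_div, ← hK, ← hN, ← hS] at h4
    refine ENNReal.ofReal_le_ofReal (Real.exp_le_exp.2 ?_)
    rw [h4]
    have h5 := mul_le_mul_of_nonneg_left h3' hs0
    nlinarith
  have h1 : ε * P (holeEvent ξ r ∩ G ∩ {ω | δ * r ^ 4 ≤ potentialDeficit ξ ρ r ω}) ≤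
      ENNReal.ofReal (∏ k ∈ Finset.range N,
        ((k.factorial : ℝ) / (r * sampleRadius (r ^ 2) K k) ^ (2 * k) *
          (B ^ (2 * (1 - s)) / (1 - s)))) := by
    refine le_trans (mul_le_mul_right (measure_mono hsub) _) (le_trans ?_ hmain)
    refine le_trans (mul_le_mul_right ?_ _) hmk
    rw [Measure.restrict_apply (measurableSet_le measurable_const hΨ)]
  have h2 : P (holeEvent ξ r ∩ G ∩ {ω | δ * r ^ 4 ≤ potentialDeficit ξ ρ r ω}) =
      ENNReal.ofReal (Real.exp (-(2 * s * δ * r ^ 4 - S))) *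
        (ε * P (holeEvent ξ r ∩ G ∩ {ω | δ * r ^ 4 ≤ potentialDeficit ξ ρ r ω})) := by
    rw [← mul_assoc, hε, ← ENNReal.ofReal_mul (Real.exp_pos _).le, ← Real.exp_add]
    simp
  rw [h2]
  refine (mul_le_mul_right h1 _).trans ?_
  rw [← ENNReal.ofReal_mul (Real.exp_pos _).le]
  refine ENNReal.ofReal_le_ofReal ?_
  rw [Finset.prod_mul_distrib, Finset.prod_const, Finset.card_range]
  have h3 := prod_factorial_div_le hr hKN
  rw [← hK, ← hS] at h3
  set A := ∏ k ∈ Finset.range N, ((k.factorial : ℝ) / (r * sampleRadius (r ^ 2) K k) ^ (2 * k))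
  set g := B ^ (2 * (1 - s)) / (1 - s)
  have hg : 0 ≤ g := by positivity
  calc Real.exp (-(2 * s * δ * r ^ 4 - S)) * (A * g ^ N)
      = Real.exp (-2 * s * δ * r ^ 4) * g ^ N * (Real.exp S * A) := by
        rw [show -(2 * s * δ * r ^ 4 - S) = -2 * s * δ * r ^ 4 + S by ring, Real.exp_add]
        ring
    _ ≤ Real.exp (-2 * s * δ * r ^ 4) * g ^ N * ((Real.exp 1 * N) ^ N *
        ∏ k ∈ Finset.range K, ((k.factorial : ℝ) / (r ^ 2) ^ k)) := by gcongr
    _ = _ := by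
        rw [mul_pow]
        ring

end

/-! ### Typical behaviour under the hole conditioning -/

open scoped Topology

theorem eventually_mul_pow_le_exp (C : ℝ) (k : ℕ) {b : ℝ} (hb : 0 < b) :
    ∀ᶠ x : ℝ in atTop, C * x ^ k ≤ Real.exp (b * x) := by
  have h := ((isLittleO_pow_exp_pos_mul_atTop k hb).const_mul_left C).bound one_pos
  filter_upwards [h] with x hx
  rw [one_mul, Real.norm_of_nonneg (Real.exp_pos _).le] at hx
  exact (le_abs_self _).trans hx

theorem floor_exp_one_mul_le {L : ℝ} (hL : 0 ≤ L) : (⌊Real.exp 1 * L⌋₊ : ℝ) ≤ 3 * L := by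
  have := Real.exp_one_lt_three
  exact (Nat.floor_le (by positivity)).trans (by nlinarith)

/-- Each of the at most `3 L` factors is at least `exp (-10 L)`. With `L = r²` the hole probability
is at least of order `exp (-30 r⁴)`, enough to beat the doubly exponential rarity of excessive
growth. -/
theorem exp_neg_le_prod_factorial_div {L : ℝ} (hL : 1 ≤ L) :
    Real.exp (-30 * L ^ 2) ≤ ∏ k ∈ Finset.range ⌊Real.exp 1 * L⌋₊,
      ((k.factorial : ℝ) / L ^ k / (((⌊Real.exp 1 * L⌋₊ : ℝ) + 1) ^ 2 * Real.exp 3)) := by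
  set K := ⌊Real.exp 1 * L⌋₊ with hK
  have hK3 : (K : ℝ) ≤ 3 * L := floor_exp_one_mul_le (by linarith)
  have hL0 : 0 < L := by linarith
  have h1 : ∀ k : ℕ, Real.exp (-10 * L) ≤
      (k.factorial : ℝ) / L ^ k / (((K : ℝ) + 1) ^ 2 * Real.exp 3) := by
    intro k
    have h2 : Real.exp (-L) ≤ (k.factorial : ℝ) / L ^ k := by
      rw [Real.exp_neg, ← inv_div]
      exact inv_anti₀ (by positivity) (Real.pow_div_factorial_le_exp L hL0.le k)
    have h3 : ((K : ℝ) + 1) ^ 2 * Real.exp 3 ≤ Real.exp (9 * L) := by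
      calc ((K : ℝ) + 1) ^ 2 * Real.exp 3 ≤ (Real.exp K) ^ 2 * Real.exp 3 := by
            gcongr
            exact Real.add_one_le_exp _
        _ = Real.exp (2 * K + 3) := by
            rw [Real.exp_add, ← Real.exp_nat_mul]
            norm_num
        _ ≤ _ := by
            gcongr
            linarith
    calc Real.exp (-10 * L) = Real.exp (-L) / Real.exp (9 * L) := by
          rw [← Real.exp_sub]
          congr 1
          ring
      _ ≤ _ := by gcongr
  calc Real.exp (-30 * L ^ 2) ≤ Real.exp (-10 * L) ^ K := by
        rw [← Real.exp_nat_mul, Real.exp_le_exp]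
        nlinarith
    _ = ∏ _k ∈ Finset.range K, Real.exp (-10 * L) := by simp
    _ ≤ _ := Finset.prod_le_prod (fun _ _ ↦ (Real.exp_pos _).le) fun k _ ↦ h1 k

/-- Polynomial factors raised to powers of order `L` are negligible against `exp (-c L²)`. The
dangerous factor is `B^(2(1-s)N)` with `B = exp (C L)`, of order `exp (c L²)`; taking `s` close to
`1` makes its constant small. -/
theorem eventually_deficit_bound_le {ρ δ s C : ℝ} (hρ : 2 ≤ ρ) (hδ : 0 < δ) (hs : s < 1)
    (hC : 0 ≤ C) (hs1 : 3 / 4 ≤ s) (hs2 : 4 * (1 - s) * (C * (ρ ^ 2 + 1)) ≤ δ) :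
    ∀ᶠ L : ℝ in atTop, Real.exp (-2 * s * δ * L ^ 2) *
        (Real.exp (C * L) ^ (2 * (1 - s)) / (1 - s) * (Real.exp 1 * ⌈ρ ^ 2 * L⌉₊)) ^ ⌈ρ ^ 2 * L⌉₊ *
        ∏ k ∈ Finset.range ⌊Real.exp 1 * L⌋₊, ((k.factorial : ℝ) / L ^ k) ≤
      Real.exp (-(δ / 2) * L ^ 2) * ∏ k ∈ Finset.range ⌊Real.exp 1 * L⌋₊,
        ((k.factorial : ℝ) / L ^ k / (((⌊Real.exp 1 * L⌋₊ : ℝ) + 1) ^ 2 * Real.exp 3)) := by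
  set D := ρ ^ 2 + 1 with hD
  have hD0 : 0 < D := by positivity
  set ε := δ / (2 * (D + 3)) with hε
  have hε0 : 0 < ε := by positivity
  have hs' : 0 < 1 - s := by linarith
  filter_upwards [eventually_ge_atTop 1,
    eventually_mul_pow_le_exp (Real.exp 1 * D / (1 - s)) 1 hε0,
    eventually_mul_pow_le_exp (16 * Real.exp 3) 2 hε0] with L hL h1 h2
  have hL0 : 0 < L := by linarith
  set K := ⌊Real.exp 1 * L⌋₊ with hK
  set N := ⌈ρ ^ 2 * L⌉₊ with hN
  have hK3 : (K : ℝ) ≤ 3 * L := floor_exp_one_mul_le hL0.le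
  have hND : (N : ℝ) ≤ D * L := by
    have h3 : (N : ℝ) < ρ ^ 2 * L + 1 := Nat.ceil_lt_add_one (by positivity)
    rw [hD]
    nlinarith
  rw [Finset.prod_div_distrib (f := fun k : ℕ ↦ (k.factorial : ℝ) / L ^ k), Finset.prod_const,
    Finset.card_range, ← mul_div_assoc, le_div_iff₀ (by positivity), mul_right_comm]
  refine mul_le_mul_of_nonneg_right ?_ (by positivity)
  have h3 : Real.exp (C * L) ^ (2 * (1 - s)) / (1 - s) * (Real.exp 1 * N) ≤
      Real.exp (2 * (1 - s) * C * L + ε * L) := by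
    rw [← Real.exp_mul, Real.exp_add]
    calc Real.exp (C * L * (2 * (1 - s))) / (1 - s) * (Real.exp 1 * N)
        = Real.exp (2 * (1 - s) * C * L) * (Real.exp 1 * N / (1 - s)) := by
          rw [show C * L * (2 * (1 - s)) = 2 * (1 - s) * C * L by ring]
          ring
      _ ≤ Real.exp (2 * (1 - s) * C * L) * (Real.exp 1 * (D * L) / (1 - s)) := by gcongr
      _ ≤ _ := by
          gcongr
          refine le_trans (le_of_eq ?_) h1
          ring
  have h4 : ((K : ℝ) + 1) ^ 2 * Real.exp 3 ≤ Real.exp (ε * L) := by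
    refine le_trans ?_ h2
    calc ((K : ℝ) + 1) ^ 2 * Real.exp 3 ≤ (4 * L) ^ 2 * Real.exp 3 := by
          gcongr
          linarith
      _ = _ := by ring
  calc Real.exp (-2 * s * δ * L ^ 2) *
        (Real.exp (C * L) ^ (2 * (1 - s)) / (1 - s) * (Real.exp 1 * N)) ^ N *
        (((K : ℝ) + 1) ^ 2 * Real.exp 3) ^ K
      ≤ Real.exp (-2 * s * δ * L ^ 2) * Real.exp (2 * (1 - s) * C * L + ε * L) ^ N *
        Real.exp (ε * L) ^ K := by gcongr
    _ = Real.exp (-2 * s * δ * L ^ 2 + N * (2 * (1 - s) * C * L + ε * L) + K * (ε * L)) := by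
        rw [← Real.exp_nat_mul, ← Real.exp_nat_mul, ← Real.exp_add, ← Real.exp_add]
    _ ≤ Real.exp (-2 * s * δ * L ^ 2 + D * L * (2 * (1 - s) * C * L + ε * L) +
          3 * L * (ε * L)) := by
        gcongr
    _ ≤ _ := by
        rw [Real.exp_le_exp]
        -- The budget: `-2 s δ ≤ -3δ/2`, the factor `B` costs at most `δ/2`, and the polynomial
        -- factors cost `δ/2`.
        have h5 : ε * (D + 3) = δ / 2 := by
          rw [hε]
          field_simp
        have h6 : -2 * s * δ * L ^ 2 + D * L * (2 * (1 - s) * C * L + ε * L) + 3 * L * (ε * L) =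
          (-2 * s * δ + 2 * (1 - s) * (C * D) + ε * (D + 3)) * L ^ 2 := by ring
        rw [h6, h5]
        gcongr
        nlinarith

section

variable {Ω : Type*} {ξ : ℕ → Ω → ℂ}

/-- The event that the rescaled logarithmic potential is, up to `δ`, at most `|w|² / 2`, with a
small potential deficit. -/
def typicalEvent (ξ : ℕ → Ω → ℂ) (ρ δ r : ℝ) : Set Ω :=
  {ω | Differentiable ℂ (gef ξ ω) ∧ gef ξ ω 0 ≠ 0 ∧
    (∀ w : ℂ, ‖w‖ ≤ ρ + 1 → ‖gef ξ ω (r * w)‖ ≤ Real.exp (r ^ 2 * (‖w‖ ^ 2 / 2 + δ))) ∧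
    potentialDeficit ξ ρ r ω < δ * r ^ 4}

/-- Apply `norm_gef_le` with `q = (1 + η)^(-1/2)`. One factor `exp (η r²)` comes from the
coefficients, another absorbs the geometric sum, and the rest is the loss `η ‖w‖²/2`; `η` is chosen
so that all of this fits in `δ`. -/
theorem eventually_norm_gef_le (ξ : ℕ → Ω → ℂ) {ρ δ : ℝ} (hδ : 0 < δ) :
    ∀ᶠ r : ℝ in atTop,
      ∀ ω ∈ linearGrowthEvent ξ (Real.exp (δ / (2 + (ρ + 1) ^ 2) * r ^ 2)),
      ∀ w : ℂ, ‖w‖ ≤ ρ + 1 → ‖gef ξ ω (r * w)‖ ≤ Real.exp (r ^ 2 * (‖w‖ ^ 2 / 2 + δ)) := by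
  set η := δ / (2 + (ρ + 1) ^ 2) with hη
  have hη0 : 0 < η := by positivity
  set q : ℝ := (Real.sqrt (1 + η))⁻¹ with hq
  have hs1 : 1 < Real.sqrt (1 + η) := by
    rw [Real.lt_sqrt zero_le_one]
    linarith
  have hq0 : 0 < q := by positivity
  have hq1 : q < 1 := inv_lt_one_of_one_lt₀ hs1
  have hL : Tendsto (fun r : ℝ ↦ r ^ 2) atTop atTop := tendsto_pow_atTop two_ne_zero
  filter_upwards [hL.eventually (eventually_mul_pow_le_exp
    (∑' k : ℕ, ((k : ℝ) + 1) * q ^ k) 0 hη0)] with r h1 ω hω w hw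
  refine (norm_gef_le hq0 hq1 hω _).trans ?_
  rw [pow_zero, mul_one] at h1
  have h2 : ‖(r : ℂ) * w‖ ^ 2 / (2 * q ^ 2) = r ^ 2 * ‖w‖ ^ 2 * (1 + η) / 2 := by
    rw [hq, inv_pow, Real.sq_sqrt (by positivity), norm_mul, mul_pow, Complex.norm_real,
      Real.norm_eq_abs, sq_abs]
    field_simp
  rw [h2]
  calc _ ≤ Real.exp (η * r ^ 2) * Real.exp (η * r ^ 2) *
        Real.exp (r ^ 2 * ‖w‖ ^ 2 * (1 + η) / 2) := by gcongr
    _ = Real.exp (r ^ 2 * (‖w‖ ^ 2 / 2 + η * (2 + ‖w‖ ^ 2 / 2))) := by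
        rw [← Real.exp_add, ← Real.exp_add]
        congr 1
        ring
    _ ≤ _ := by
        gcongr
        have h3 : η * (2 + (ρ + 1) ^ 2) = δ := by
          rw [hη]
          field_simp
        rw [← h3]
        gcongr
        have : ‖w‖ ^ 2 ≤ (ρ + 1) ^ 2 := by gcongr
        have := sq_nonneg ‖w‖
        linarith

variable [MeasurableSpace Ω] {P : Measure Ω} [IsProbabilityMeasure P]

/-- Off the typical event the coefficients grow too fast, or `F(0) = 0`, or the deficit is large.
The second is null; the other two are exponentially small compared with the same lower bound for the
hole probability. -/
theorem tendsto_measure_hole_diff_typical (hmeas : ∀ k, Measurable (ξ k))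
    (hlaw : ∀ k, P.map (ξ k) = stdComplexGaussian) (hindep : iIndepFun ξ P)
    {ρ δ : ℝ} (hρ : 2 ≤ ρ) (hδ : 0 < δ) (hδ1 : δ ≤ 1) :
    Tendsto (fun r ↦ P (holeEvent ξ r \ typicalEvent ξ ρ δ r) / P (holeEvent ξ r)) atTop
      (𝓝 0) := by
  obtain ⟨c, hc, hlow⟩ := exists_measure_holeEvent_ge hmeas hlaw hindep
  set η := δ / (2 + (ρ + 1) ^ 2) with hη
  have hη0 : 0 < η := by positivity
  set C : ℝ := (ρ + 1) ^ 2 / 2 + 1 with hC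
  have hC0 : 0 < C := by positivity
  -- The exponent `s` must be below `1` for integrability of `|ζ|^(-2s)`, yet near `1` for the cost
  -- of the bound `B` to be below the gain `δ`.
  obtain ⟨s, hs, hs1, hs2⟩ : ∃ s : ℝ, s < 1 ∧ 3 / 4 ≤ s ∧
      4 * (1 - s) * (C * (ρ ^ 2 + 1)) ≤ δ := by
    refine ⟨1 - min (1 / 4) (δ / (4 * (C * (ρ ^ 2 + 1)))), ?_, ?_, ?_⟩
    · have : 0 < min (1 / 4) (δ / (4 * (C * (ρ ^ 2 + 1)))) := by positivity
      linarith
    · have := min_le_left (1 / 4) (δ / (4 * (C * (ρ ^ 2 + 1))))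
      linarith
    · have := min_le_right (1 / 4) (δ / (4 * (C * (ρ ^ 2 + 1))))
      rw [le_div_iff₀ (by positivity)] at this
      linarith
  have hL : Tendsto (fun r : ℝ ↦ r ^ 2) atTop atTop := tendsto_pow_atTop two_ne_zero
  have hL4 : Tendsto (fun r : ℝ ↦ (r ^ 2) ^ 2) atTop atTop := (tendsto_pow_atTop two_ne_zero).comp hL
  have hbound : ∀ᶠ r : ℝ in atTop, P (holeEvent ξ r \ typicalEvent ξ ρ δ r) / P (holeEvent ξ r) ≤
      ENNReal.ofReal (4 / c * Real.exp (-(r ^ 2) ^ 2)) +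
      ENNReal.ofReal (c⁻¹ * Real.exp (-(δ / 2) * (r ^ 2) ^ 2)) := by
    filter_upwards [eventually_ge_atTop 1, eventually_norm_gef_le ξ (ρ := ρ) hδ,
      hL.eventually (eventually_mul_pow_le_exp 2 0 hη0),
      hL.eventually (eventually_mul_pow_le_exp 62 2 (b := 2 * η) (by positivity)),
      hL.eventually (eventually_deficit_bound_le hρ hδ hs hC0.le hs1 hs2)] with r hr h1 h2 h3 h4
    have hr2 : 1 ≤ r ^ 2 := by nlinarith
    have hlow := hlow r hr
    set W := ∏ k ∈ Finset.range ⌊Real.exp 1 * r ^ 2⌋₊, ((k.factorial : ℝ) / (r ^ 2) ^ k /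
      (((⌊Real.exp 1 * r ^ 2⌋₊ : ℝ) + 1) ^ 2 * Real.exp 3)) with hW
    have hW30 : Real.exp (-30 * (r ^ 2) ^ 2) ≤ W := exp_neg_le_prod_factorial_div hr2
    set G : Set Ω := linearGrowthEvent ξ (Real.exp (η * r ^ 2)) with hG
    set G' : Set Ω := {ω | gef ξ ω 0 ≠ 0} with hG'
    have hG'm : MeasurableSet G' := by
      have h5 : Measurable fun ω ↦ gef ξ ω 0 := by
        simp only [gef_zero]
        exact hmeas 0
      exact h5 (measurableSet_singleton 0).compl
    have hsub : holeEvent ξ r \ typicalEvent ξ ρ δ r ⊆ Gᶜ ∪ G'ᶜ ∪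
        (holeEvent ξ r ∩ (G ∩ G') ∩ {ω | δ * r ^ 4 ≤ potentialDeficit ξ ρ r ω}) := by
      rintro ω ⟨hω, hω'⟩
      by_cases hωG : ω ∈ G
      · by_cases hωG' : ω ∈ G'
        · refine Or.inr ⟨⟨hω, hωG, hωG'⟩, ?_⟩
          by_contra hcon
          exact hω' ⟨differentiable_gef hωG, hωG', h1 ω hωG, not_le.1 hcon⟩
        · exact Or.inl (Or.inr hωG')
      · exact Or.inl (Or.inl hωG)
    have hGF : ∀ ω ∈ G ∩ G', Differentiable ℂ (gef ξ ω) ∧ gef ξ ω 0 ≠ 0 ∧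
        ∀ w : ℂ, ‖w‖ ≤ ρ + 1 → ‖gef ξ ω (r * w)‖ ≤ Real.exp (C * r ^ 2) := by
      refine fun ω hω ↦ ⟨differentiable_gef hω.1, hω.2, fun w hw ↦ (h1 ω hω.1 w hw).trans ?_⟩
      rw [Real.exp_le_exp, mul_comm]
      gcongr
      rw [hC]
      gcongr
    -- The inequality `62 r⁴ ≤ exp (2 η r²)` gives an exponent of `31 r⁴`: `30` pay for the hole
    -- probability and `1` is left as decay.
    have hA : P Gᶜ ≤ ENNReal.ofReal (4 / c * Real.exp (-(r ^ 2) ^ 2)) * P (holeEvent ξ r) := by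
      rw [pow_zero, mul_one] at h2
      refine (measure_compl_linearGrowthEvent_le hmeas hlaw h2).trans ?_
      refine le_trans ?_ (mul_le_mul_right hlow _)
      rw [← ENNReal.ofReal_mul (by positivity)]
      refine ENNReal.ofReal_le_ofReal ?_
      rw [← Real.exp_nat_mul]
      calc 4 * Real.exp (-Real.exp ((2 : ℕ) * (η * r ^ 2)) / 2)
          ≤ 4 * (Real.exp (-(r ^ 2) ^ 2) * Real.exp (-30 * (r ^ 2) ^ 2)) := by
            rw [← Real.exp_add]
            gcongr
            push_cast
            rw [← mul_assoc]
            linarith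
        _ ≤ 4 * (Real.exp (-(r ^ 2) ^ 2) * W) := by gcongr
        _ = _ := by
            field_simp
    have hB : P (holeEvent ξ r ∩ (G ∩ G') ∩ {ω | δ * r ^ 4 ≤ potentialDeficit ξ ρ r ω}) ≤
        ENNReal.ofReal (c⁻¹ * Real.exp (-(δ / 2) * (r ^ 2) ^ 2)) * P (holeEvent ξ r) := by
      refine (measure_hole_inter_deficit_le hmeas hlaw hindep hρ hr (by linarith) hs
        (Real.exp_pos _) ((measurableSet_linearGrowthEvent hmeas _).inter hG'm) hGF).trans ?_
      refine le_trans ?_ (mul_le_mul_right hlow _)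
      rw [← ENNReal.ofReal_mul (by positivity)]
      refine ENNReal.ofReal_le_ofReal ?_
      rw [show r ^ 4 = (r ^ 2) ^ 2 by ring]
      refine h4.trans (le_of_eq ?_)
      field_simp
    have hC' : P G'ᶜ = 0 := by
      have := ae_gef_zero_ne_zero hmeas hlaw
      rwa [ae_iff] at this
    refine ENNReal.div_le_of_le_mul ?_
    calc P (holeEvent ξ r \ typicalEvent ξ ρ δ r) ≤ P Gᶜ + P G'ᶜ + _ :=
          (measure_mono hsub).trans ((measure_union_le _ _).trans
            (add_le_add_left (measure_union_le _ _) _))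
      _ ≤ _ := by
          rw [hC', add_zero, add_mul]
          exact add_le_add hA hB
  have hlim : ∀ a b : ℝ, 0 < b → Tendsto (fun r : ℝ ↦ ENNReal.ofReal
      (a * Real.exp (-b * (r ^ 2) ^ 2))) atTop (𝓝 0) := by
    intro a b hb
    have h1 : Tendsto (fun r : ℝ ↦ a * Real.exp (-b * (r ^ 2) ^ 2)) atTop (𝓝 (a * 0)) := by
      refine (Real.tendsto_exp_atBot.comp ?_).const_mul a
      exact hL4.const_mul_atTop_of_neg (by linarith)
    rw [mul_zero] at h1
    simpa using ENNReal.tendsto_ofReal h1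
  have h0 := (hlim (4 / c) 1 one_pos).add (hlim c⁻¹ (δ / 2) (by positivity))
  rw [add_zero] at h0
  refine tendsto_of_tendsto_of_tendsto_of_le_of_le' tendsto_const_nhds h0
    (Eventually.of_forall fun _ ↦ zero_le) ?_
  filter_upwards [hbound] with r hr
  simpa using hr

end

/-! ### Jensen's formula and logarithmic potentials -/

/-- The truncated logarithmic kernel `log⁺ (t / |w|)`. -/
def logKernel (t : ℝ) (w : ℂ) : ℝ := Real.posLog (t * ‖w‖⁻¹)

theorem logKernel_nonneg (t : ℝ) (w : ℂ) : 0 ≤ logKernel t w := Real.posLog_nonneg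

@[fun_prop]
theorem measurable_logKernel (t : ℝ) : Measurable (logKernel t) := by
  unfold logKernel
  have : Measurable Real.posLog := by
    unfold Real.posLog
    fun_prop
  fun_prop

theorem logKernel_eq_zero {t : ℝ} (ht : 0 ≤ t) {w : ℂ} (hw : t ≤ ‖w‖) : logKernel t w = 0 := by
  rw [logKernel, Real.posLog_eq_zero_iff, abs_of_nonneg (by positivity), ← div_eq_mul_inv]
  exact div_le_one_of_le₀ hw (norm_nonneg w)

theorem logKernel_eq_log {t : ℝ} {w : ℂ} (hw0 : w ≠ 0) (hw : ‖w‖ ≤ t) :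
    logKernel t w = Real.log t - Real.log ‖w‖ := by
  have h0 : 0 < ‖w‖ := norm_pos_iff.2 hw0
  have ht : 0 < t := h0.trans_le hw
  rw [logKernel, Real.posLog_eq_log, Real.log_mul ht.ne' (by positivity), Real.log_inv, sub_eq_add_neg]
  rw [abs_of_nonneg (by positivity), ← div_eq_mul_inv]
  exact (one_le_div h0).2 hw

theorem lintegral_zeroCountingMeasure (f : ℂ → ℂ) (g : ℂ → ENNReal) :
    ∫⁻ z, g z ∂zeroCountingMeasure f =
      ∑' z : {z : ℂ // f z = 0}, (analyticOrderNatAt f (z : ℂ) : ENNReal) * g z := by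
  rw [zeroCountingMeasure, lintegral_sum_measure]
  simp_rw [lintegral_smul_measure, lintegral_dirac, smul_eq_mul]

theorem divisor_eq_analyticOrderNatAt {f : ℂ → ℂ} (hf : Differentiable ℂ f) {s : Set ℂ} {z : ℂ}
    (hz : z ∈ s) : MeromorphicOn.divisor f s z = (analyticOrderNatAt f z : ℤ) := by
  rw [MeromorphicOn.AnalyticOnNhd.divisor_apply (fun z _ ↦ hf.analyticAt z) hz, analyticOrderNatAt]
  induction analyticOrderAt f z using ENat.recTopCoe with
  | top => simp
  | coe n => simp

/-- Jensen's formula, as a statement on the zero counting measure. -/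
theorem lintegral_logKernel_zeroCountingMeasure {f : ℂ → ℂ} (hf : Differentiable ℂ f) {a : ℂ}
    (ha : f a ≠ 0) {t : ℝ} (ht : 0 < t) :
    ∫⁻ z, ENNReal.ofReal (logKernel t (z - a)) ∂zeroCountingMeasure f =
      ENNReal.ofReal (Real.circleAverage (fun z ↦ Real.log ‖f z‖) a t - Real.log ‖f a‖) ∧
    Real.log ‖f a‖ ≤ Real.circleAverage (fun z ↦ Real.log ‖f z‖) a t := by
  have hA : AnalyticOnNhd ℂ f (Metric.closedBall a |t|) := fun z _ ↦ hf.analyticAt z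
  rw [hA.circleAverage_log_norm ht.ne' ha, add_sub_cancel_right, abs_of_pos ht]
  set D := MeromorphicOn.divisor f (Metric.closedBall a t) with hD
  have hfin : D.support.Finite := D.finiteSupport (isCompact_closedBall a t)
  have hsub : (Function.support fun u ↦ (D u : ℝ) * Real.log (t * ‖a - u‖⁻¹)) ⊆
      (hfin.toFinset : Set ℂ) := by
    intro u hu
    simp only [Function.mem_support, ne_eq, mul_eq_zero, not_or, Int.cast_eq_zero] at hu
    simpa using hu.1
  have hmem : ∀ u ∈ hfin.toFinset, u ∈ Metric.closedBall a t := by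
    intro u hu
    by_contra hcon
    exact (hfin.mem_toFinset.1 hu) (Function.locallyFinsuppWithin.apply_eq_zero_of_notMem D hcon)
  have hterm : ∀ u ∈ hfin.toFinset, f u = 0 ∧
      (D u : ℝ) * Real.log (t * ‖a - u‖⁻¹) = analyticOrderNatAt f u * logKernel t (u - a) := by
    intro u hu
    have h1 := hmem u hu
    have h2 := divisor_eq_analyticOrderNatAt hf h1
    have h3 : f u = 0 := by
      by_contra hne
      refine hfin.mem_toFinset.1 hu (h2.trans ?_)
      rw [analyticOrderNatAt, (hf.analyticAt u).analyticOrderAt_eq_zero.2 hne]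
      simp
    refine ⟨h3, ?_⟩
    have h4 : u - a ≠ 0 := by
      rw [sub_ne_zero]
      rintro rfl
      exact ha h3
    rw [hD, h2, Int.cast_natCast, logKernel, Real.posLog_eq_log, norm_sub_rev]
    rw [abs_of_nonneg (by positivity), ← div_eq_mul_inv, one_le_div (norm_pos_iff.2 h4)]
    rwa [mem_closedBall_iff_norm] at h1
  rw [finsum_eq_sum_of_support_subset _ hsub, Finset.sum_congr rfl fun u hu ↦ (hterm u hu).2]
  have hnn : ∀ u ∈ hfin.toFinset, 0 ≤ (analyticOrderNatAt f u : ℝ) * logKernel t (u - a) :=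
    fun u _ ↦ mul_nonneg (Nat.cast_nonneg _) (logKernel_nonneg _ _)
  refine ⟨?_, le_add_of_nonneg_left (Finset.sum_nonneg hnn)⟩
  rw [lintegral_zeroCountingMeasure]
  have h5 := tsum_subtype {z : ℂ | f z = 0}
    fun z ↦ (analyticOrderNatAt f z : ENNReal) * ENNReal.ofReal (logKernel t (z - a))
  refine h5.trans ?_
  rw [tsum_eq_sum (s := hfin.toFinset), ENNReal.ofReal_sum_of_nonneg hnn]
  · refine Finset.sum_congr rfl fun u hu ↦ ?_
    rw [Set.indicator_of_mem (show u ∈ {z : ℂ | f z = 0} from (hterm u hu).1),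
      ENNReal.ofReal_mul (Nat.cast_nonneg _), ENNReal.ofReal_natCast]
  · intro u hu
    refine Set.indicator_apply_eq_zero.2 fun _ ↦ ?_
    by_cases hut : u ∈ Metric.closedBall a t
    · have h6 : D u = 0 := by simpa using hu
      rw [hD, divisor_eq_analyticOrderNatAt hf hut, Int.natCast_eq_zero] at h6
      simp [h6]
    · rw [mem_closedBall_iff_norm, not_le] at hut
      rw [logKernel_eq_zero ht.le hut.le]
      simp

/-- `u` is a logarithmic potential of the measure `X`: Jensen's formula holds on almost all
circles, and on the circles centred at the origin. -/
structure IsLogPotential (X : Measure ℂ) (u : ℂ → ℝ) : Prop where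
  measurable : Measurable u
  locallyIntegrable : LocallyIntegrable u
  ae_lintegral_eq : ∀ t : ℝ, 0 < t → ∀ᵐ a : ℂ, ∫⁻ w, ENNReal.ofReal (logKernel t (w - a)) ∂X =
    ENNReal.ofReal (∫ ζ, u (a + t * ζ) ∂unitCircleMeasure - u a) ∧
    u a ≤ ∫ ζ, u (a + t * ζ) ∂unitCircleMeasure
  lintegral_eq_zero : ∀ t : ℝ, 0 < t → ∫⁻ w, ENNReal.ofReal (logKernel t w) ∂X =
    ENNReal.ofReal (∫ ζ, u (t * ζ) ∂unitCircleMeasure - u 0) ∧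
    u 0 ≤ ∫ ζ, u (t * ζ) ∂unitCircleMeasure

/-- Near any point there is a centre `a` at which the kernel integral is finite, and `log⁺ (e/|w -
a|) ≥ 1` on the punctured unit disk around `a`. -/
theorem IsLogPotential.isLocallyFiniteMeasure {X : Measure ℂ} {u : ℂ → ℝ}
    (h : IsLogPotential X u) : IsLocallyFiniteMeasure X := by
  refine ⟨fun x ↦ ?_⟩
  have h1 : ∀ᵐ a : ℂ, a ≠ x ∧ ∫⁻ w, ENNReal.ofReal (logKernel (Real.exp 1) (w - a)) ∂X < ⊤ := by
    filter_upwards [h.ae_lintegral_eq _ (Real.exp_pos 1), Measure.ae_ne volume x] with a ha hax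
    exact ⟨hax, ha.1.trans_lt ENNReal.ofReal_lt_top⟩
  obtain ⟨a, ⟨hax, ha⟩, hdist⟩ := (Measure.dense_of_ae h1).exists_dist_lt x one_pos
  -- The kernel is `0` at its centre by the convention for `0⁻¹`, so `a` is removed; `a ≠ x` keeps
  -- this a neighbourhood of `x`.
  refine ⟨Metric.ball a 1 \ {a}, ?_, ?_⟩
  · refine (Metric.isOpen_ball.sdiff isClosed_singleton).mem_nhds ⟨hdist, hax.symm⟩
  · refine lt_of_le_of_lt ?_ ha
    have hm : MeasurableSet (Metric.ball a 1 \ {a}) :=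
      measurableSet_ball.diff (measurableSet_singleton a)
    rw [← lintegral_indicator_one hm]
    refine lintegral_mono fun w ↦ ?_
    by_cases hw : w ∈ Metric.ball a 1 \ {a}
    · rw [Set.indicator_of_mem hw, Pi.one_apply, ← ENNReal.ofReal_one]
      refine ENNReal.ofReal_le_ofReal ?_
      obtain ⟨hw1, hw2⟩ := hw
      have hwa : w - a ≠ 0 := sub_ne_zero.2 hw2
      rw [mem_ball_iff_norm] at hw1
      have he := Real.add_one_le_exp (1 : ℝ)
      rw [logKernel_eq_log hwa (by linarith), Real.log_exp]
      have := Real.log_nonpos (norm_nonneg _) hw1.le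
      linarith
    · rw [Set.indicator_of_notMem hw]
      exact zero_le

theorem ae_ne_zero_of_differentiable {f : ℂ → ℂ} (hf : Differentiable ℂ f) (h0 : f 0 ≠ 0) :
    ∀ᵐ a : ℂ, f a ≠ 0 := by
  have h1 := AnalyticOnNhd.preimage_zero_mem_codiscrete (fun z _ ↦ hf.analyticAt z) h0
  have h2 := ae_restrict_le_codiscreteWithin (μ := (volume : Measure ℂ)) MeasurableSet.univ h1
  rw [Measure.restrict_univ] at h2
  exact h2

/-- A disk with normalised area is a mixture of centred circles, so integrability follows from
Jensen's formula at the origin. -/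
theorem locallyIntegrable_log_norm {f : ℂ → ℂ} (hf : Differentiable ℂ f) (h0 : f 0 ≠ 0) :
    LocallyIntegrable fun z ↦ Real.log ‖f z‖ := by
  rw [locallyIntegrable_iff]
  intro k hk
  obtain ⟨R, hR⟩ := hk.isBounded.exists_norm_le
  have hsub : k ⊆ shell 0 ((|R| + 1) ^ 2) := by
    intro w hw
    refine ⟨by positivity, ?_⟩
    have := (hR w hw).trans (le_abs_self R)
    gcongr
    linarith
  refine IntegrableOn.mono_set ?_ hsub
  have hV : 0 < Real.pi * ((|R| + 1) ^ 2 - 0) := by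
    rw [sub_zero]
    positivity
  set c := ENNReal.ofReal (Real.pi * ((|R| + 1) ^ 2 - 0))⁻¹ with hc
  have hprob : IsProbabilityMeasure
      (c • (volume : Measure ℂ).restrict (shell 0 ((|R| + 1) ^ 2))) := by
    refine ⟨?_⟩
    rw [Measure.smul_apply, Measure.restrict_apply_univ, volume_shell le_rfl (by positivity),
      smul_eq_mul, ← ENNReal.ofReal_mul (by positivity), inv_mul_cancel₀ hV.ne', ENNReal.ofReal_one]
  have h1 := integrable_log_norm_mconv (ρ := |R| + 1)
    (τ := c • (volume : Measure ℂ).restrict (shell 0 ((|R| + 1) ^ 2))) hf h0 (by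
      refine Measure.ae_smul_measure ?_ _
      filter_upwards [ae_restrict_mem (measurableSet_shell 0 ((|R| + 1) ^ 2))] with w hw
      exact le_of_sq_le_sq hw.2.le (by positivity))
  rw [restrict_shell_mconv] at h1
  exact (integrable_smul_measure (ENNReal.ofReal_pos.2 (inv_pos.2 hV)).ne' ENNReal.ofReal_ne_top).1 h1

/-- The rescaled logarithm `r⁻² log |f (r w)|`. -/
def scaledLog (f : ℂ → ℂ) (r : ℝ) (w : ℂ) : ℝ := Real.log ‖f (r * w)‖ / r ^ 2

theorem lintegral_logKernel_scaled {f : ℂ → ℂ} (hf : Differentiable ℂ f) {r : ℝ} (hr : r ≠ 0)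
    {a : ℂ} (ha : f (r * a) ≠ 0) {t : ℝ} (ht : 0 < t) :
    ∫⁻ w, ENNReal.ofReal (logKernel t (w - a)) ∂(ENNReal.ofReal (1 / r ^ 2) •
        (zeroCountingMeasure f).map fun z ↦ z / (r : ℂ)) =
      ENNReal.ofReal (∫ ζ, scaledLog f r (a + t * ζ) ∂unitCircleMeasure - scaledLog f r a) ∧
    scaledLog f r a ≤ ∫ ζ, scaledLog f r (a + t * ζ) ∂unitCircleMeasure := by
  have hr' : (r : ℂ) ≠ 0 := by exact_mod_cast hr
  have htr : 0 < t * |r| := by positivity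
  obtain ⟨h1, h2⟩ := lintegral_logKernel_zeroCountingMeasure hf ha htr
  have hd : Differentiable ℂ fun ζ : ℂ ↦ f (r * (a + t * ζ)) := hf.comp (by fun_prop)
  have h3 : ∫ ζ, scaledLog f r (a + t * ζ) ∂unitCircleMeasure =
      Real.circleAverage (fun z ↦ Real.log ‖f z‖) (r * a) (t * |r|) / r ^ 2 := by
    unfold scaledLog
    rw [integral_div, integral_unitCircleMeasure (measurable_log_norm hd)]
    congr 1
    have h4 : t * |r| = |t * r| := by rw [abs_mul, abs_of_pos ht]
    rw [h4, Real.circleAverage_abs_radius,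
      Real.circleAverage_eq_circleAverage_zero_one (c := r * a)]
    congr 1
    ext z
    congr 3
    push_cast
    ring
  have hr2 : 0 < r ^ 2 := by positivity
  rw [h3]
  refine ⟨?_, ?_⟩
  · rw [lintegral_smul_measure, lintegral_map (by fun_prop) (by fun_prop)]
    have h5 : ∀ z : ℂ, logKernel t (z / r - a) = logKernel (t * |r|) (z - r * a) := by
      intro z
      have h6 : z - r * a = r * (z / r - a) := by
        field_simp
      rw [logKernel, logKernel, h6, norm_mul, Complex.norm_real, Real.norm_eq_abs, mul_inv]
      congr 1
      have : |r| ≠ 0 := abs_ne_zero.2 hr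
      field_simp
    simp_rw [h5]
    rw [h1, smul_eq_mul, ← ENNReal.ofReal_mul (by positivity), scaledLog]
    congr 1
    ring
  · unfold scaledLog
    gcongr

theorem isLogPotential_scaled {f : ℂ → ℂ} (hf : Differentiable ℂ f) (h0 : f 0 ≠ 0) {r : ℝ}
    (hr : r ≠ 0) : IsLogPotential (ENNReal.ofReal (1 / r ^ 2) •
      (zeroCountingMeasure f).map fun z ↦ z / (r : ℂ)) (scaledLog f r) := by
  have hd : Differentiable ℂ fun w : ℂ ↦ f (r * w) := hf.comp (by fun_prop)
  have h0' : f (r * 0) ≠ 0 := by simpa using h0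
  refine ⟨(measurable_log_norm hd).div_const _, ?_, fun t ht ↦ ?_, fun t ht ↦ ?_⟩
  · have := (locallyIntegrable_log_norm hd h0').smul (r ^ 2)⁻¹
    refine this.congr (ae_of_all _ fun w ↦ ?_)
    simp [scaledLog, div_eq_inv_mul]
  · filter_upwards [ae_ne_zero_of_differentiable hd h0'] with a ha
    exact lintegral_logKernel_scaled hf hr ha ht
  · simpa using lintegral_logKernel_scaled hf hr h0' ht

theorem scaled_zeroCountingMeasure_ball {f : ℂ → ℂ} (r : ℝ) (hr : 0 < r)
    (h : ∀ z : ℂ, ‖z‖ < r → f z ≠ 0) :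
    (ENNReal.ofReal (1 / r ^ 2) • (zeroCountingMeasure f).map fun z ↦ z / (r : ℂ))
      (Metric.ball 0 1) = 0 := by
  rw [Measure.smul_apply, Measure.map_apply (by fun_prop) measurableSet_ball, smul_eq_mul]
  refine mul_eq_zero_of_right _ ?_
  have hm : MeasurableSet ((fun z : ℂ ↦ z / (r : ℂ)) ⁻¹' Metric.ball 0 1) :=
    (measurable_id.div_const (r : ℂ)) measurableSet_ball
  rw [zeroCountingMeasure, Measure.sum_apply _ hm, ENNReal.tsum_eq_zero]
  intro z
  rw [Measure.smul_apply, Measure.dirac_apply, Set.indicator_of_notMem, smul_zero]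
  intro hz
  refine h z ?_ z.2
  simp only [Set.mem_preimage, mem_ball_zero_iff, norm_div, Complex.norm_real,
    Real.norm_of_nonneg hr.le] at hz
  exact (div_lt_one hr).1 hz

/-- Layer cake: the superlevel set at height `s > 0` is a punctured disk of radius `t e^(-s)`. The
total mass normalises the smoothing by the kernel. -/
theorem lintegral_logKernel {t : ℝ} (ht : 0 < t) :
    ∫⁻ w : ℂ, ENNReal.ofReal (logKernel t w) = ENNReal.ofReal (Real.pi * t ^ 2 / 2) := by
  rw [lintegral_eq_lintegral_meas_lt volume (ae_of_all _ (logKernel_nonneg t)) (by fun_prop)]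
  have h1 : ∀ s ∈ Set.Ioi (0 : ℝ), volume {w : ℂ | s < logKernel t w} =
      ENNReal.ofReal (Real.pi * t ^ 2 * Real.exp (-2 * s)) := by
    intro s hs
    have hs : 0 < s := hs
    have h2 : {w : ℂ | s < logKernel t w} = Metric.ball 0 (t * Real.exp (-s)) \ {0} := by
      ext w
      by_cases hw : w = 0
      · simp [hw, logKernel, hs.le]
      have hw0 : 0 < ‖w‖ := norm_pos_iff.2 hw
      simp only [Set.mem_ofPred_eq, Set.mem_sdiff, mem_ball_zero_iff, Set.mem_singleton_iff, hw,
        not_false_eq_true, and_true]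
      rcases le_total t ‖w‖ with h | h
      · rw [logKernel_eq_zero ht.le h]
        refine iff_of_false (not_lt.2 hs.le) (not_lt.2 (le_trans ?_ h))
        have : Real.exp (-s) ≤ 1 := Real.exp_le_one_iff.2 (by linarith)
        nlinarith
      · rw [logKernel_eq_log hw h, lt_sub_comm, Real.log_lt_iff_lt_exp hw0, sub_eq_add_neg,
          Real.exp_add, Real.exp_log ht]
    rw [h2, measure_sdiff_null (by simp), Complex.volume_ball,
      ← ENNReal.ofReal_pow (by positivity), mul_pow, ← Real.exp_nat_mul]
    have h3 : (NNReal.pi : ENNReal) = ENNReal.ofReal Real.pi := by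
      rw [← NNReal.coe_real_pi, ENNReal.ofReal_coe_nnreal]
    rw [h3, ← ENNReal.ofReal_mul (by positivity)]
    congr 1
    push_cast
    ring_nf
  rw [setLIntegral_congr_fun measurableSet_Ioi h1, ← ofReal_integral_eq_lintegral_ofReal]
  · rw [integral_const_mul, integral_exp_mul_Ioi (by norm_num)]
    congr 1
    norm_num
    ring
  · exact (integrableOn_exp_mul_Ioi (by norm_num) 0).const_mul _
  · exact ae_of_all _ fun s ↦ by positivity

theorem integrable_logKernel {t : ℝ} (ht : 0 < t) : Integrable (logKernel t) := by
  refine ⟨(measurable_logKernel t).aestronglyMeasurable, ?_⟩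
  rw [hasFiniteIntegral_iff_ofReal (ae_of_all _ (logKernel_nonneg t)), lintegral_logKernel ht]
  exact ENNReal.ofReal_lt_top

theorem integral_logKernel {t : ℝ} (ht : 0 < t) :
    ∫ w, logKernel t w = Real.pi * t ^ 2 / 2 := by
  rw [integral_eq_lintegral_of_nonneg_ae (ae_of_all _ (logKernel_nonneg t))
    (measurable_logKernel t).aestronglyMeasurable, lintegral_logKernel ht,
    ENNReal.toReal_ofReal (by positivity)]

/-! ### Recovering a measure from its potential -/

/-- The mean of `ψ` over the circle of radius `t` around `w`. -/
def circMean (t : ℝ) (ψ : ℂ → ℝ) (w : ℂ) : ℝ := ∫ ζ, ψ (w - t * ζ) ∂unitCircleMeasure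

/-- The convolution of `ψ` with the truncated logarithmic kernel. -/
def logSmooth (t : ℝ) (ψ : ℂ → ℝ) (w : ℂ) : ℝ := ∫ a, ψ a * logKernel t (w - a)

section

variable {ψ u : ℂ → ℝ} {R t : ℝ}

theorem exists_bound_of_support (hψ : Continuous ψ) (hR : ∀ w, R < ‖w‖ → ψ w = 0) :
    ∃ C, 0 ≤ C ∧ ∀ w, |ψ w| ≤ C := by
  obtain ⟨C, hC⟩ := (isCompact_closedBall (0 : ℂ) R).exists_bound_of_continuousOn hψ.continuousOn
  refine ⟨max C 0, le_max_right _ _, fun w ↦ ?_⟩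
  by_cases hw : ‖w‖ ≤ R
  · exact (hC w (by simpa using hw)).trans (le_max_left _ _)
  · rw [hR w (not_le.1 hw), abs_zero]
    exact le_max_right _ _

theorem measurable_circMean (hψ : Measurable ψ) : Measurable (circMean t ψ) := by
  have h : Measurable fun p : ℂ × ℂ ↦ ψ (p.1 - t * p.2) := hψ.comp (by fun_prop)
  exact (h.stronglyMeasurable.integral_prod_right' (ν := unitCircleMeasure)).measurable

theorem abs_circMean_le {C : ℝ} (hC : ∀ w, |ψ w| ≤ C) (w : ℂ) : |circMean t ψ w| ≤ C := by
  have := norm_integral_le_of_norm_le_const (μ := unitCircleMeasure)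
    (f := fun ζ ↦ ψ (w - t * ζ)) (ae_of_all _ fun ζ ↦ hC _)
  simpa [circMean] using this

theorem norm_sub_mul_ge (ht : 0 < t) (w : ℂ) {ζ : ℂ} (hζ : ‖ζ‖ = 1) :
    ‖w‖ - t ≤ ‖w - t * ζ‖ := by
  have h1 : ‖(t : ℂ) * ζ‖ = t := by
    rw [norm_mul, hζ, mul_one, Complex.norm_real, Real.norm_of_nonneg ht.le]
  have := norm_sub_norm_le w (t * ζ)
  rwa [h1] at this

theorem circMean_eq_zero (ht : 0 < t) (hR : ∀ w, R < ‖w‖ → ψ w = 0) {w : ℂ}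
    (hw : R + t < ‖w‖) : circMean t ψ w = 0 := by
  refine integral_eq_zero_of_ae ?_
  filter_upwards [ae_unitCircleMeasure_norm_eq_one] with ζ hζ
  refine hR _ ?_
  have := norm_sub_mul_ge ht w hζ
  linarith

theorem integrable_mul_of_locallyIntegrable (hul : LocallyIntegrable u) {g : ℂ → ℝ} {C : ℝ}
    (hg : Measurable g) (hC : ∀ w, |g w| ≤ C) (hR : ∀ w, R < ‖w‖ → g w = 0) :
    Integrable fun w ↦ u w * g w := by
  have h1 : IntegrableOn u (Metric.closedBall 0 R) :=
    hul.integrableOn_isCompact (isCompact_closedBall 0 R)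
  have h2 : IntegrableOn (fun w ↦ u w * g w) (Metric.closedBall 0 R) :=
    h1.mul_bdd (c := C) hg.aestronglyMeasurable (ae_of_all _ hC)
  refine (integrableOn_iff_integrable_of_support_subset ?_).1 h2
  intro w hw
  by_contra hcon
  exact hw (by simp [hR w (by simpa using hcon)])

theorem integrable_mul_translate (hψ : Continuous ψ) (hR : ∀ w, R < ‖w‖ → ψ w = 0)
    (hu : Measurable u) (hul : LocallyIntegrable u) (ht : 0 < t) :
    Integrable (fun p : ℂ × ℂ ↦ u p.2 * ψ (p.2 - t * p.1)) (unitCircleMeasure.prod volume) := by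
  obtain ⟨C, hC0, hC⟩ := exists_bound_of_support hψ hR
  have h1 : IntegrableOn u (Metric.closedBall 0 (R + t)) :=
    hul.integrableOn_isCompact (isCompact_closedBall 0 (R + t))
  have h2 : Integrable ((Metric.closedBall (0 : ℂ) (R + t)).indicator u) :=
    (integrable_indicator_iff measurableSet_closedBall).2 h1
  have h3 := ((h2.norm.comp_snd unitCircleMeasure)).mul_const C
  refine h3.mono' (by
    have := hψ.measurable
    exact ((hu.comp measurable_snd).mul (this.comp (by fun_prop))).aestronglyMeasurable) ?_
  have h4 : ∀ᵐ p ∂(unitCircleMeasure.prod (volume : Measure ℂ)), ‖p.1‖ = 1 :=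
    Measure.quasiMeasurePreserving_fst.ae ae_unitCircleMeasure_norm_eq_one
  filter_upwards [h4] with p hp
  by_cases hp2 : ‖p.2‖ ≤ R + t
  · rw [Set.indicator_of_mem (by simpa using hp2), norm_mul]
    gcongr
    exact hC _
  · have := norm_sub_mul_ge ht p.2 hp
    rw [hR _ (by linarith), mul_zero, norm_zero]
    positivity

theorem integrable_translate_mul (hψ : Continuous ψ) (hR : ∀ w, R < ‖w‖ → ψ w = 0)
    (hu : Measurable u) (hul : LocallyIntegrable u) (ht : 0 < t) :
    Integrable (fun p : ℂ × ℂ ↦ u (p.2 + t * p.1) * ψ p.2) (unitCircleMeasure.prod volume) := by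
  -- The shear `(ζ, a) ↦ (ζ, a + t ζ)` preserves the product measure and carries one integrand to
  -- the other.
  have h1 : MeasurePreserving (fun p : ℂ × ℂ ↦ (p.1, p.2 + t * p.1))
      (unitCircleMeasure.prod volume) (unitCircleMeasure.prod volume) :=
    (MeasurePreserving.id _).skew_product (g := fun ζ a : ℂ ↦ a + t * ζ)
      (by fun_prop) (ae_of_all _ fun ζ ↦ map_add_right_eq_self _ _)
  have h2 := h1.integrable_comp_of_integrable (integrable_mul_translate hψ hR hu hul ht)
  refine h2.congr (ae_of_all _ fun p ↦ ?_)
  simp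

/-- Fubini and translation invariance move the circular mean from `u` to the test function. -/
theorem integral_mean_mul (hψ : Continuous ψ) (hR : ∀ w, R < ‖w‖ → ψ w = 0)
    (hu : Measurable u) (hul : LocallyIntegrable u) (ht : 0 < t) :
    Integrable (fun a ↦ (∫ ζ, u (a + t * ζ) ∂unitCircleMeasure) * ψ a) ∧
    ∫ a, (∫ ζ, u (a + t * ζ) ∂unitCircleMeasure) * ψ a = ∫ w, u w * circMean t ψ w := by
  have h1 := integrable_translate_mul hψ hR hu hul ht
  have h2 := integrable_mul_translate hψ hR hu hul ht
  refine ⟨by simpa only [integral_mul_const] using h1.integral_prod_right, ?_⟩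
  simp only [← integral_mul_const, circMean, ← integral_const_mul]
  rw [← integral_integral_swap (f := fun ζ a ↦ u (a + t * ζ) * ψ a) h1,
    ← integral_integral_swap (f := fun ζ w ↦ u w * ψ (w - t * ζ)) h2]
  congr 1
  ext ζ
  rw [← integral_add_right_eq_self (fun w ↦ u w * ψ (w - t * ζ)) (t * ζ)]
  simp

theorem integrable_mul_circMean_sub (hψ : Continuous ψ) (hR : ∀ w, R < ‖w‖ → ψ w = 0)
    (hul : LocallyIntegrable u) (ht : 0 < t) :
    Integrable fun w ↦ u w * (circMean t ψ w - ψ w) := by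
  obtain ⟨C, hC0, hC⟩ := exists_bound_of_support hψ hR
  refine integrable_mul_of_locallyIntegrable (C := C + C) (R := R + t) hul
    ((measurable_circMean hψ.measurable).sub hψ.measurable) (fun w ↦ ?_) fun w hw ↦ ?_
  · exact (abs_sub _ _).trans (add_le_add (abs_circMean_le hC w) (hC w))
  · rw [circMean_eq_zero ht hR hw, hR w (by linarith), sub_zero]

theorem integral_mul_circMean_sub (hψ : Continuous ψ) (hR : ∀ w, R < ‖w‖ → ψ w = 0)
    (hu : Measurable u) (hul : LocallyIntegrable u) (ht : 0 < t) :
    ∫ w, u w * (circMean t ψ w - ψ w) =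
      ∫ a, (∫ ζ, u (a + t * ζ) ∂unitCircleMeasure - u a) * ψ a := by
  obtain ⟨C, hC0, hC⟩ := exists_bound_of_support hψ hR
  obtain ⟨h1, h2⟩ := integral_mean_mul hψ hR hu hul ht
  have h3 : Integrable fun w ↦ u w * ψ w :=
    integrable_mul_of_locallyIntegrable hul hψ.measurable hC hR
  have h4 : Integrable fun w ↦ u w * circMean t ψ w := by
    refine ((integrable_mul_circMean_sub hψ hR hul ht).add h3).congr (ae_of_all _ fun w ↦ ?_)
    simp only [Pi.add_apply]
    ring
  simp only [mul_sub, sub_mul]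
  rw [integral_sub h4 h3, integral_sub h1 h3, h2]

/-- The distributional form of Jensen's formula. -/
theorem IsLogPotential.integral_logSmooth {X : Measure ℂ} (h : IsLogPotential X u)
    (hψ : Continuous ψ) (hR : ∀ w, R < ‖w‖ → ψ w = 0) (ht : 0 < t) :
    ∫ w, logSmooth t ψ w ∂X = ∫ w, u w * (circMean t ψ w - ψ w) := by
  have hX := h.isLocallyFiniteMeasure
  obtain ⟨C, hC0, hC⟩ := exists_bound_of_support hψ hR
  have hint : ∀ᵐ a : ℂ, Integrable (fun w ↦ logKernel t (w - a)) X ∧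
      ∫ w, logKernel t (w - a) ∂X = ∫ ζ, u (a + t * ζ) ∂unitCircleMeasure - u a := by
    filter_upwards [h.ae_lintegral_eq t ht] with a ha
    have hm : Measurable fun w ↦ logKernel t (w - a) := by fun_prop
    have hnn := ae_of_all X fun w ↦ logKernel_nonneg t (w - a)
    refine ⟨⟨hm.aestronglyMeasurable, ?_⟩, ?_⟩
    · rw [hasFiniteIntegral_iff_ofReal hnn, ha.1]
      exact ENNReal.ofReal_lt_top
    · rw [integral_eq_lintegral_of_nonneg_ae hnn hm.aestronglyMeasurable, ha.1,
        ENNReal.toReal_ofReal (sub_nonneg.2 ha.2)]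
  rw [integral_mul_circMean_sub hψ hR h.measurable h.locallyIntegrable ht]
  unfold logSmooth
  have hψm := hψ.measurable
  have hm2 : Measurable fun p : ℂ × ℂ ↦ ψ p.2 * logKernel t (p.1 - p.2) :=
    (hψm.comp measurable_snd).mul ((measurable_logKernel t).comp (by fun_prop))
  -- Integrability for Fubini comes from the same mean identity with `|ψ|` in place of `ψ`, as the
  -- kernel is nonnegative.
  have hprod : Integrable (fun p : ℂ × ℂ ↦ ψ p.2 * logKernel t (p.1 - p.2))
      (X.prod volume) := by
    rw [integrable_prod_iff' hm2.aestronglyMeasurable]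
    refine ⟨?_, ?_⟩
    · filter_upwards [hint] with a ha
      exact ha.1.const_mul _
    · have h3 : Integrable fun a ↦ (∫ ζ, u (a + t * ζ) ∂unitCircleMeasure - u a) * |ψ a| := by
        have h4 := (integral_mean_mul (ψ := fun a ↦ |ψ a|) (R := R) hψ.abs (fun w hw ↦ by simp [hR w hw])
          h.measurable h.locallyIntegrable ht).1
        have h5 : Integrable fun w ↦ u w * |ψ w| :=
          integrable_mul_of_locallyIntegrable (C := C) (R := R) h.locallyIntegrable
            hψm.abs (fun w ↦ by simpa using hC w) (fun w hw ↦ by simp [hR w hw])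
        refine (h4.sub h5).congr (ae_of_all _ fun a ↦ ?_)
        simp only [Pi.sub_apply]
        ring
      refine h3.congr ?_
      filter_upwards [hint] with a ha
      rw [← ha.2, ← integral_mul_const]
      refine integral_congr_ae (ae_of_all _ fun w ↦ ?_)
      simp only [norm_mul, Real.norm_eq_abs, abs_of_nonneg (logKernel_nonneg t (w - a))]
      ring
  rw [integral_integral_swap (f := fun w a ↦ ψ a * logKernel t (w - a)) hprod]
  refine integral_congr_ae ?_
  filter_upwards [hint] with a ha
  rw [integral_const_mul, ha.2, mul_comm]

theorem integral_logKernel_sub (ht : 0 < t) (w : ℂ) :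
    Integrable (fun a ↦ logKernel t (w - a)) ∧
      ∫ a, logKernel t (w - a) = Real.pi * t ^ 2 / 2 :=
  ⟨(integrable_logKernel ht).comp_sub_left w, by
    rw [integral_sub_left_eq_self (logKernel t) volume w, integral_logKernel ht]⟩

theorem measurable_logSmooth (hψ : Measurable ψ) : Measurable (logSmooth t ψ) := by
  have h : Measurable fun p : ℂ × ℂ ↦ ψ p.2 * logKernel t (p.1 - p.2) :=
    (hψ.comp measurable_snd).mul ((measurable_logKernel t).comp (by fun_prop))
  exact (h.stronglyMeasurable.integral_prod_right' (ν := volume)).measurable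

/-- The kernel lives on the disk of radius `t` and has mass `π t²/2`, so divided by this mass it is
an approximate identity. -/
theorem abs_logSmooth_sub_le (hψ : Continuous ψ) (hR : ∀ w, R < ‖w‖ → ψ w = 0) (ht : 0 < t)
    {ω : ℝ} (hω : ∀ x y, ‖x - y‖ ≤ t → |ψ x - ψ y| ≤ ω) (w : ℂ) :
    |logSmooth t ψ w - Real.pi * t ^ 2 / 2 * ψ w| ≤ Real.pi * t ^ 2 / 2 * ω := by
  obtain ⟨C, hC0, hC⟩ := exists_bound_of_support hψ hR
  obtain ⟨h1, h2⟩ := integral_logKernel_sub ht w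
  have h3 : Integrable fun a ↦ ψ a * logKernel t (w - a) :=
    h1.bdd_mul (c := C) hψ.measurable.aestronglyMeasurable (ae_of_all _ hC)
  rw [← h2, logSmooth, ← integral_mul_const, ← integral_mul_const, ← integral_sub h3
    (h1.mul_const _)]
  rw [← Real.norm_eq_abs]
  refine norm_integral_le_of_norm_le (h1.mul_const _) (ae_of_all _ fun a ↦ ?_)
  have h4 : ψ a * logKernel t (w - a) - logKernel t (w - a) * ψ w =
    logKernel t (w - a) * (ψ a - ψ w) := by ring
  rw [h4, norm_mul, Real.norm_of_nonneg (logKernel_nonneg _ _)]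
  by_cases hwa : ‖w - a‖ ≤ t
  · refine mul_le_mul_of_nonneg_left (hω a w ?_) (logKernel_nonneg _ _)
    rwa [norm_sub_rev]
  · rw [logKernel_eq_zero ht.le (not_le.1 hwa).le]
    simp

theorem logSmooth_eq_zero (ht : 0 < t) (hR : ∀ w, R < ‖w‖ → ψ w = 0) {w : ℂ}
    (hw : R + t < ‖w‖) : logSmooth t ψ w = 0 := by
  refine integral_eq_zero_of_ae (ae_of_all _ fun a ↦ ?_)
  by_cases ha : R < ‖a‖
  · simp [hR a ha]
  · simp only [Pi.zero_apply]
    rw [logKernel_eq_zero ht.le, mul_zero]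
    have := norm_sub_norm_le w a
    linarith

/-- A quantitative recovery of `X` from its logarithmic potential. -/
theorem IsLogPotential.abs_integral_sub_le {X : Measure ℂ} (h : IsLogPotential X u)
    (hψ : Continuous ψ) (hR : ∀ w, R < ‖w‖ → ψ w = 0) (ht : 0 < t)
    {ω : ℝ} (hω : ∀ x y, ‖x - y‖ ≤ t → |ψ x - ψ y| ≤ ω) :
    |2 / (Real.pi * t ^ 2) * (∫ w, u w * (circMean t ψ w - ψ w)) - ∫ w, ψ w ∂X| ≤
      ω * X.real (Metric.closedBall 0 (R + t)) := by
  have hX := h.isLocallyFiniteMeasure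
  have hXf : X (Metric.closedBall 0 (R + t)) < ⊤ := (isCompact_closedBall _ _).measure_lt_top
  obtain ⟨C, hC0, hC⟩ := exists_bound_of_support hψ hR
  have hc : 0 < Real.pi * t ^ 2 / 2 := by positivity
  set c := Real.pi * t ^ 2 / 2
  have hω0 : 0 ≤ ω := (abs_nonneg _).trans (hω 0 0 (by simpa using ht.le))
  have hbd := abs_logSmooth_sub_le hψ hR ht hω
  have hfin : IsFiniteMeasure (X.restrict (Metric.closedBall 0 (R + t))) :=
    ⟨by rwa [Measure.restrict_apply_univ]⟩
  have hrestr : ∀ g : ℂ → ℝ, (∀ w, R + t < ‖w‖ → g w = 0) →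
      ∫ w, g w ∂X = ∫ w in Metric.closedBall 0 (R + t), g w ∂X := fun g hg ↦
    (setIntegral_eq_integral_of_forall_compl_eq_zero fun w hw ↦ hg w (by simpa using hw)).symm
  have hi1 : IntegrableOn ψ (Metric.closedBall 0 (R + t)) X :=
    Integrable.of_bound hψ.aestronglyMeasurable C (ae_of_all _ hC)
  have hi2 : IntegrableOn (logSmooth t ψ) (Metric.closedBall 0 (R + t)) X := by
    refine Integrable.of_bound (measurable_logSmooth hψ.measurable).aestronglyMeasurable
      (c * ω + c * C) (ae_of_all _ fun w ↦ ?_)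
    have h1 := abs_add_le (logSmooth t ψ w - c * ψ w) (c * ψ w)
    rw [sub_add_cancel, abs_mul c, abs_of_pos hc] at h1
    refine h1.trans (add_le_add (hbd w) ?_)
    gcongr
    exact hC w
  rw [← h.integral_logSmooth hψ hR ht, show 2 / (Real.pi * t ^ 2) = c⁻¹ by simp [c],
    hrestr _ fun w hw ↦ logSmooth_eq_zero ht hR hw, hrestr ψ fun w hw ↦ hR w (by linarith),
    ← integral_const_mul, ← integral_sub (hi2.const_mul _) hi1, ← Real.norm_eq_abs]
  have h2 := norm_integral_le_of_norm_le_const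
    (μ := X.restrict (Metric.closedBall 0 (R + t)))
    (f := fun w ↦ c⁻¹ * logSmooth t ψ w - ψ w) (C := ω) (ae_of_all _ fun w ↦ ?_)
  · simpa [measureReal_restrict_apply_univ] using h2
  · have h3 : c⁻¹ * logSmooth t ψ w - ψ w = c⁻¹ * (logSmooth t ψ w - c * ψ w) := by
      field_simp
    rw [h3, Real.norm_eq_abs, abs_mul, abs_of_pos (inv_pos.2 hc), inv_mul_le_iff₀ hc]
    exact hbd w

theorem exists_modulus (hψ : Continuous ψ) (hR : ∀ w, R < ‖w‖ → ψ w = 0) {ω : ℝ} (hω : 0 < ω) :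
    ∃ t₀ > 0, ∀ x y, ‖x - y‖ ≤ t₀ → |ψ x - ψ y| ≤ ω := by
  have hc : HasCompactSupport ψ :=
    HasCompactSupport.intro (isCompact_closedBall (0 : ℂ) R) fun w hw ↦ hR w (by simpa using hw)
  obtain ⟨δ, hδ, h⟩ := Metric.uniformContinuous_iff.1
    (hc.uniformContinuous_of_continuous hψ) ω hω
  refine ⟨δ / 2, by positivity, fun x y hxy ↦ ?_⟩
  have h1 := h (a := x) (b := y) (by rw [dist_eq_norm]; linarith)
  rw [Real.dist_eq] at h1
  exact h1.le

/-- Expresses integrals against `X` through `u` alone, and `u` depends measurably on the random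
parameter. -/
theorem IsLogPotential.tendsto_integral {X : Measure ℂ} (h : IsLogPotential X u)
    (hψ : Continuous ψ) (hR : ∀ w, R < ‖w‖ → ψ w = 0) :
    Tendsto (fun t : ℝ ↦ 2 / (Real.pi * t ^ 2) * ∫ w, u w * (circMean t ψ w - ψ w))
      (nhdsWithin 0 (Set.Ioi 0)) (nhds (∫ w, ψ w ∂X)) := by
  have hX := h.isLocallyFiniteMeasure
  have hXf : X (Metric.closedBall 0 (R + 1)) < ⊤ := (isCompact_closedBall _ _).measure_lt_top
  rw [Metric.tendsto_nhds]
  intro ε hε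
  set m := X.real (Metric.closedBall 0 (R + 1)) with hm
  have hm0 : 0 ≤ m := measureReal_nonneg
  obtain ⟨t₀, ht₀, hmod⟩ := exists_modulus hψ hR (ω := ε / (2 * (m + 1))) (by positivity)
  filter_upwards [Ioo_mem_nhdsGT (lt_min ht₀ one_pos)] with t ht
  rw [Real.dist_eq]
  have ht1 : t < t₀ := ht.2.trans_le (min_le_left _ _)
  have ht2 : t < 1 := ht.2.trans_le (min_le_right _ _)
  refine (h.abs_integral_sub_le hψ hR ht.1 fun x y hxy ↦ hmod x y (by linarith)).trans_lt ?_
  have h1 : X.real (Metric.closedBall 0 (R + t)) ≤ m :=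
    measureReal_mono (Metric.closedBall_subset_closedBall (by linarith)) hXf.ne
  calc ε / (2 * (m + 1)) * X.real (Metric.closedBall 0 (R + t)) ≤ ε / (2 * (m + 1)) * (m + 1) := by
        gcongr
        linarith
    _ = ε / 2 := by field_simp
    _ < ε := by linarith

end

/-- The mean value property on circles for the real part of an entire function. -/
theorem integral_re_unitCircle {f : ℂ → ℂ} (hf : Differentiable ℂ f) (a c : ℂ) :
    ∫ ζ, (f (a + c * ζ)).re ∂unitCircleMeasure = (f a).re := by
  have hd : Differentiable ℂ fun ζ : ℂ ↦ f (a + c * ζ) := hf.comp (by fun_prop)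
  have hm : Measurable fun ζ : ℂ ↦ (f (a + c * ζ)).re :=
    (Complex.continuous_re.comp hd.continuous).measurable
  rw [integral_unitCircleMeasure hm]
  have h1 := Complex.reCLM.circleAverage_comp_comm (f := fun ζ : ℂ ↦ f (a + c * ζ)) (c := 0) (R := 1)
    hd.continuous.continuousOn.circleIntegrable'
  have h2 : Real.circleAverage (fun ζ : ℂ ↦ f (a + c * ζ)) 0 1 = f (a + c * 0) :=
    hd.diffContOnCl.circleAverage
  rw [h2] at h1
  simpa [Function.comp_def] using h1

theorem integral_unitCircle_mul_left {f : ℂ → ℝ} (hf : Measurable f) {c : ℂ} (hc : ‖c‖ = 1) :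
    ∫ ζ, f (c * ζ) ∂unitCircleMeasure = ∫ ζ, f ζ ∂unitCircleMeasure := by
  have hm : Measurable fun ζ ↦ f (c * ζ) := hf.comp (by fun_prop)
  rw [integral_unitCircleMeasure hf, integral_unitCircleMeasure hm,
    Real.circleAverage_eq_integral_add (f := f) c.arg, Real.circleAverage_def]
  congr 2
  ext θ
  congr 1
  have h1 := Complex.norm_mul_exp_arg_mul_I c
  rw [hc, Complex.ofReal_one, one_mul] at h1
  rw [circleMap_zero_one, circleMap_zero_one]
  push_cast
  rw [add_mul, Complex.exp_add, h1, mul_comm]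

/-- The cross term is the real part of a linear function and averages to zero. -/
theorem integral_half_norm_sq_unitCircle (a : ℂ) (t : ℝ) :
    ∫ ζ, ‖a + t * ζ‖ ^ 2 / 2 ∂unitCircleMeasure - ‖a‖ ^ 2 / 2 = t ^ 2 / 2 := by
  have h1 : ∫ ζ, ‖a + t * ζ‖ ^ 2 / 2 ∂unitCircleMeasure =
      ∫ ζ, ((‖a‖ ^ 2 + t ^ 2) / 2 + ((0 : ℂ) + (t * (starRingEnd ℂ) a) * ζ).re)
        ∂unitCircleMeasure := by
    refine integral_congr_ae ?_
    filter_upwards [ae_unitCircleMeasure_norm_eq_one] with ζ hζ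
    have h2 : Complex.normSq ζ = 1 := by rw [Complex.normSq_eq_norm_sq, hζ, one_pow]
    rw [← Complex.normSq_eq_norm_sq, ← Complex.normSq_eq_norm_sq, Complex.normSq_add,
      Complex.normSq_mul, h2, Complex.normSq_ofReal]
    simp
    ring
  rw [h1, integral_add (integrable_const _), integral_const, probReal_univ, one_smul,
    integral_re_unitCircle (f := fun z ↦ z) differentiable_id 0]
  · simp
    ring
  · refine integrable_unitCircleMeasure (by fun_prop) ?_
    exact (Continuous.continuousOn (by fun_prop)).circleIntegrable'

section

variable {ψ : ℂ → ℝ} {R t : ℝ}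

/-- Multiplied by `2/(π t²)` this is `π⁻¹ ∫ ψ`, reflecting that `|w|²/2` is a potential of area
measure over `π`. -/
theorem integral_half_norm_sq_mul_circMean_sub (hψ : Continuous ψ)
    (hR : ∀ w, R < ‖w‖ → ψ w = 0) (ht : 0 < t) :
    ∫ w, ‖w‖ ^ 2 / 2 * (circMean t ψ w - ψ w) = t ^ 2 / 2 * ∫ w, ψ w := by
  have hc : Continuous fun w : ℂ ↦ ‖w‖ ^ 2 / 2 := by fun_prop
  rw [integral_mul_circMean_sub hψ hR hc.measurable hc.locallyIntegrable ht,
    ← integral_const_mul]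
  simp_rw [integral_half_norm_sq_unitCircle]

end

/-! ### The deterministic limit theorem -/

section

variable {ι : Type*} {l : Filter ι} {X : ι → Measure ℂ} {u : ι → ℂ → ℝ} {ρ M : ℝ}

/-- Convergence of the integrals of test functions that are harmonic on the disk
`|w| ≤ √e`, when the potentials converge to `|w|² / 2` on the annulus `√e ≤ |w| < ρ`. -/
theorem tendsto_integral_of_mean_eq (hX : ∀ i, IsLogPotential (X i) (u i))
    (hM : ∀ i, (X i).real (Metric.closedBall 0 ρ) ≤ M)
    (hu : Tendsto (fun i ↦ ∫ w in shell (Real.exp 1) (ρ ^ 2), |u i w - ‖w‖ ^ 2 / 2|) l (nhds 0))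
    {ψ : ℂ → ℝ} {R t₀ : ℝ} (hψ : Continuous ψ) (hRρ : R < ρ)
    (hR : ∀ w, R < ‖w‖ → ψ w = 0) (ht₀ : 0 < t₀)
    (hmean : ∀ t, 0 < t → t < t₀ → ∀ w : ℂ, ‖w‖ ^ 2 < Real.exp 1 → circMean t ψ w = ψ w) :
    Tendsto (fun i ↦ ∫ w, ψ w ∂X i) l (nhds (Real.pi⁻¹ * ∫ w, ψ w)) := by
  rw [Metric.tendsto_nhds]
  intro ε hε
  obtain ⟨C, hC0, hC⟩ := exists_bound_of_support hψ hR
  obtain ⟨t₁, ht₁, hmod⟩ := exists_modulus hψ hR (ω := ε / (2 * (|M| + 1))) (by positivity)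
  -- The smoothing scale is fixed before the limit along `l`: the recovery error is already below
  -- `ε/2` uniformly in `i`, by the common mass bound.
  obtain ⟨t, ht, htlt⟩ : ∃ t, 0 < t ∧ t < min (min t₀ t₁) (ρ - R) :=
    exists_between (lt_min (lt_min ht₀ ht₁) (by linarith))
  have ht0 : t < t₀ := htlt.trans_le ((min_le_left _ _).trans (min_le_left _ _))
  have ht1 : t < t₁ := htlt.trans_le ((min_le_left _ _).trans (min_le_right _ _))
  have htR : t < ρ - R := htlt.trans_le (min_le_right _ _)
  have hlim := hu.const_mul (2 / (Real.pi * t ^ 2) * (C + C))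
  rw [mul_zero] at hlim
  filter_upwards [hlim.eventually (gt_mem_nhds (half_pos hε))] with i hi
  have hXi := (hX i).isLocallyFiniteMeasure
  have h1 := (hX i).abs_integral_sub_le hψ hR ht (ω := ε / (2 * (|M| + 1)))
    fun x y hxy ↦ hmod x y (by linarith)
  have h2 : (X i).real (Metric.closedBall 0 (R + t)) ≤ |M| :=
    (measureReal_mono (Metric.closedBall_subset_closedBall (by linarith))
      (isCompact_closedBall _ _).measure_lt_top.ne).trans ((hM i).trans (le_abs_self M))
  have h3 : ε / (2 * (|M| + 1)) * (X i).real (Metric.closedBall 0 (R + t)) ≤ ε / 2 := by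
    calc _ ≤ ε / (2 * (|M| + 1)) * (|M| + 1) := by
          gcongr
          linarith
      _ = ε / 2 := by field_simp
  have hqc : Continuous fun w : ℂ ↦ ‖w‖ ^ 2 / 2 := by fun_prop
  have hi1 := integrable_mul_circMean_sub hψ hR (hX i).locallyIntegrable ht
  have hi2 := integrable_mul_circMean_sub hψ hR hqc.locallyIntegrable ht
  have hid : IntegrableOn (fun w ↦ |u i w - ‖w‖ ^ 2 / 2|) (shell (Real.exp 1) (ρ ^ 2)) := by
    have h4 := ((hX i).locallyIntegrable.sub hqc.locallyIntegrable).integrableOn_isCompact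
      (isCompact_closedBall (0 : ℂ) |ρ|)
    refine IntegrableOn.mono_set h4.abs fun w hw ↦ ?_
    rw [mem_closedBall_zero_iff]
    exact le_of_sq_le_sq (by rw [sq_abs]; exact hw.2.le) (abs_nonneg _)
  have h5 : |(∫ w, u i w * (circMean t ψ w - ψ w)) -
      ∫ w, ‖w‖ ^ 2 / 2 * (circMean t ψ w - ψ w)| ≤
      (C + C) * ∫ w in shell (Real.exp 1) (ρ ^ 2), |u i w - ‖w‖ ^ 2 / 2| := by
    rw [← integral_sub hi1 hi2, ← integral_const_mul,
      ← integral_indicator (measurableSet_shell _ _), ← Real.norm_eq_abs]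
    refine norm_integral_le_of_norm_le
      ((integrable_indicator_iff (measurableSet_shell _ _)).2 (hid.const_mul _))
      (ae_of_all _ fun w ↦ ?_)
    rw [← sub_mul]
    by_cases hw : w ∈ shell (Real.exp 1) (ρ ^ 2)
    · rw [Set.indicator_of_mem hw, norm_mul, mul_comm, Real.norm_eq_abs, Real.norm_eq_abs]
      gcongr
      exact (abs_sub _ _).trans (add_le_add (abs_circMean_le hC w) (hC w))
    -- Where `u` is not controlled the weight vanishes: inside by the mean value property of `ψ`,
    -- outside because of its support.
    · have h6 : circMean t ψ w - ψ w = 0 := by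
        by_cases hw1 : ‖w‖ ^ 2 < Real.exp 1
        · rw [hmean t ht ht0 w hw1, sub_self]
        · have hw2 : ρ ≤ ‖w‖ := by
            by_contra hcon
            exact hw ⟨not_lt.1 hw1, by
              have := not_le.1 hcon
              gcongr⟩
          rw [circMean_eq_zero ht hR (by linarith), hR w (by linarith), sub_zero]
      rw [Set.indicator_of_notMem hw, h6, mul_zero, norm_zero]
  rw [integral_half_norm_sq_mul_circMean_sub hψ hR ht] at h5
  set A := ∫ w, u i w * (circMean t ψ w - ψ w)
  set I := ∫ w, ψ w
  set J := ∫ w, ψ w ∂X i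
  set E := ∫ w in shell (Real.exp 1) (ρ ^ 2), |u i w - ‖w‖ ^ 2 / 2|
  have hc : 0 < 2 / (Real.pi * t ^ 2) := by positivity
  have h7 : |2 / (Real.pi * t ^ 2) * A - Real.pi⁻¹ * I| < ε / 2 := by
    have h8 : 2 / (Real.pi * t ^ 2) * A - Real.pi⁻¹ * I =
        2 / (Real.pi * t ^ 2) * (A - t ^ 2 / 2 * I) := by
      field_simp
    rw [h8, abs_mul, abs_of_pos hc]
    refine (mul_le_mul_of_nonneg_left h5 hc.le).trans_lt ?_
    rwa [← mul_assoc]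
  rw [Real.dist_eq]
  have h9 := abs_sub_le J (2 / (Real.pi * t ^ 2) * A) (Real.pi⁻¹ * I)
  rw [abs_sub_comm J (2 / (Real.pi * t ^ 2) * A)] at h9
  linarith

/-- A radial cutoff: `1` for `|w| ≤ a`, and `0` for `|w| ≥ b`. -/
def radialCutoff (a b : ℝ) (w : ℂ) : ℝ := max 0 (min 1 ((b - ‖w‖) / (b - a)))

theorem continuous_radialCutoff (a b : ℝ) : Continuous (radialCutoff a b) := by
  unfold radialCutoff
  fun_prop

theorem radialCutoff_nonneg (a b : ℝ) (w : ℂ) : 0 ≤ radialCutoff a b w := le_max_left _ _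

theorem radialCutoff_le_one (a b : ℝ) (w : ℂ) : radialCutoff a b w ≤ 1 :=
  max_le zero_le_one (min_le_left _ _)

theorem radialCutoff_eq_one {a b : ℝ} (hab : a < b) {w : ℂ} (hw : ‖w‖ ≤ a) :
    radialCutoff a b w = 1 := by
  rw [radialCutoff, min_eq_left, max_eq_right zero_le_one]
  rw [one_le_div (by linarith)]
  linarith

theorem radialCutoff_eq_zero {a b : ℝ} (hab : a < b) {w : ℂ} (hw : b ≤ ‖w‖) :
    radialCutoff a b w = 0 := by
  refine max_eq_left ((min_le_right _ _).trans ?_)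
  exact div_nonpos_of_nonpos_of_nonneg (by linarith) (by linarith)

/-- The logarithmic moment of `X` inside a disk is controlled by its mass and by the mean of the
potential over an annulus. -/
theorem IsLogPotential.integral_log_norm_le {X : Measure ℂ} {u : ℂ → ℝ} (h : IsLogPotential X u)
    (h0 : X (Metric.ball 0 1) = 0) {a b : ℝ} (ha : 1 ≤ a) (hab : a < b)
    {E : ℝ} (hE : ∫ w in shell (a ^ 2) (b ^ 2), |u w - ‖w‖ ^ 2 / 2| ≤ E) :
    IntegrableOn (fun w ↦ Real.log ‖w‖) (Metric.closedBall 0 b) X ∧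
    ∫ w in Metric.closedBall 0 b, Real.log ‖w‖ ∂X ≤
      Real.log b * X.real (Metric.closedBall 0 b) - a ^ 2 / 2 + u 0 +
        E / (Real.pi * (b ^ 2 - a ^ 2)) := by
  have hX := h.isLocallyFiniteMeasure
  have hb : 1 < b := ha.trans_lt hab
  have hne0 : ∀ᵐ w ∂X, 1 ≤ ‖w‖ := by
    rw [ae_iff]
    simpa [Metric.ball, dist_zero_right] using h0
  have hint : ∀ t : ℝ, 0 < t → Integrable (logKernel t) X ∧
      ∫ w, logKernel t w ∂X = ∫ ζ, u (t * ζ) ∂unitCircleMeasure - u 0 := by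
    intro t ht
    obtain ⟨h1, h2⟩ := h.lintegral_eq_zero t ht
    have hm := (measurable_logKernel t).aestronglyMeasurable (μ := X)
    have hnn := ae_of_all X (logKernel_nonneg t)
    refine ⟨⟨hm, ?_⟩, ?_⟩
    · rw [hasFiniteIntegral_iff_ofReal hnn, h1]
      exact ENNReal.ofReal_lt_top
    · rw [integral_eq_lintegral_of_nonneg_ae hnn hm, h1, ENNReal.toReal_ofReal (sub_nonneg.2 h2)]
  -- Circle means increase with the radius. The mean over the annulus, controlled by `E`, therefore
  -- bounds the mean over the outer circle from below, although nothing is known pointwise on that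
  -- circle.
  have hmono : ∀ t : ℝ, 0 < t → t ≤ b → ∫ ζ, u (t * ζ) ∂unitCircleMeasure ≤
      ∫ w, logKernel b w ∂X + u 0 := by
    intro t ht htb
    rw [← sub_le_iff_le_add, ← (hint t ht).2]
    refine integral_mono (hint t ht).1 (hint b (by linarith)).1 fun w ↦ ?_
    unfold logKernel
    exact Real.posLog_le_posLog (by positivity) (by gcongr)
  have hVpos : 0 < Real.pi * (b ^ 2 - a ^ 2) := by
    have : a ^ 2 < b ^ 2 := by gcongr
    have := Real.pi_pos
    nlinarith
  set V := Real.pi * (b ^ 2 - a ^ 2) with hV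
  set σ : Measure ℂ := ENNReal.ofReal V⁻¹ • volume.restrict (shell (a ^ 2) (b ^ 2)) with hσ
  have hσp : IsProbabilityMeasure σ := by
    refine ⟨?_⟩
    rw [hσ, Measure.smul_apply, Measure.restrict_apply_univ,
      volume_shell (by positivity) (by gcongr), smul_eq_mul, ← ENNReal.ofReal_mul (by positivity),
      inv_mul_cancel₀ hVpos.ne', ENNReal.ofReal_one]
  have hσU : σ ∗ₘ unitCircleMeasure = σ := restrict_shell_mconv _ _ _
  have hsub : shell (a ^ 2) (b ^ 2) ⊆ Metric.closedBall 0 b := fun w hw ↦ by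
    rw [mem_closedBall_zero_iff]
    exact le_of_sq_le_sq hw.2.le (by linarith)
  have huσ : Integrable u σ := by
    refine Integrable.smul_measure ?_ ENNReal.ofReal_ne_top
    exact (h.locallyIntegrable.integrableOn_isCompact (isCompact_closedBall 0 b)).mono_set hsub
  have hqc : Continuous fun w : ℂ ↦ ‖w‖ ^ 2 / 2 := by fun_prop
  have hqσ : Integrable (fun w : ℂ ↦ ‖w‖ ^ 2 / 2) σ := by
    refine Integrable.smul_measure ?_ ENNReal.ofReal_ne_top
    exact (hqc.locallyIntegrable.integrableOn_isCompact (isCompact_closedBall 0 b)).mono_set hsub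
  have hσae : ∀ᵐ w ∂σ, w ∈ shell (a ^ 2) (b ^ 2) :=
    Measure.ae_smul_measure (ae_restrict_mem (measurableSet_shell _ _)) _
  have h1 : ∫ w, u w ∂σ ≤ ∫ w, logKernel b w ∂X + u 0 := by
    have huσ' := huσ
    rw [← hσU] at huσ'
    rw [← hσU, integral_mconv huσ']
    have h2 := ((integrable_mconv_iff huσ'.aestronglyMeasurable).1 huσ')
    refine (integral_mono_ae (g := fun _ ↦ ∫ w, logKernel b w ∂X + u 0) ?_
      (integrable_const _) ?_).trans_eq (by simp)
    · refine h2.2.mono' ?_ (ae_of_all _ fun w ↦ norm_integral_le_integral_norm _)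
      exact ((h.measurable.comp measurable_mul).stronglyMeasurable.integral_prod_right'
        (ν := unitCircleMeasure)).aestronglyMeasurable
    · filter_upwards [hσae] with y hy
      have hy0 : 0 < ‖y‖ := by
        have h3 : a ≤ ‖y‖ := le_of_sq_le_sq hy.1 (norm_nonneg y)
        linarith
      have h3 := integral_unitCircle_mul_left (f := fun ζ ↦ u (‖y‖ * ζ))
        (h.measurable.comp (by fun_prop)) (c := y / ‖y‖) (by
          rw [norm_div, Complex.norm_real, norm_norm, div_self hy0.ne'])
      have h4 : ∀ ζ : ℂ, (‖y‖ : ℂ) * (y / ‖y‖ * ζ) = y * ζ := by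
        intro ζ
        have : (‖y‖ : ℂ) ≠ 0 := by exact_mod_cast hy0.ne'
        field_simp
      simp only [h4] at h3
      rw [h3]
      exact hmono _ hy0 (le_of_sq_le_sq hy.2.le (by linarith))
  have h5 : a ^ 2 / 2 - E / V ≤ ∫ w, u w ∂σ := by
    have h6 : a ^ 2 / 2 ≤ ∫ w, ‖w‖ ^ 2 / 2 ∂σ := by
      have h7 := integral_mono_ae (μ := σ) (f := fun _ ↦ a ^ 2 / 2) (integrable_const _) hqσ (by
        filter_upwards [hσae] with w hw
        have := hw.1
        linarith)
      simpa using h7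
    have h8 : |(∫ w, u w ∂σ) - ∫ w, ‖w‖ ^ 2 / 2 ∂σ| ≤ E / V := by
      rw [← integral_sub huσ hqσ]
      refine abs_integral_le_integral_abs.trans ?_
      rw [hσ, integral_smul_measure, ENNReal.toReal_ofReal (by positivity), smul_eq_mul,
        div_eq_inv_mul]
      gcongr
    have := (abs_le.1 h8).1
    linarith
  have hK : (fun w ↦ logKernel b w) =ᵐ[X]
      (Metric.closedBall 0 b).indicator fun w ↦ Real.log b - Real.log ‖w‖ := by
    filter_upwards [hne0] with w hw
    by_cases hwb : ‖w‖ ≤ b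
    · rw [Set.indicator_of_mem (by simpa using hwb), logKernel_eq_log (norm_pos_iff.1 (by linarith)) hwb]
    · rw [Set.indicator_of_notMem (by simpa using hwb),
        logKernel_eq_zero (by linarith) (not_le.1 hwb).le]
  have hconst : IntegrableOn (fun _ : ℂ ↦ Real.log b) (Metric.closedBall 0 b) X :=
    integrableOn_const (isCompact_closedBall _ _).measure_lt_top.ne
  have hi : IntegrableOn (fun w : ℂ ↦ Real.log b - Real.log ‖w‖) (Metric.closedBall 0 b) X :=
    (integrable_indicator_iff measurableSet_closedBall).1
      ((hint b (by linarith)).1.congr hK)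
  have hlog : IntegrableOn (fun w : ℂ ↦ Real.log ‖w‖) (Metric.closedBall 0 b) X :=
    (hconst.sub hi).congr (ae_of_all _ fun w ↦ by simp)
  refine ⟨hlog, ?_⟩
  have h9 : ∫ w, logKernel b w ∂X = Real.log b * X.real (Metric.closedBall 0 b) -
      ∫ w in Metric.closedBall 0 b, Real.log ‖w‖ ∂X := by
    rw [integral_congr_ae hK, integral_indicator measurableSet_closedBall,
      integral_sub hconst hlog, setIntegral_const, smul_eq_mul, mul_comm]
  linarith

end

/-- On the circle a negative power is the conjugate of a positive one, so a trigonometric polynomial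
splits as entire plus conjugate of entire. -/
theorem exists_entire_of_mem_span_fourier {g : C(UnitAddCircle, ℂ)}
    (hg : g ∈ Submodule.span ℂ (Set.range (@fourier (1 : ℝ)))) :
    ∃ p q : ℂ → ℂ, Differentiable ℂ p ∧ Differentiable ℂ q ∧
      ∀ x, g x = p (AddCircle.toCircle x) + (starRingEnd ℂ) (q (AddCircle.toCircle x)) := by
  induction hg using Submodule.span_induction with
  | mem g hg =>
    obtain ⟨n, rfl⟩ := hg
    have hn : ∀ x : UnitAddCircle, fourier n x = (AddCircle.toCircle x : ℂ) ^ n := by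
      intro x
      rw [fourier_apply, AddCircle.toCircle_zsmul, Circle.coe_zpow]
    rcases n with n | n
    · refine ⟨fun z ↦ z ^ n, 0, by fun_prop, differentiable_const 0, fun x ↦ ?_⟩
      rw [hn]
      simp
    · refine ⟨0, fun z ↦ z ^ (n + 1), differentiable_const 0, by fun_prop, fun x ↦ ?_⟩
      rw [hn, zpow_negSucc, ← inv_pow, ← Circle.coe_inv, Circle.coe_inv_eq_conj, map_pow]
      simp
  | zero => exact ⟨0, 0, differentiable_const 0, differentiable_const 0, fun x ↦ by simp⟩
  | add g₁ g₂ _ _ h₁ h₂ =>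
    obtain ⟨p₁, q₁, hp₁, hq₁, e₁⟩ := h₁
    obtain ⟨p₂, q₂, hp₂, hq₂, e₂⟩ := h₂
    refine ⟨p₁ + p₂, q₁ + q₂, hp₁.add hp₂, hq₁.add hq₂, fun x ↦ ?_⟩
    rw [ContinuousMap.add_apply, e₁, e₂, Pi.add_apply, Pi.add_apply, map_add]
    ring
  | smul c g _ h =>
    obtain ⟨p, q, hp, hq, e⟩ := h
    refine ⟨fun z ↦ c * p z, fun z ↦ (starRingEnd ℂ) c * q z, hp.const_mul c, hq.const_mul _,
      fun x ↦ ?_⟩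
    rw [ContinuousMap.smul_apply, e, smul_eq_mul, map_mul, Complex.conj_conj, mul_add]

/-- On the unit circle, continuous functions are uniform limits of real parts of entire
functions. -/
theorem exists_entire_re_approx {φ : ℂ → ℝ} (hφ : Continuous φ) {κ : ℝ} (hκ : 0 < κ) :
    ∃ f : ℂ → ℂ, Differentiable ℂ f ∧ ∀ ζ : ℂ, ‖ζ‖ = 1 → |φ ζ - (f ζ).re| ≤ κ := by
  let g : C(UnitAddCircle, ℂ) := ⟨fun x ↦ (φ (AddCircle.toCircle x) : ℂ),
    Complex.continuous_ofReal.comp (hφ.comp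
      (continuous_subtype_val.comp AddCircle.continuous_toCircle))⟩
  have hg : g ∈ closure (Submodule.span ℂ (Set.range (@fourier (1 : ℝ))) : Set C(UnitAddCircle, ℂ)) := by
    rw [← Submodule.topologicalClosure_coe, span_fourier_closure_eq_top]
    trivial
  obtain ⟨h, hh, hgh⟩ := Metric.mem_closure_iff.1 hg κ hκ
  obtain ⟨p, q, hp, hq, e⟩ := exists_entire_of_mem_span_fourier hh
  -- The approximated function is real, and `Re (p + conj q) = Re (p + q)`.
  refine ⟨fun z ↦ p z + q z, hp.add hq, fun ζ hζ ↦ ?_⟩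
  obtain ⟨x, hx⟩ := (AddCircle.homeomorphCircle (T := 1) one_ne_zero).surjective
    ⟨ζ, mem_sphere_zero_iff_norm.2 hζ⟩
  rw [AddCircle.homeomorphCircle_apply] at hx
  have hx' : ((AddCircle.toCircle x : Circle) : ℂ) = ζ := by rw [hx]
  have h1 : ‖(g - h) x‖ ≤ κ := by
    refine ((g - h).norm_coe_le_norm x).trans ?_
    rw [← dist_eq_norm]
    exact hgh.le
  have h2 : (g - h) x = (φ ζ : ℂ) - (p ζ + (starRingEnd ℂ) (q ζ)) := by
    rw [ContinuousMap.sub_apply, e, hx']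
    simp [g, hx']
  rw [h2] at h1
  refine le_trans (le_of_eq ?_) ((Complex.abs_re_le_norm _).trans h1)
  simp

/-- The set where `|h| ≥ 2κ` is compact and misses the unit circle, so `log ‖w‖` has a positive
minimum on it. The logarithmic moment thus controls the error away from the circle. -/
theorem exists_le_add_mul_log {h : ℂ → ℝ} (hh : Continuous h) {κ : ℝ} (hκ : 0 < κ)
    (h1 : ∀ ζ : ℂ, ‖ζ‖ = 1 → |h ζ| ≤ κ) :
    ∃ C, 0 ≤ C ∧ ∀ w : ℂ, 1 ≤ ‖w‖ → ‖w‖ ≤ 2 → |h w| ≤ 2 * κ + C * Real.log ‖w‖ := by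
  set S : Set ℂ := Metric.closedBall 0 2 ∩ ({w | 1 ≤ ‖w‖} ∩ {w | 2 * κ ≤ |h w|}) with hS
  have hSc : IsCompact S := (isCompact_closedBall 0 2).inter_right
    ((isClosed_le continuous_const continuous_norm).inter (isClosed_le continuous_const hh.abs))
  obtain ⟨D, hD⟩ := (isCompact_closedBall (0 : ℂ) 2).exists_bound_of_continuousOn hh.continuousOn
  rcases S.eq_empty_or_nonempty with hE | hne
  · refine ⟨0, le_rfl, fun w hw1 hw2 ↦ ?_⟩
    by_contra hcon
    have : w ∈ S := ⟨by simpa using hw2, hw1, by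
      have := not_le.1 hcon
      simp only [zero_mul, add_zero] at this
      exact this.le⟩
    rw [hE] at this
    exact this
  · have hlogc : ContinuousOn (fun w : ℂ ↦ Real.log ‖w‖) S := by
      refine ContinuousOn.log continuous_norm.continuousOn fun w hw ↦ ?_
      have : 1 ≤ ‖w‖ := hw.2.1
      positivity
    obtain ⟨w₀, hw₀, hmin⟩ := hSc.exists_isMinOn hne hlogc
    have hm : 0 < Real.log ‖w₀‖ := by
      refine Real.log_pos (lt_of_le_of_ne hw₀.2.1 fun heq ↦ ?_)
      have h3 := h1 w₀ heq.symm
      have h4 : 2 * κ ≤ |h w₀| := hw₀.2.2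
      linarith
    have hD0 : 0 ≤ D := (norm_nonneg _).trans (hD w₀ hw₀.1)
    refine ⟨D / Real.log ‖w₀‖, by positivity, fun w hw1 hw2 ↦ ?_⟩
    have hlog : 0 ≤ Real.log ‖w‖ := Real.log_nonneg hw1
    by_cases hw : 2 * κ ≤ |h w|
    · have h5 : w ∈ S := ⟨by simpa using hw2, hw1, hw⟩
      have h6 : Real.log ‖w₀‖ ≤ Real.log ‖w‖ := hmin h5
      have h7 : D ≤ D / Real.log ‖w₀‖ * Real.log ‖w‖ := by
        rw [div_mul_eq_mul_div, le_div_iff₀ hm]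
        gcongr
      have h8 : |h w| ≤ D := hD w h5.1
      linarith
    · have : 0 ≤ D / Real.log ‖w₀‖ * Real.log ‖w‖ := by positivity
      linarith

theorem setIntegral_shell_re {f : ℂ → ℂ} (hf : Differentiable ℂ f) {b : ℝ} (hb : 0 < b) :
    ∫ w in shell 0 b, (f w).re = Real.pi * b * (f 0).re := by
  have hV : 0 < Real.pi * (b - 0) := by
    rw [sub_zero]
    positivity
  set σ : Measure ℂ := ENNReal.ofReal (Real.pi * (b - 0))⁻¹ • volume.restrict (shell 0 b) with hσ
  have hσp : IsProbabilityMeasure σ := by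
    refine ⟨?_⟩
    rw [hσ, Measure.smul_apply, Measure.restrict_apply_univ, volume_shell le_rfl hb.le,
      smul_eq_mul, ← ENNReal.ofReal_mul (by positivity), inv_mul_cancel₀ hV.ne', ENNReal.ofReal_one]
  have hσU : σ ∗ₘ unitCircleMeasure = σ := restrict_shell_mconv _ _ _
  have hc : Continuous fun w ↦ (f w).re := Complex.continuous_re.comp hf.continuous
  have hi : Integrable (fun w ↦ (f w).re) σ := by
    refine Integrable.smul_measure ?_ ENNReal.ofReal_ne_top
    refine (hc.locallyIntegrable.integrableOn_isCompact
      (isCompact_closedBall 0 (Real.sqrt b))).mono_set fun w hw ↦ ?_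
    rw [mem_closedBall_zero_iff]
    exact Real.le_sqrt_of_sq_le hw.2.le
  have h1 : ∫ w, (f w).re ∂σ = (f 0).re := by
    have hi' := hi
    rw [← hσU] at hi'
    rw [← hσU, integral_mconv hi']
    have h2 : ∀ y : ℂ, ∫ ζ, (f (y * ζ)).re ∂unitCircleMeasure = (f 0).re := by
      intro y
      simpa using integral_re_unitCircle hf 0 y
    simp [h2]
  rw [hσ, integral_smul_measure, ENNReal.toReal_ofReal (by positivity), smul_eq_mul,
    inv_mul_eq_iff_eq_mul₀ hV.ne', sub_zero] at h1
  exact h1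

theorem integral_holeLimitMeasure {φ : ℂ → ℝ} (hφ : Continuous φ) {R : ℝ}
    (hR : ∀ w, R < ‖w‖ → φ w = 0) :
    ∫ w, φ w ∂holeLimitMeasure.toMeasure = Real.exp 1 * ∫ ζ, φ ζ ∂unitCircleMeasure +
      Real.pi⁻¹ * ∫ w in (shell 0 (Real.exp 1))ᶜ, φ w := by
  obtain ⟨C, -, hC⟩ := exists_bound_of_support hφ hR
  have hset : {z : ℂ | Real.sqrt (Real.exp 1) ≤ ‖z‖} = (shell 0 (Real.exp 1))ᶜ := by
    ext w
    simp [shell, Real.sqrt_le_left]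
  have hi1 : Integrable φ unitCircleMeasure :=
    Integrable.of_bound hφ.aestronglyMeasurable C (ae_of_all _ hC)
  have hi2 : Integrable φ := by
    refine hφ.integrable_of_hasCompactSupport ?_
    exact HasCompactSupport.intro (isCompact_closedBall (0 : ℂ) R) fun w hw ↦
      hR w (by simpa using hw)
  rw [holeLimitMeasure]
  simp only
  rw [integral_add_measure (hi1.smul_measure ENNReal.ofReal_ne_top)
    (hi2.restrict.smul_measure ENNReal.ofReal_ne_top), integral_smul_measure,
    integral_smul_measure, hset, ENNReal.toReal_ofReal (Real.exp_pos 1).le,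
    ENNReal.toReal_ofReal (by positivity), smul_eq_mul, smul_eq_mul, one_div]

/-- With all three radii equal to `√e` both expressions vanish, as `e · log √e = e/2`; continuity
leaves room to separate the radii. -/
theorem exists_radii {C D κ : ℝ} (hκ : 0 < κ) :
    ∃ b₁ b₂ b₃ : ℝ, Real.sqrt (Real.exp 1) < b₁ ∧ b₁ < b₂ ∧ b₂ < b₃ ∧ b₃ < 2 ∧
      C * (b₃ ^ 2 * Real.log b₂ - b₁ ^ 2 / 2) < κ ∧ D * (b₂ ^ 2 - Real.exp 1) < κ := by
  set s := Real.sqrt (Real.exp 1) with hs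
  have hs0 : 0 < s := Real.sqrt_pos.2 (Real.exp_pos 1)
  have hs2 : s ^ 2 = Real.exp 1 := Real.sq_sqrt (Real.exp_pos 1).le
  have hlog : Real.log s = 1 / 2 := by
    rw [hs, Real.log_sqrt (Real.exp_pos 1).le, Real.log_exp]
  have hslt : s < 2 := by
    have := Real.exp_one_lt_three
    nlinarith
  have h1 : ContinuousAt (fun x : ℝ ↦ s + 3 * x) 0 := by fun_prop
  have h2 : ContinuousAt (fun x : ℝ ↦ C * ((s + 3 * x) ^ 2 * Real.log (s + 2 * x) -
      (s + x) ^ 2 / 2)) 0 := by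
    have : ContinuousAt (fun x : ℝ ↦ Real.log (s + 2 * x)) 0 :=
      ContinuousAt.log (by fun_prop) (by simpa using hs0.ne')
    fun_prop
  have h3 : ContinuousAt (fun x : ℝ ↦ D * ((s + 2 * x) ^ 2 - Real.exp 1)) 0 := by fun_prop
  have e1 := h1.eventually_lt (g := fun _ ↦ 2) continuousAt_const (by simpa using hslt)
  have e2 := h2.eventually_lt (g := fun _ ↦ κ) continuousAt_const (by
    simp only [mul_zero, add_zero, hlog]
    ring_nf
    exact hκ)
  have e3 := h3.eventually_lt (g := fun _ ↦ κ) continuousAt_const (by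
    simp only [mul_zero, add_zero, hs2, sub_self]
    exact hκ)
  have e4 := ((e1.and (e2.and e3)).filter_mono (nhdsWithin_le_nhds (s := Set.Ioi 0))).and
    self_mem_nhdsWithin
  obtain ⟨x, ⟨hx1, hx2, hx3⟩, hx⟩ := e4.exists
  have hx : 0 < x := hx
  exact ⟨s + x, s + 2 * x, s + 3 * x, by linarith, by linarith, by linarith, hx1, hx2, hx3⟩

section

variable {ι : Type*} {l : Filter ι} {X : ι → Measure ℂ} {u : ι → ℂ → ℝ} {ρ M : ℝ}

/-- A cutoff constant near `|w| ≤ √e` satisfies the mean value condition there, so the mass of the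
disk is at most about the normalised area `b₃²`. Inserting this mass in `integral_log_norm_le`
bounds the logarithmic moment. -/
theorem eventually_mass_and_log_moment_le (hX : ∀ i, IsLogPotential (X i) (u i))
    (h0 : ∀ i, X i (Metric.ball 0 1) = 0)
    (hM : ∀ i, (X i).real (Metric.closedBall 0 ρ) ≤ M)
    (hu0 : Tendsto (fun i ↦ u i 0) l (nhds 0))
    (hu : Tendsto (fun i ↦ ∫ w in shell (Real.exp 1) (ρ ^ 2), |u i w - ‖w‖ ^ 2 / 2|) l (nhds 0))
    {b₁ b₂ b₃ τ : ℝ} (hb₁ : Real.sqrt (Real.exp 1) < b₁) (hb₂ : b₁ < b₂) (hb₃ : b₂ < b₃)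
    (hρ : b₃ < ρ) (hτ : 0 < τ) :
    ∀ᶠ i in l, (X i).real (Metric.closedBall 0 b₂) ≤ b₃ ^ 2 + τ ∧
      IntegrableOn (fun w ↦ Real.log ‖w‖) (Metric.closedBall 0 b₂) (X i) ∧
      ∫ w in Metric.closedBall 0 b₂, Real.log ‖w‖ ∂X i ≤
        b₃ ^ 2 * Real.log b₂ - b₁ ^ 2 / 2 + τ := by
  have hs1 : 1 ≤ Real.sqrt (Real.exp 1) :=
    Real.one_le_sqrt.2 (Real.one_le_exp zero_le_one)
  have hb₁1 : 1 ≤ b₁ := by linarith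
  set χ := radialCutoff b₂ b₃ with hχ
  have hχc := continuous_radialCutoff b₂ b₃
  have hχ0 : ∀ w, b₃ < ‖w‖ → χ w = 0 := fun w hw ↦ radialCutoff_eq_zero hb₃ hw.le
  have hsq : ∀ w : ℂ, ‖w‖ ^ 2 < Real.exp 1 → ‖w‖ < b₁ := by
    intro w hw
    exact (Real.lt_sqrt_of_sq_lt hw).trans hb₁
  have hlim := tendsto_integral_of_mean_eq hX hM hu hχc hρ hχ0
    (t₀ := b₂ - b₁) (by linarith) (by
      intro t ht htlt w hw
      have hw1 := hsq w hw
      have h1 : ∫ ζ, χ (w - t * ζ) ∂unitCircleMeasure = ∫ _, (1 : ℝ) ∂unitCircleMeasure := by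
        refine integral_congr_ae ?_
        filter_upwards [ae_unitCircleMeasure_norm_eq_one] with ζ hζ
        refine radialCutoff_eq_one hb₃ ?_
        have h2 := norm_sub_le w (t * ζ)
        rw [norm_mul, hζ, mul_one, Complex.norm_real, Real.norm_of_nonneg ht.le] at h2
        linarith
      rw [circMean, h1, integral_const, probReal_univ, one_smul]
      exact (radialCutoff_eq_one hb₃ (by linarith)).symm)
  have hχint : Real.pi⁻¹ * ∫ w, χ w ≤ b₃ ^ 2 := by
    have h1 : ∫ w, χ w ≤ ∫ w, (Metric.closedBall (0 : ℂ) b₃).indicator (fun _ ↦ (1 : ℝ)) w := by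
      refine integral_mono_of_nonneg (ae_of_all _ fun w ↦ radialCutoff_nonneg _ _ w) ?_
        (ae_of_all _ fun w ↦ ?_)
      · exact (integrable_indicator_iff measurableSet_closedBall).2
          (integrableOn_const (isCompact_closedBall _ _).measure_lt_top.ne)
      · by_cases hw : ‖w‖ ≤ b₃
        · rw [Set.indicator_of_mem (by simpa using hw)]
          exact radialCutoff_le_one _ _ w
        · rw [Set.indicator_of_notMem (by simpa using hw), hχ0 w (not_le.1 hw)]
    rw [integral_indicator measurableSet_closedBall, setIntegral_const, smul_eq_mul, mul_one,
      measureReal_def, Complex.volume_closedBall, ← ENNReal.ofReal_pow (by linarith),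
      ENNReal.toReal_mul, ENNReal.toReal_ofReal (by positivity)] at h1
    rw [inv_mul_le_iff₀ Real.pi_pos, mul_comm]
    simpa using h1
  set V := Real.pi * (b₂ ^ 2 - b₁ ^ 2) with hV
  have hlim2 := (hu0.add (hu.div_const V))
  rw [zero_div, add_zero] at hlim2
  have hlog2 : 0 ≤ Real.log b₂ := Real.log_nonneg (by linarith)
  set τ' := min τ (τ / (2 * (Real.log b₂ + 1))) with hτ'
  have hτ'0 : 0 < τ' := lt_min hτ (by positivity)
  filter_upwards [hlim.eventually (gt_mem_nhds (show Real.pi⁻¹ * ∫ w, χ w < b₃ ^ 2 + τ' by linarith)),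
    hlim2.eventually (gt_mem_nhds (half_pos hτ))] with i h1 h2
  have hXi := (hX i).isLocallyFiniteMeasure
  have hmass : (X i).real (Metric.closedBall 0 b₂) ≤ b₃ ^ 2 + τ' := by
    refine le_trans ?_ h1.le
    have hχi : Integrable χ (X i) := hχc.integrable_of_hasCompactSupport
      (HasCompactSupport.intro (isCompact_closedBall (0 : ℂ) b₃) fun w hw ↦
        hχ0 w (by simpa using hw))
    have h3 : (X i).real (Metric.closedBall 0 b₂) =
        ∫ w, (Metric.closedBall (0 : ℂ) b₂).indicator (fun _ ↦ (1 : ℝ)) w ∂X i := by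
      rw [integral_indicator measurableSet_closedBall, setIntegral_const, smul_eq_mul, mul_one]
    rw [h3]
    refine integral_mono_of_nonneg
      (ae_of_all _ fun w ↦ Set.indicator_nonneg (fun _ _ ↦ zero_le_one) w) hχi
      (ae_of_all _ fun w ↦ ?_)
    by_cases hw : ‖w‖ ≤ b₂
    · rw [Set.indicator_of_mem (by simpa using hw), radialCutoff_eq_one hb₃ hw]
    · rw [Set.indicator_of_notMem (by simpa using hw)]
      exact radialCutoff_nonneg _ _ w
  have hE : ∫ w in shell (b₁ ^ 2) (b₂ ^ 2), |u i w - ‖w‖ ^ 2 / 2| ≤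
      ∫ w in shell (Real.exp 1) (ρ ^ 2), |u i w - ‖w‖ ^ 2 / 2| := by
    refine setIntegral_mono_set ?_ (ae_of_all _ fun w ↦ abs_nonneg _) (ae_of_all _ ?_)
    · have hqc : Continuous fun w : ℂ ↦ ‖w‖ ^ 2 / 2 := by fun_prop
      have h4 := ((hX i).locallyIntegrable.sub hqc.locallyIntegrable).integrableOn_isCompact
        (isCompact_closedBall (0 : ℂ) ρ)
      refine IntegrableOn.mono_set h4.abs fun w hw ↦ ?_
      rw [mem_closedBall_zero_iff]
      exact le_of_sq_le_sq hw.2.le (by linarith)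
    · intro w hw
      refine ⟨?_, hw.2.trans_le ?_⟩
      · refine le_trans ?_ hw.1
        exact ((Real.sqrt_lt' (by linarith)).1 hb₁).le
      · exact pow_le_pow_left₀ (by linarith) (by linarith) 2
  obtain ⟨h5, h6⟩ := (hX i).integral_log_norm_le (h0 i) hb₁1 hb₂ hE
  refine ⟨hmass.trans (by
    have := min_le_left τ (τ / (2 * (Real.log b₂ + 1)))
    linarith), h5, h6.trans ?_⟩
  have h7 : Real.log b₂ * (X i).real (Metric.closedBall 0 b₂) ≤
      Real.log b₂ * b₃ ^ 2 + τ / 2 := by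
    calc _ ≤ Real.log b₂ * (b₃ ^ 2 + τ') := by gcongr
      _ = Real.log b₂ * b₃ ^ 2 + Real.log b₂ * τ' := by ring
      _ ≤ Real.log b₂ * b₃ ^ 2 + (Real.log b₂ + 1) * (τ / (2 * (Real.log b₂ + 1))) := by
          gcongr
          · linarith
          · exact min_le_right _ _
      _ = _ := by
          field_simp
  linarith

/-- The deterministic core: measures without mass in the unit disk, whose logarithmic potentials
vanish asymptotically at the origin and converge to `|w|² / 2` on the annulus `√e ≤ |w| < ρ`,
converge vaguely to `holeLimitMeasure` on the disk of radius `ρ`. -/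
theorem tendsto_integral_holeLimitMeasure (hX : ∀ i, IsLogPotential (X i) (u i))
    (h0 : ∀ i, X i (Metric.ball 0 1) = 0)
    (hM : ∀ i, (X i).real (Metric.closedBall 0 ρ) ≤ M)
    (hu0 : Tendsto (fun i ↦ u i 0) l (nhds 0))
    (hu : Tendsto (fun i ↦ ∫ w in shell (Real.exp 1) (ρ ^ 2), |u i w - ‖w‖ ^ 2 / 2|) l (nhds 0))
    (hρ : 2 ≤ ρ) {φ : ℂ → ℝ} (hφ : Continuous φ) {R : ℝ} (hRρ : R < ρ)
    (hR : ∀ w, R < ‖w‖ → φ w = 0) :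
    Tendsto (fun i ↦ ∫ w, φ w ∂X i) l (nhds (∫ w, φ w ∂holeLimitMeasure.toMeasure)) := by
  rw [Metric.tendsto_nhds]
  intro ε hε
  set κ := min (ε / 20) 1 with hκ
  have hκ0 : 0 < κ := lt_min (by positivity) one_pos
  have hκ1 : κ ≤ 1 := min_le_right _ _
  have hκε : 20 * κ ≤ ε := by
    have := min_le_left (ε / 20) 1
    linarith
  obtain ⟨f, hf, hfφ⟩ := exists_entire_re_approx hφ hκ0
  have hpc : Continuous fun w ↦ (f w).re := Complex.continuous_re.comp hf.continuous
  have hdc : Continuous fun w ↦ φ w - (f w).re := hφ.sub hpc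
  obtain ⟨C, hC0, hC⟩ := exists_le_add_mul_log hdc hκ0 hfφ
  obtain ⟨D, hD⟩ := (isCompact_closedBall (0 : ℂ) 2).exists_bound_of_continuousOn hdc.continuousOn
  have hD0 : 0 ≤ D := (norm_nonneg _).trans (hD 0 (by simp))
  obtain ⟨b₁, b₂, b₃, hb₁, hb₂, hb₃, hb₃2, hCb, hDb⟩ := exists_radii (C := C) (D := D) hκ0
  have he : Real.exp 1 < 3 := Real.exp_one_lt_three
  have hs1 : 1 ≤ Real.sqrt (Real.exp 1) :=
    Real.one_le_sqrt.2 (Real.one_le_exp zero_le_one)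
  have hsq : ∀ w : ℂ, ‖w‖ ^ 2 < Real.exp 1 → ‖w‖ < b₁ := by
    intro w hw
    exact (Real.lt_sqrt_of_sq_lt hw).trans hb₁
  set χ := radialCutoff b₁ b₂ with hχ
  have hχc : Continuous χ := continuous_radialCutoff b₁ b₂
  have hχ0 : ∀ w, b₂ ≤ ‖w‖ → χ w = 0 := fun w hw ↦ radialCutoff_eq_zero hb₂ hw
  have hχ1 : ∀ w, ‖w‖ ≤ b₁ → χ w = 1 := fun w hw ↦ radialCutoff_eq_one hb₂ hw
  -- Harmonic on `|w| ≤ b₁`, where it equals `Re f`, and equal to `φ` beyond `b₂`.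
  set ψ : ℂ → ℝ := fun w ↦ φ w - χ w * (φ w - (f w).re) with hψ
  have hψc : Continuous ψ := hφ.sub (hχc.mul hdc)
  set R' := max R b₂ with hR'
  have hR'ρ : R' < ρ := max_lt hRρ (by linarith)
  have hφ0 : ∀ w, R' < ‖w‖ → φ w = 0 := fun w hw ↦ hR w ((le_max_left _ _).trans_lt hw)
  have hψ0 : ∀ w, R' < ‖w‖ → ψ w = 0 := by
    intro w hw
    simp only [hψ]
    rw [hφ0 w hw, hχ0 w ((le_max_right R b₂).trans hw.le)]
    simp
  have hψp : ∀ w, ‖w‖ ≤ b₁ → ψ w = (f w).re := by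
    intro w hw
    simp only [hψ]
    rw [hχ1 w hw]
    ring
  have hcs : ∀ g : ℂ → ℝ, (∀ w, R' < ‖w‖ → g w = 0) → HasCompactSupport g := fun g hg ↦
    HasCompactSupport.intro (isCompact_closedBall (0 : ℂ) R') fun w hw ↦ hg w (by simpa using hw)
  have hlim := tendsto_integral_of_mean_eq hX hM hu hψc hR'ρ hψ0
    (t₀ := b₁ - Real.sqrt (Real.exp 1)) (by linarith) (by
      intro t ht htlt w hw
      have hws : ‖w‖ < Real.sqrt (Real.exp 1) := Real.lt_sqrt_of_sq_lt hw
      have h1 : ∫ ζ, ψ (w - t * ζ) ∂unitCircleMeasure =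
          ∫ ζ, (f (w + (-t : ℂ) * ζ)).re ∂unitCircleMeasure := by
        refine integral_congr_ae ?_
        filter_upwards [ae_unitCircleMeasure_norm_eq_one] with ζ hζ
        have h2 := norm_sub_le w (t * ζ)
        rw [norm_mul, hζ, mul_one, Complex.norm_real, Real.norm_of_nonneg ht.le] at h2
        rw [hψp _ (by linarith), neg_mul, sub_eq_add_neg]
      rw [circMean, h1, integral_re_unitCircle hf, hψp w (by linarith)])
  -- The mean value property turns the integral over `|w|² < e` into `π e Re f(0)`. The errors are
  -- `e κ ≤ 3κ` on the circle and `κ` from the thin annulus up to `b₂`.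
  have hlimit : |Real.pi⁻¹ * (∫ w, ψ w) - ∫ w, φ w ∂holeLimitMeasure.toMeasure| ≤ 4 * κ := by
    have hφi : Integrable φ := hφ.integrable_of_hasCompactSupport (hcs φ hφ0)
    have hψi : Integrable ψ := hψc.integrable_of_hasCompactSupport (hcs ψ hψ0)
    have hSm := measurableSet_shell 0 (Real.exp 1)
    have h1 : ∫ w in shell 0 (Real.exp 1), ψ w = Real.pi * Real.exp 1 * (f 0).re := by
      rw [← setIntegral_shell_re hf (Real.exp_pos 1)]
      exact setIntegral_congr_fun hSm fun w hw ↦ hψp w (hsq w hw.2).le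
    have h2 : |(∫ w in (shell 0 (Real.exp 1))ᶜ, ψ w) - ∫ w in (shell 0 (Real.exp 1))ᶜ, φ w| ≤
        D * (Real.pi * (b₂ ^ 2 - Real.exp 1)) := by
      have hb₂e : Real.exp 1 ≤ b₂ ^ 2 := ((Real.sqrt_lt' (by linarith)).1 (hb₁.trans hb₂)).le
      have hvol : volume.real (shell (Real.exp 1) (b₂ ^ 2)) = Real.pi * (b₂ ^ 2 - Real.exp 1) := by
        rw [measureReal_def, volume_shell (Real.exp_pos 1).le hb₂e, ENNReal.toReal_ofReal]
        exact mul_nonneg Real.pi_pos.le (by linarith)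
      have hvfin : volume (shell (Real.exp 1) (b₂ ^ 2)) ≠ ⊤ := by
        rw [volume_shell (Real.exp_pos 1).le hb₂e]
        exact ENNReal.ofReal_ne_top
      rw [← integral_sub hψi.integrableOn hφi.integrableOn, ← Real.norm_eq_abs,
        ← integral_indicator hSm.compl]
      refine (norm_integral_le_of_norm_le (g := (shell (Real.exp 1) (b₂ ^ 2)).indicator fun _ ↦ D)
        ?_ (ae_of_all _ fun w ↦ ?_)).trans_eq ?_
      · exact (integrable_indicator_iff (measurableSet_shell _ _)).2 (integrableOn_const hvfin)
      · by_cases hw1 : w ∈ (shell 0 (Real.exp 1))ᶜ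
        · rw [Set.indicator_of_mem hw1]
          have hw1' : Real.exp 1 ≤ ‖w‖ ^ 2 := by
            by_contra hcon
            exact hw1 ⟨by positivity, not_le.1 hcon⟩
          have h3 : ψ w - φ w = -(χ w * (φ w - (f w).re)) := by
            simp only [hψ]
            ring
          rw [h3, norm_neg, norm_mul, Real.norm_of_nonneg (radialCutoff_nonneg _ _ w)]
          by_cases hw2 : ‖w‖ < b₂
          · rw [Set.indicator_of_mem (show w ∈ shell _ _ from ⟨hw1', by gcongr⟩)]
            refine (mul_le_of_le_one_left (norm_nonneg _) (radialCutoff_le_one _ _ w)).trans ?_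
            exact hD w (by rw [mem_closedBall_zero_iff]; linarith)
          · have h4 : radialCutoff b₁ b₂ w = 0 := hχ0 w (not_lt.1 hw2)
            rw [h4, zero_mul]
            exact Set.indicator_nonneg (fun _ _ ↦ hD0) w
        · rw [Set.indicator_of_notMem hw1, norm_zero]
          exact Set.indicator_nonneg (fun _ _ ↦ hD0) w
      · rw [integral_indicator (measurableSet_shell _ _), setIntegral_const, hvol, smul_eq_mul,
          mul_comm]
    have h5 : |(f 0).re - ∫ ζ, φ ζ ∂unitCircleMeasure| ≤ κ := by
      obtain ⟨B, -, hB⟩ := exists_bound_of_support hφ hφ0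
      have hpi : Integrable (fun ζ ↦ (f ζ).re) unitCircleMeasure :=
        integrable_unitCircleMeasure hpc.measurable hpc.continuousOn.circleIntegrable'
      have h6 : ∫ ζ, (f ζ).re ∂unitCircleMeasure = (f 0).re := by
        simpa using integral_re_unitCircle hf 0 1
      rw [← h6, ← integral_sub hpi (Integrable.of_bound hφ.aestronglyMeasurable B (ae_of_all _ hB)),
        ← Real.norm_eq_abs]
      refine (norm_integral_le_of_norm_le_const (C := κ) ?_).trans_eq (by simp)
      filter_upwards [ae_unitCircleMeasure_norm_eq_one] with ζ hζ
      rw [Real.norm_eq_abs, abs_sub_comm]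
      exact hfφ ζ hζ
    rw [integral_holeLimitMeasure hφ hR, ← integral_add_compl hSm hψi, h1]
    set I₁ := ∫ w in (shell 0 (Real.exp 1))ᶜ, ψ w
    set I₂ := ∫ w in (shell 0 (Real.exp 1))ᶜ, φ w
    set J := ∫ ζ, φ ζ ∂unitCircleMeasure
    have hπ := Real.pi_pos
    have h7 : Real.pi⁻¹ * (Real.pi * Real.exp 1 * (f 0).re + I₁) -
        (Real.exp 1 * J + Real.pi⁻¹ * I₂) =
        Real.exp 1 * ((f 0).re - J) + Real.pi⁻¹ * (I₁ - I₂) := by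
      field_simp
      ring
    rw [h7]
    refine (abs_add_le _ _).trans ?_
    rw [abs_mul, abs_mul, abs_of_pos (Real.exp_pos 1), abs_of_pos (inv_pos.2 hπ)]
    have h8 : Real.exp 1 * |(f 0).re - J| ≤ 3 * κ := by gcongr
    have h9 : Real.pi⁻¹ * |I₁ - I₂| ≤ D * (b₂ ^ 2 - Real.exp 1) := by
      rw [inv_mul_le_iff₀ hπ]
      linarith
    linarith
  filter_upwards [hlim.eventually (Metric.ball_mem_nhds _ hκ0),
    eventually_mass_and_log_moment_le hX h0 hM hu0 hu hb₁ hb₂ hb₃ (by linarith)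
      (show 0 < κ / (C + 1) by positivity)] with i h1 h2
  obtain ⟨hmass, hlogi, hlog⟩ := h2
  have hXi := (hX i).isLocallyFiniteMeasure
  have h1' : |(∫ w, ψ w ∂X i) - Real.pi⁻¹ * ∫ w, ψ w| < κ := by
    rw [← Real.dist_eq]
    exact h1
  have hne0 : ∀ᵐ w ∂X i, 1 ≤ ‖w‖ := by
    rw [ae_iff]
    simpa [Metric.ball, dist_zero_right] using h0 i
  have hfinB : X i (Metric.closedBall 0 b₂) ≠ ⊤ := (isCompact_closedBall _ _).measure_lt_top.ne
  have hki : IntegrableOn (fun _ : ℂ ↦ 2 * κ) (Metric.closedBall 0 b₂) (X i) :=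
    integrableOn_const hfinB
  have hgi : IntegrableOn (fun w : ℂ ↦ 2 * κ + C * Real.log ‖w‖) (Metric.closedBall 0 b₂) (X i) :=
    hki.add (hlogi.const_mul C)
  -- No mass lies in the unit disk, so the discrepancy is at most `2κ + C log ‖w‖` there: `10κ` from
  -- a mass of at most `5`, and `2κ` from the logarithmic moment.
  have h3 : |(∫ w, φ w ∂X i) - ∫ w, ψ w ∂X i| ≤ 12 * κ := by
    rw [← integral_sub (hφ.integrable_of_hasCompactSupport (hcs φ hφ0))
      (hψc.integrable_of_hasCompactSupport (hcs ψ hψ0)), ← Real.norm_eq_abs]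
    refine (norm_integral_le_of_norm_le
      ((integrable_indicator_iff measurableSet_closedBall).2 hgi) ?_).trans ?_
    · filter_upwards [hne0] with w hw
      have h4 : φ w - ψ w = χ w * (φ w - (f w).re) := by
        simp only [hψ]
        ring
      rw [h4, norm_mul, Real.norm_of_nonneg (radialCutoff_nonneg _ _ w)]
      by_cases hw2 : ‖w‖ ≤ b₂
      · rw [Set.indicator_of_mem (by simpa using hw2)]
        exact (mul_le_of_le_one_left (norm_nonneg _) (radialCutoff_le_one _ _ w)).trans
          (hC w hw (by linarith))
      · rw [Set.indicator_of_notMem (by simpa using hw2)]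
        have h4 : radialCutoff b₁ b₂ w = 0 := hχ0 w (not_le.1 hw2).le
        rw [h4, zero_mul]
    · rw [integral_indicator measurableSet_closedBall,
        integral_add hki (hlogi.const_mul C), setIntegral_const,
        integral_const_mul, smul_eq_mul]
      have h5 : C * ∫ w in Metric.closedBall 0 b₂, Real.log ‖w‖ ∂X i ≤ 2 * κ := by
        calc _ ≤ C * (b₃ ^ 2 * Real.log b₂ - b₁ ^ 2 / 2 + κ / (C + 1)) := by gcongr
          _ = C * (b₃ ^ 2 * Real.log b₂ - b₁ ^ 2 / 2) + C * (κ / (C + 1)) := by ring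
          _ ≤ κ + (C + 1) * (κ / (C + 1)) := by
              gcongr
              linarith
          _ = 2 * κ := by
              field_simp
              ring
      have h6 : (X i).real (Metric.closedBall 0 b₂) ≤ 5 := by
        have h7 : κ / (C + 1) ≤ 1 := by
          rw [div_le_one (by positivity)]
          linarith
        have h8 : b₃ ^ 2 ≤ 2 ^ 2 := pow_le_pow_left₀ (by linarith) hb₃2.le 2
        linarith
      nlinarith
  rw [Real.dist_eq]
  have h4 := abs_sub_le (∫ w, φ w ∂X i) (∫ w, ψ w ∂X i) (Real.pi⁻¹ * ∫ w, ψ w)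
  have h5 := abs_sub_le (∫ w, φ w ∂X i) (Real.pi⁻¹ * ∫ w, ψ w)
    (∫ w, φ w ∂holeLimitMeasure.toMeasure)
  linarith

end

/-! ### From the typical event to convergence of integrals -/

/-- In Jensen's formula at radius `ρ + 1`, mass within radius `ρ` is weighted by at least `log
((ρ+1)/ρ)`. -/
theorem IsLogPotential.measureReal_closedBall_le {X : Measure ℂ} {u : ℂ → ℝ}
    (h : IsLogPotential X u) (h0 : X (Metric.ball 0 1) = 0) {ρ B : ℝ} (hρ : 0 < ρ) (hB : 0 ≤ B)
    (hu : ∀ w : ℂ, ‖w‖ ≤ ρ + 1 → u w ≤ B) :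
    Real.log ((ρ + 1) / ρ) * X.real (Metric.closedBall 0 ρ) ≤ B - u 0 := by
  have hX := h.isLocallyFiniteMeasure
  have hρ1 : 0 < ρ + 1 := by linarith
  obtain ⟨h1, h2⟩ := h.lintegral_eq_zero (ρ + 1) hρ1
  have hne0 : ∀ᵐ w ∂X, 1 ≤ ‖w‖ := by
    rw [ae_iff]
    simpa [Metric.ball, dist_zero_right] using h0
  have hmean : ∫ ζ, u ((ρ + 1 : ℝ) * ζ) ∂unitCircleMeasure ≤ B := by
    by_cases hi : Integrable (fun ζ ↦ u ((ρ + 1 : ℝ) * ζ)) unitCircleMeasure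
    · refine (integral_mono_ae hi (integrable_const B) ?_).trans_eq (by simp)
      filter_upwards [ae_unitCircleMeasure_norm_eq_one] with ζ hζ
      refine hu _ ?_
      rw [norm_mul, hζ, mul_one, Complex.norm_real, Real.norm_of_nonneg hρ1.le]
    -- A non-integrable mean is `0` by convention, which is why `0 ≤ B` is assumed.
    · rw [integral_undef hi]
      exact hB
  have hlog : 0 ≤ Real.log ((ρ + 1) / ρ) :=
    Real.log_nonneg ((one_le_div hρ).2 (by linarith))
  have h3 : ENNReal.ofReal (Real.log ((ρ + 1) / ρ)) * X (Metric.closedBall 0 ρ) ≤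
      ENNReal.ofReal (B - u 0) := by
    calc ENNReal.ofReal (Real.log ((ρ + 1) / ρ)) * X (Metric.closedBall 0 ρ)
        = ∫⁻ w, (Metric.closedBall (0 : ℂ) ρ).indicator
            (fun _ ↦ ENNReal.ofReal (Real.log ((ρ + 1) / ρ))) w ∂X := by
          rw [lintegral_indicator measurableSet_closedBall, setLIntegral_const]
      _ ≤ ∫⁻ w, ENNReal.ofReal (logKernel (ρ + 1) w) ∂X := by
          refine lintegral_mono_ae ?_
          filter_upwards [hne0] with w hw
          by_cases hwρ : ‖w‖ ≤ ρ
          · have hw0 : 0 < ‖w‖ := by linarith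
            rw [Set.indicator_of_mem (by simpa using hwρ),
              logKernel_eq_log (norm_pos_iff.1 hw0) (by linarith), Real.log_div hρ1.ne' hρ.ne']
            refine ENNReal.ofReal_le_ofReal ?_
            have := Real.log_le_log hw0 hwρ
            linarith
          · rw [Set.indicator_of_notMem (by simpa using hwρ)]
            exact zero_le
      _ ≤ _ := by
          rw [h1]
          exact ENNReal.ofReal_le_ofReal (by linarith)
  have h4 := ENNReal.toReal_mono ENNReal.ofReal_ne_top h3
  rwa [ENNReal.toReal_mul, ENNReal.toReal_ofReal hlog, ENNReal.toReal_ofReal (by linarith)] at h4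

section

variable {Ω : Type*} {ξ : ℕ → Ω → ℂ} {ρ δ r : ℝ} {ω : Ω}

theorem scaledLog_le_of_typical (hω : ω ∈ typicalEvent ξ ρ δ r) (hr : 0 < r) (hδ : 0 ≤ δ) {w : ℂ}
    (hw : ‖w‖ ≤ ρ + 1) : scaledLog (gef ξ ω) r w ≤ ‖w‖ ^ 2 / 2 + δ := by
  have h1 := hω.2.2.1 w hw
  rw [scaledLog, div_le_iff₀ (by positivity), mul_comm _ (r ^ 2)]
  rcases (norm_nonneg (gef ξ ω (r * w))).eq_or_lt with h0 | h0
  · rw [← h0, Real.log_zero]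
    positivity
  · exact (Real.log_le_iff_le_exp h0).2 h1

theorem ceil_le_mul {L : ℝ} (hL : 1 ≤ L) : (⌈ρ ^ 2 * L⌉₊ : ℝ) ≤ (ρ ^ 2 + 1) * L := by
  have h1 : (⌈ρ ^ 2 * L⌉₊ : ℝ) < ρ ^ 2 * L + 1 := Nat.ceil_lt_add_one (by positivity)
  linarith

theorem integrable_half_norm_sq_shellLaw (L : ℝ) (j : ℕ) :
    Integrable (fun w : ℂ ↦ ‖w‖ ^ 2 / 2) (shellLaw L j) := by
  have hc : Continuous fun w : ℂ ↦ ‖w‖ ^ 2 / 2 := by fun_prop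
  refine Integrable.smul_measure ?_ ENNReal.ofReal_ne_top
  refine (hc.locallyIntegrable.integrableOn_isCompact
    (isCompact_closedBall 0 (Real.sqrt ((j + 1) / L)))).mono_set fun w hw ↦ ?_
  rw [mem_closedBall_zero_iff]
  exact Real.le_sqrt_of_sq_le hw.2.le

theorem integral_half_norm_sq_shellLaw_le {L : ℝ} (hL : 0 < L) (j : ℕ) :
    ∫ w, ‖w‖ ^ 2 / 2 ∂shellLaw L j ≤ ((j : ℝ) + 1) / (2 * L) := by
  have := isProbabilityMeasure_shellLaw hL j
  refine (integral_mono_ae (integrable_half_norm_sq_shellLaw L j)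
    (integrable_const (((j : ℝ) + 1) / (2 * L))) ?_).trans_eq (by simp)
  filter_upwards [ae_shellLaw L j] with w hw
  have h1 : ‖w‖ ^ 2 ≤ ((j : ℝ) + 1) / L := hw.2.le
  calc ‖w‖ ^ 2 / 2 ≤ ((j : ℝ) + 1) / L / 2 := by gcongr
    _ = _ := by
      rw [div_div, mul_comm L 2]

theorem integrable_scaledLog_shellLaw (hd : Differentiable ℂ (gef ξ ω)) (h0 : gef ξ ω 0 ≠ 0)
    (hr : r ≠ 0) (L : ℝ) (j : ℕ) : Integrable (scaledLog (gef ξ ω) r) (shellLaw L j) := by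
  refine Integrable.smul_measure ?_ ENNReal.ofReal_ne_top
  refine ((isLogPotential_scaled hd h0 hr).locallyIntegrable.integrableOn_isCompact
    (isCompact_closedBall 0 (Real.sqrt ((j + 1) / L)))).mono_set fun w hw ↦ ?_
  rw [mem_closedBall_zero_iff]
  exact Real.le_sqrt_of_sq_le hw.2.le

theorem integral_scaledLog_shellLaw_le (hω : ω ∈ typicalEvent ξ ρ δ r) (hρ : 2 ≤ ρ) (hr : 1 ≤ r)
    (hδ : 0 ≤ δ) {j : ℕ} (hj : j < ⌈ρ ^ 2 * r ^ 2⌉₊) :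
    ∫ w, scaledLog (gef ξ ω) r w ∂shellLaw (r ^ 2) j ≤ ((j : ℝ) + 1) / (2 * r ^ 2) + δ := by
  have hr2 : 1 ≤ r ^ 2 := by nlinarith
  have := isProbabilityMeasure_shellLaw (by positivity : 0 < r ^ 2) j
  have hq := integrable_half_norm_sq_shellLaw (r ^ 2) j
  calc ∫ w, scaledLog (gef ξ ω) r w ∂shellLaw (r ^ 2) j
      ≤ ∫ w, (‖w‖ ^ 2 / 2 + δ) ∂shellLaw (r ^ 2) j := by
        refine integral_mono_ae (integrable_scaledLog_shellLaw hω.1 hω.2.1 (by linarith) _ j)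
          (hq.add (integrable_const δ)) ?_
        filter_upwards [ae_shellLaw (r ^ 2) j] with w hw
        refine scaledLog_le_of_typical hω (by linarith) hδ ?_
        exact le_of_sq_le_sq (hw.2.le.trans (succ_div_le_sq hr2 (by linarith) hj)) (by linarith)
    _ = ∫ w, ‖w‖ ^ 2 / 2 ∂shellLaw (r ^ 2) j + δ := by
        rw [integral_add hq (integrable_const δ), integral_const, probReal_univ, one_smul]
    _ ≤ _ := by
        gcongr
        exact integral_half_norm_sq_shellLaw_le (by positivity) j

theorem potentialDeficit_eq (hr : r ≠ 0) : potentialDeficit ξ ρ r ω =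
    r ^ 2 * (-(⌊Real.exp 1 * r ^ 2⌋₊ : ℝ) * scaledLog (gef ξ ω) r 0 +
      ∑ j ∈ Finset.Ico ⌊Real.exp 1 * r ^ 2⌋₊ ⌈ρ ^ 2 * r ^ 2⌉₊,
        ((j : ℝ) / (2 * r ^ 2) - ∫ w, scaledLog (gef ξ ω) r w ∂shellLaw (r ^ 2) j)) := by
  have hr2 : r ^ 2 ≠ 0 := pow_ne_zero 2 hr
  rw [potentialDeficit, mul_add, Finset.mul_sum]
  congr 1
  · rw [scaledLog, mul_zero]
    field_simp
  · refine Finset.sum_congr rfl fun j _ ↦ ?_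
    unfold scaledLog
    rw [integral_div]
    field_simp

/-- The upper bound on the potential makes each annulus term of the deficit at least `-(1/L + δ)`. A
very negative `u 0`, multiplied by `K ≥ L`, would then make the deficit too large. -/
theorem neg_le_scaledLog_zero (hω : ω ∈ typicalEvent ξ ρ δ r) (hρ : 2 ≤ ρ) (hr : 1 ≤ r)
    (hδ : 0 ≤ δ) :
    -(δ + (ρ ^ 2 + 1) * (1 / r ^ 2 + δ)) ≤ scaledLog (gef ξ ω) r 0 := by
  have hr2 : 1 ≤ r ^ 2 := by nlinarith
  have hr0 : 0 < r ^ 2 := by positivity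
  have h1 := hω.2.2.2
  rw [potentialDeficit_eq (by linarith)] at h1
  set L := r ^ 2 with hL
  set u := scaledLog (gef ξ ω) r with hu
  set K := ⌊Real.exp 1 * L⌋₊ with hK
  set N := ⌈ρ ^ 2 * L⌉₊ with hN
  have hKL : L ≤ K := le_floor_exp_one_mul hr2
  have hNL : (N : ℝ) ≤ (ρ ^ 2 + 1) * L := ceil_le_mul hr2
  have h2 : -(N * (1 / L + δ)) ≤
      ∑ j ∈ Finset.Ico K N, ((j : ℝ) / (2 * L) - ∫ w, u w ∂shellLaw L j) := by
    have h3 : ∑ _j ∈ Finset.Ico K N, -(1 / L + δ) ≤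
        ∑ j ∈ Finset.Ico K N, ((j : ℝ) / (2 * L) - ∫ w, u w ∂shellLaw L j) := by
      refine Finset.sum_le_sum fun j hj ↦ ?_
      have h4 := integral_scaledLog_shellLaw_le hω hρ hr hδ (Finset.mem_Ico.1 hj).2
      have h5 : ((j : ℝ) + 1) / (2 * L) ≤ (j : ℝ) / (2 * L) + 1 / L := by
        rw [add_div]
        gcongr
        linarith
      linarith
    refine le_trans ?_ h3
    rw [Finset.sum_const, nsmul_eq_mul, Nat.card_Ico, mul_neg]
    gcongr
    exact Nat.sub_le _ _
  have h6 : r ^ 4 = L * L := by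
    rw [hL]
    ring
  rw [h6] at h1
  have h7 : -(K : ℝ) * u 0 + ∑ j ∈ Finset.Ico K N, ((j : ℝ) / (2 * L) - ∫ w, u w ∂shellLaw L j) <
      δ * L := by
    have : L * (-(K : ℝ) * u 0 +
      ∑ j ∈ Finset.Ico K N, ((j : ℝ) / (2 * L) - ∫ w, u w ∂shellLaw L j)) < L * (δ * L) := by
      linarith
    exact lt_of_mul_lt_mul_left this hr0.le
  have h8 : (N : ℝ) * (1 / L + δ) ≤ (ρ ^ 2 + 1) * L * (1 / L + δ) := by gcongr
  by_contra hcon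
  have hcon := not_le.1 hcon
  set A := δ + (ρ ^ 2 + 1) * (1 / L + δ) with hA
  have hA0 : 0 ≤ A := by positivity
  have h9 : A * L ≤ -(K : ℝ) * u 0 := by
    calc A * L ≤ A * K := by gcongr
      _ ≤ (-u 0) * K := by
          gcongr
          linarith
      _ = _ := by ring
  have h10 : A * L = δ * L + (ρ ^ 2 + 1) * L * (1 / L + δ) := by
    rw [hA]
    ring
  linarith

/-- The one-sided bound `u ≤ |w|²/2 + δ` gives `|u - |w|²/2| ≤ (|w|²/2 - u) + 2δ`. The integral of
the signed difference is bounded by the deficit, because `u 0 ≤ δ` limits what its first term can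
cancel. -/
theorem setIntegral_abs_scaledLog_sub_le (hω : ω ∈ typicalEvent ξ ρ δ r) (hρ : 2 ≤ ρ)
    (hr : 1 ≤ r) (hδ : 0 ≤ δ) :
    ∫ w in shell (Real.exp 1) (ρ ^ 2), |scaledLog (gef ξ ω) r w - ‖w‖ ^ 2 / 2| ≤
      Real.pi * ((ρ ^ 2 + 1) * (1 / r ^ 2) + (4 + 2 * (ρ ^ 2 + 1)) * δ) := by
  have hr2 : 1 ≤ r ^ 2 := by nlinarith
  have hr0 : 0 < r ^ 2 := by positivity
  have h1 := hω.2.2.2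
  rw [potentialDeficit_eq (by linarith)] at h1
  set L := r ^ 2 with hL
  set u := scaledLog (gef ξ ω) r with hu
  set K := ⌊Real.exp 1 * L⌋₊ with hK
  set N := ⌈ρ ^ 2 * L⌉₊ with hN
  set D := ρ ^ 2 + 1 with hD
  have hKN : K ≤ N := floor_le_ceil hρ hr0.le
  have hK3 : (K : ℝ) ≤ 3 * L := floor_exp_one_mul_le hr0.le
  have hNL : (N : ℝ) ≤ D * L := ceil_le_mul hr2
  have hu0 : u 0 ≤ δ := by
    have := scaledLog_le_of_typical hω (by linarith) hδ (w := 0) (by simp; linarith)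
    simpa using this
  have hui : ∀ j ∈ Finset.Ico K N, Integrable u (shellLaw L j) := fun j _ ↦
    integrable_scaledLog_shellLaw hω.1 hω.2.1 (by linarith) _ j
  have hqi : ∀ j ∈ Finset.Ico K N, Integrable (fun w : ℂ ↦ ‖w‖ ^ 2 / 2) (shellLaw L j) :=
    fun j _ ↦ integrable_half_norm_sq_shellLaw L j
  obtain ⟨hui', hus⟩ := sum_integral_shellLaw hr0 hKN hui
  obtain ⟨hqi', hqs⟩ := sum_integral_shellLaw hr0 hKN hqi
  set S := shell (K / L) (N / L) with hS
  have h6 : r ^ 4 = L * L := by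
    rw [hL]
    ring
  rw [h6, Finset.sum_sub_distrib, hus] at h1
  have h7 : -(K : ℝ) * u 0 + (∑ j ∈ Finset.Ico K N, (j : ℝ) / (2 * L) -
      L / Real.pi * ∫ w in S, u w) < δ * L := by
    refine lt_of_mul_lt_mul_left (a := L) ?_ hr0.le
    linarith
  have h8 : L / Real.pi * ∫ w in S, ‖w‖ ^ 2 / 2 ≤
      ∑ j ∈ Finset.Ico K N, (j : ℝ) / (2 * L) + D := by
    rw [← hqs]
    have h9 : ∑ j ∈ Finset.Ico K N, ∫ w, ‖w‖ ^ 2 / 2 ∂shellLaw L j ≤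
        ∑ j ∈ Finset.Ico K N, ((j : ℝ) / (2 * L) + 1 / L) := by
      refine Finset.sum_le_sum fun j _ ↦ (integral_half_norm_sq_shellLaw_le hr0 j).trans ?_
      rw [add_div]
      gcongr
      linarith
    refine h9.trans ?_
    rw [Finset.sum_add_distrib, Finset.sum_const, nsmul_eq_mul, Nat.card_Ico]
    gcongr
    calc ((N - K : ℕ) : ℝ) * (1 / L) ≤ (D * L) * (1 / L) := by
          gcongr
          refine le_trans ?_ hNL
          exact_mod_cast Nat.sub_le _ _
      _ = D := by field_simp
  have hKu : (K : ℝ) * u 0 ≤ 3 * L * δ := by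
    calc (K : ℝ) * u 0 ≤ K * δ := by gcongr
      _ ≤ 3 * L * δ := by gcongr
  have hvolS : volume.real S ≤ Real.pi * D := by
    have hle : (K : ℝ) / L ≤ N / L := by gcongr
    rw [measureReal_def, hS, volume_shell (by positivity) hle, ENNReal.toReal_ofReal
      (mul_nonneg Real.pi_pos.le (by linarith))]
    gcongr
    have h10 : (N : ℝ) / L ≤ D := by rwa [div_le_iff₀ hr0]
    have h11 : 0 ≤ (K : ℝ) / L := by positivity
    linarith
  have hvolfin : volume S ≠ ⊤ := by
    have hle : (K : ℝ) / L ≤ N / L := by gcongr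
    rw [hS, volume_shell (by positivity) hle]
    exact ENNReal.ofReal_ne_top
  have hsub : shell (Real.exp 1) (ρ ^ 2) ⊆ S := by
    rintro w ⟨hw1, hw2⟩
    refine ⟨le_trans ?_ hw1, hw2.trans_le ?_⟩
    · rw [div_le_iff₀ hr0]
      exact Nat.floor_le (by positivity)
    · rw [le_div_iff₀ hr0]
      exact Nat.le_ceil _
  have hci : IntegrableOn (fun _ : ℂ ↦ 2 * δ) S := integrableOn_const hvolfin
  have hqui : IntegrableOn (fun w ↦ ‖w‖ ^ 2 / 2 - u w) S := hqi'.sub hui'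
  have huqi : IntegrableOn (fun w ↦ |u w - ‖w‖ ^ 2 / 2|) S := (hui'.sub hqi').abs
  have hpt : ∀ w ∈ S, |u w - ‖w‖ ^ 2 / 2| ≤ (‖w‖ ^ 2 / 2 - u w) + 2 * δ := by
    intro w hw
    have h12 : u w ≤ ‖w‖ ^ 2 / 2 + δ := by
      refine scaledLog_le_of_typical hω (by linarith) hδ ?_
      refine le_of_sq_le_sq ?_ (by linarith)
      have h10 : (N : ℝ) / L ≤ D := by rwa [div_le_iff₀ hr0]
      have h13 := hw.2
      rw [hD] at h10
      linarith
    rw [abs_le]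
    constructor <;> linarith
  calc ∫ w in shell (Real.exp 1) (ρ ^ 2), |u w - ‖w‖ ^ 2 / 2|
      ≤ ∫ w in S, |u w - ‖w‖ ^ 2 / 2| :=
        setIntegral_mono_set huqi (ae_of_all _ fun w ↦ abs_nonneg _)
          (ae_of_all _ hsub)
    _ ≤ ∫ w in S, ((‖w‖ ^ 2 / 2 - u w) + 2 * δ) :=
        setIntegral_mono_on huqi (hqui.add hci)
          (measurableSet_shell _ _) hpt
    _ = (∫ w in S, ‖w‖ ^ 2 / 2) - (∫ w in S, u w) + volume.real S * (2 * δ) := by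
        rw [integral_add hqui hci, integral_sub hqi' hui', setIntegral_const, smul_eq_mul]
    _ ≤ _ := by
        set Q := ∫ w in S, ‖w‖ ^ 2 / 2
        set U := ∫ w in S, u w
        have h14 : L / Real.pi * (Q - U) ≤ D + 4 * L * δ := by
          rw [mul_sub]
          linarith
        have h15 : Q - U ≤ Real.pi * (D * (1 / L) + 4 * δ) := by
          have h16 : Q - U = Real.pi / L * (L / Real.pi * (Q - U)) := by
            have := Real.pi_pos
            field_simp
          rw [h16]
          calc _ ≤ Real.pi / L * (D + 4 * L * δ) := by gcongr
            _ = _ := by field_simp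
        have h17 : volume.real S * (2 * δ) ≤ Real.pi * D * (2 * δ) := by gcongr
        linarith

/-- On the hole event and the typical event, the scaled zero measure is close to the limit. -/
theorem exists_forall_abs_integral_sub_lt (ξ : ℕ → Ω → ℂ) {φ : ℂ → ℝ} (hφ : Continuous φ) {R : ℝ}
    (hR : ∀ w, R < ‖w‖ → φ w = 0) {ε : ℝ} (hε : 0 < ε) :
    ∃ ρ δ r₀ : ℝ, 2 ≤ ρ ∧ 0 < δ ∧ δ ≤ 1 ∧ ∀ r, r₀ ≤ r → ∀ ω ∈ holeEvent ξ r ∩ typicalEvent ξ ρ δ r,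
      |(∫ w, φ w ∂(scaledZeroMeasure ξ r ω).toMeasure) -
        ∫ w, φ w ∂holeLimitMeasure.toMeasure| < ε := by
  set ρ := max 2 (R + 1) with hρdef
  have hρ : 2 ≤ ρ := le_max_left _ _
  have hRρ : R < ρ := by
    have := le_max_right 2 (R + 1)
    linarith
  -- A failure for all parameters yields samples with `δ = 1/(n+1)` and `r ≥ n+1`, a sequence to
  -- which the deterministic theorem applies.
  by_contra! hcon
  have hδ0 : ∀ n : ℕ, 0 < 1 / ((n : ℝ) + 1) := fun n ↦ by positivity
  have hδ1 : ∀ n : ℕ, 1 / ((n : ℝ) + 1) ≤ 1 := fun n ↦ by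
    rw [div_le_one (by positivity)]
    have : (0 : ℝ) ≤ n := n.cast_nonneg
    linarith
  choose r hrn ω hω hbad using fun n : ℕ ↦ hcon ρ (1 / ((n : ℝ) + 1)) (n + 1) hρ (hδ0 n) (hδ1 n)
  have hr1 : ∀ n, 1 ≤ r n := fun n ↦ by
    have : (0 : ℝ) ≤ n := n.cast_nonneg
    have := hrn n
    linarith
  have hrinv : ∀ n, 1 / r n ^ 2 ≤ 1 / ((n : ℝ) + 1) := fun n ↦ by
    have h1 := hr1 n
    refine one_div_le_one_div_of_le (by positivity) ((hrn n).trans ?_)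
    nlinarith
  set X : ℕ → Measure ℂ := fun n ↦ ENNReal.ofReal (1 / r n ^ 2) •
    (zeroCountingMeasure (gef ξ (ω n))).map fun z ↦ z / (r n : ℂ)
  set u : ℕ → ℂ → ℝ := fun n ↦ scaledLog (gef ξ (ω n)) (r n)
  have hX : ∀ n, IsLogPotential (X n) (u n) := fun n ↦
    isLogPotential_scaled (hω n).2.1 (hω n).2.2.1 (by linarith [hr1 n])
  have hXeq : ∀ n, (scaledZeroMeasure ξ (r n) (ω n)).toMeasure = X n := by
    intro n
    rw [scaledZeroMeasure, RadonMeasure.ofMeasure, dif_pos (hX n).isLocallyFiniteMeasure]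
  have h0 : ∀ n, X n (Metric.ball 0 1) = 0 := fun n ↦
    scaled_zeroCountingMeasure_ball (r n) (by linarith [hr1 n]) (hω n).1
  have hlimδ : Tendsto (fun n : ℕ ↦ 1 / ((n : ℝ) + 1)) atTop (nhds 0) :=
    tendsto_one_div_add_atTop_nhds_zero_nat
  set D := ρ ^ 2 + 1 with hD
  have hDpos : 0 ≤ D := by positivity
  have hlow : ∀ n : ℕ, -((1 + 2 * D) * (1 / ((n : ℝ) + 1))) ≤ u n 0 := by
    intro n
    refine le_trans ?_ (neg_le_scaledLog_zero (hω n).2 hρ (hr1 n) (hδ0 n).le)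
    have h1 : D * (1 / r n ^ 2) ≤ D * (1 / ((n : ℝ) + 1)) :=
      mul_le_mul_of_nonneg_left (hrinv n) hDpos
    linarith
  have hup : ∀ n : ℕ, ∀ w : ℂ, ‖w‖ ≤ ρ + 1 → u n w ≤ ‖w‖ ^ 2 / 2 + 1 / ((n : ℝ) + 1) := fun n w hw ↦
    scaledLog_le_of_typical (hω n).2 (by linarith [hr1 n]) (hδ0 n).le hw
  have hu0 : Tendsto (fun n ↦ u n 0) atTop (nhds 0) := by
    have h1 := (hlimδ.const_mul (1 + 2 * D)).neg
    rw [mul_zero, neg_zero] at h1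
    refine tendsto_of_tendsto_of_tendsto_of_le_of_le h1 hlimδ hlow fun n ↦ ?_
    have h2 := hup n 0 (by rw [norm_zero]; linarith)
    rw [norm_zero] at h2
    linarith
  have hu : Tendsto (fun n ↦ ∫ w in shell (Real.exp 1) (ρ ^ 2), |u n w - ‖w‖ ^ 2 / 2|) atTop
      (nhds 0) := by
    have h1 := hlimδ.const_mul (Real.pi * (D + (4 + 2 * D)))
    rw [mul_zero] at h1
    refine squeeze_zero (fun n ↦ integral_nonneg fun w ↦ abs_nonneg _) (fun n ↦ ?_) h1
    refine (setIntegral_abs_scaledLog_sub_le (hω n).2 hρ (hr1 n) (hδ0 n).le).trans ?_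
    rw [mul_assoc]
    refine mul_le_mul_of_nonneg_left ?_ Real.pi_pos.le
    have h2 := mul_le_mul_of_nonneg_left (hrinv n) hDpos
    linarith
  set B := (ρ + 1) ^ 2 / 2 + 1 with hB
  have hlogpos : 0 < Real.log ((ρ + 1) / ρ) := Real.log_pos ((one_lt_div (by linarith)).2 (by linarith))
  have hM : ∀ n, (X n).real (Metric.closedBall 0 ρ) ≤
      (B + (1 + 2 * D)) / Real.log ((ρ + 1) / ρ) := by
    intro n
    rw [le_div_iff₀ hlogpos, mul_comm]
    refine ((hX n).measureReal_closedBall_le (h0 n) (by linarith) (B := B) (by positivity)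
      fun w hw ↦ ?_).trans ?_
    · refine (hup n w hw).trans ?_
      rw [hB]
      have h1 := hδ1 n
      gcongr
    · have h1 := hlow n
      have h2 : (1 + 2 * D) * (1 / ((n : ℝ) + 1)) ≤ (1 + 2 * D) * 1 :=
        mul_le_mul_of_nonneg_left (hδ1 n) (by positivity)
      linarith
  have hlim := tendsto_integral_holeLimitMeasure hX h0 hM hu0 hu hρ hφ hRρ hR
  obtain ⟨n, hn⟩ := (hlim.eventually (Metric.ball_mem_nhds _ hε)).exists
  refine absurd hn ?_
  rw [Real.dist_eq, not_lt, ← hXeq]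
  exact hbad n

end

/-! ### Vague topology, measurability and the conclusion -/

theorem CompactlySupportedContinuousMap.exists_norm_bound (φ : C_c(ℂ, ℝ)) :
    ∃ R, ∀ w, R < ‖w‖ → φ w = 0 := by
  obtain ⟨R, hR⟩ := φ.hasCompactSupport.isCompact.isBounded.exists_norm_le
  refine ⟨R, fun w hw ↦ ?_⟩
  by_contra hne
  have := hR w (subset_tsupport _ hne)
  linarith

/-- The test function `f χ_n`, with `χ_n` a cutoff of the disk of radius `n`. -/
def cutoffMul (f : C(ℂ, ℝ)) (n : ℕ) (w : ℂ) : ℝ := f w * radialCutoff n (n + 1) w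

theorem continuous_cutoffMul (f : C(ℂ, ℝ)) (n : ℕ) : Continuous (cutoffMul f n) :=
  f.continuous.mul (continuous_radialCutoff _ _)

theorem cutoffMul_eq_zero (f : C(ℂ, ℝ)) (n : ℕ) (w : ℂ) (hw : (n : ℝ) + 1 < ‖w‖) :
    cutoffMul f n w = 0 := by
  rw [cutoffMul, radialCutoff_eq_zero (by linarith) hw.le, mul_zero]

theorem integrable_of_support {ν : Measure ℂ} [IsLocallyFiniteMeasure ν] {ψ : ℂ → ℝ}
    (hψ : Continuous ψ) {R : ℝ} (hR : ∀ w, R < ‖w‖ → ψ w = 0) : Integrable ψ ν :=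
  hψ.integrable_of_hasCompactSupport
    (HasCompactSupport.intro (isCompact_closedBall (0 : ℂ) R) fun w hw ↦ hR w (by simpa using hw))

/-- Convergence of the integrals of a countable family of test functions implies vague
convergence. -/
theorem tendsto_integral_of_dense {D : Set C(ℂ, ℝ)} (hD : Dense D) (h1 : 1 ∈ D)
    {l : Filter RadonMeasure} {ν₀ : RadonMeasure}
    (h : ∀ f ∈ D, ∀ n : ℕ, Tendsto (fun ν : RadonMeasure ↦ ∫ w, cutoffMul f n w ∂ν.toMeasure) l
      (nhds (∫ w, cutoffMul f n w ∂ν₀.toMeasure))) (φ : C_c(ℂ, ℝ)) :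
    Tendsto (fun ν : RadonMeasure ↦ ∫ w, φ w ∂ν.toMeasure) l
      (nhds (∫ w, φ w ∂ν₀.toMeasure)) := by
  rw [Metric.tendsto_nhds]
  intro ε hε
  obtain ⟨R, hR⟩ := φ.exists_norm_bound
  obtain ⟨n, hn⟩ := exists_nat_ge R
  set m := ∫ w, cutoffMul 1 n w ∂ν₀.toMeasure with hm
  have hm0 : 0 ≤ m := integral_nonneg fun w ↦ by
    rw [cutoffMul, ContinuousMap.one_apply, one_mul]
    exact radialCutoff_nonneg _ _ w
  set η := ε / (4 * (m + 1)) with hη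
  have hη0 : 0 < η := by positivity
  obtain ⟨f, hfD, hf⟩ : ∃ f ∈ D, ∀ w ∈ Metric.closedBall (0 : ℂ) (n + 1),
      dist ((φ : C(ℂ, ℝ)) w) (f w) < η := by
    have h2 : ∀ᶠ f in nhds (φ : C(ℂ, ℝ)), ∀ w ∈ Metric.closedBall (0 : ℂ) (n + 1),
        dist ((φ : C(ℂ, ℝ)) w) (f w) < η :=
      Metric.tendstoUniformlyOn_iff.1
        (ContinuousMap.tendsto_iff_forall_isCompact_tendstoUniformlyOn.1 tendsto_id _
          (isCompact_closedBall 0 _)) η hη0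
    exact ((mem_closure_iff_frequently.1 (hD (φ : C(ℂ, ℝ)))).and_eventually h2).exists
  -- The cutoff of the constant `1` dominates the approximation error, so convergence for that test
  -- function controls the error uniformly near `ν₀`; hence `1 ∈ D`.
  have hpt : ∀ w, |φ w - cutoffMul f n w| ≤ η * cutoffMul 1 n w := by
    intro w
    have hχ := radialCutoff_nonneg n (n + 1) w
    have h3 : φ w = φ w * radialCutoff n (n + 1) w := by
      by_cases hw : ‖w‖ ≤ n
      · rw [radialCutoff_eq_one (by linarith) hw, mul_one]
      · rw [hR w (by linarith [not_le.1 hw]), zero_mul]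
    rw [cutoffMul, cutoffMul, ContinuousMap.one_apply, one_mul, h3, ← sub_mul, abs_mul,
      abs_of_nonneg hχ]
    by_cases hw : ‖w‖ ≤ n + 1
    · refine mul_le_mul_of_nonneg_right ?_ hχ
      exact (hf w (by simpa using hw)).le
    · rw [radialCutoff_eq_zero (by linarith) (not_le.1 hw).le]
      simp
  have hint : ∀ ν : RadonMeasure, |(∫ w, φ w ∂ν.toMeasure) - ∫ w, cutoffMul f n w ∂ν.toMeasure| ≤
      η * ∫ w, cutoffMul 1 n w ∂ν.toMeasure := by
    intro ν
    have := ν.locallyFinite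
    have hφi : Integrable (fun w ↦ φ w) ν.toMeasure :=
      integrable_of_support (ψ := fun w ↦ φ w) (map_continuous φ) hR
    have hfi : Integrable (fun w ↦ cutoffMul f n w) ν.toMeasure :=
      integrable_of_support (continuous_cutoffMul f n) (cutoffMul_eq_zero f n)
    rw [← integral_sub hφi hfi, ← Real.norm_eq_abs, ← integral_const_mul]
    exact norm_integral_le_of_norm_le ((integrable_of_support (continuous_cutoffMul 1 n)
      (cutoffMul_eq_zero 1 n)).const_mul η) (ae_of_all _ hpt)
  filter_upwards [(h f hfD n).eventually (Metric.ball_mem_nhds _ (by positivity : 0 < ε / 4)),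
    (h 1 h1 n).eventually (gt_mem_nhds (show m < m + 1 by linarith))] with ν h4 h5
  have h4' : |(∫ w, cutoffMul f n w ∂ν.toMeasure) - ∫ w, cutoffMul f n w ∂ν₀.toMeasure| <
      ε / 4 := h4
  have h6 := hint ν
  have h7 := hint ν₀
  have h8 : η * ∫ w, cutoffMul 1 n w ∂ν.toMeasure ≤ η * (m + 1) := by gcongr
  have h9 : η * m ≤ η * (m + 1) := by
    gcongr
    linarith
  have h10 : η * (m + 1) = ε / 4 := by
    rw [hη]
    field_simp
  rw [Real.dist_eq]
  have h11 := abs_sub_le (∫ w, φ w ∂ν.toMeasure) (∫ w, cutoffMul f n w ∂ν.toMeasure)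
    (∫ w, φ w ∂ν₀.toMeasure)
  have h12 := abs_sub_le (∫ w, cutoffMul f n w ∂ν.toMeasure)
    (∫ w, cutoffMul f n w ∂ν₀.toMeasure) (∫ w, φ w ∂ν₀.toMeasure)
  rw [abs_sub_comm (∫ w, cutoffMul f n w ∂ν₀.toMeasure)] at h12
  linarith

namespace RadonMeasure

theorem continuous_integral {ψ : ℂ → ℝ} (hψ : Continuous ψ) {R : ℝ}
    (hR : ∀ w, R < ‖w‖ → ψ w = 0) :
    Continuous fun ν : RadonMeasure ↦ ∫ w, ψ w ∂ν.toMeasure := by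
  have h1 : Continuous fun (ν : RadonMeasure) (φ : C_c(ℂ, ℝ)) ↦ ∫ z, φ z ∂ν.toMeasure :=
    continuous_induced_dom
  exact (continuous_apply (⟨⟨ψ, hψ⟩, HasCompactSupport.intro (isCompact_closedBall (0 : ℂ) R)
    fun w hw ↦ hR w (by simpa using hw)⟩ : C_c(ℂ, ℝ))).comp h1

theorem nhds_eq_comap (ν₀ : RadonMeasure) : nhds ν₀ =
    comap (fun (ν : RadonMeasure) (φ : C_c(ℂ, ℝ)) ↦ ∫ z, φ z ∂ν.toMeasure)
      (nhds fun φ : C_c(ℂ, ℝ) ↦ ∫ z, φ z ∂ν₀.toMeasure) :=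
  nhds_induced _ _

/-- The vague topology is induced by a countable family of test functions. -/
theorem isInducing_cutoffMul {D : Set C(ℂ, ℝ)} (hD : Dense D) (h1 : 1 ∈ D) :
    Topology.IsInducing fun (ν : RadonMeasure) (p : D × ℕ) ↦
      ∫ w, cutoffMul (p.1 : C(ℂ, ℝ)) p.2 w ∂ν.toMeasure := by
  rw [Topology.isInducing_iff_nhds]
  intro ν₀
  refine le_antisymm ?_ ?_
  · rw [← tendsto_iff_comap]
    have hc : Continuous fun (ν : RadonMeasure) (p : D × ℕ) ↦
        ∫ w, cutoffMul (p.1 : C(ℂ, ℝ)) p.2 w ∂ν.toMeasure :=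
      continuous_pi fun p ↦
        continuous_integral (continuous_cutoffMul _ _) (cutoffMul_eq_zero _ _)
    exact hc.tendsto ν₀
  · rw [nhds_eq_comap, ← tendsto_iff_comap, tendsto_pi_nhds]
    refine fun φ ↦ tendsto_integral_of_dense hD h1 (fun f hf n ↦ ?_) φ
    exact (tendsto_pi_nhds.1 (tendsto_comap (x := nhds fun p : D × ℕ ↦
      ∫ w, cutoffMul (p.1 : C(ℂ, ℝ)) p.2 w ∂ν₀.toMeasure))) (⟨f, hf⟩, n)

/-- A random Radon measure is measurable as soon as its integrals against continuous functions
with bounded support are. -/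
theorem measurable_of_integral {α : Type*} [MeasurableSpace α] {Y : α → RadonMeasure}
    (hY : ∀ ψ : ℂ → ℝ, Continuous ψ → (∃ R, ∀ w, R < ‖w‖ → ψ w = 0) →
      Measurable fun a ↦ ∫ w, ψ w ∂(Y a).toMeasure) : Measurable Y := by
  obtain ⟨D₀, hD₀c, hD₀⟩ := TopologicalSpace.exists_countable_dense C(ℂ, ℝ)
  -- A countable family makes the target of the inducing map a countable product of lines, where
  -- coordinatewise measurability is Borel measurability.
  set D : Set C(ℂ, ℝ) := insert 1 D₀ with hDdef
  have hDc : Countable D := (hD₀c.insert 1).to_subtype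
  have hind := isInducing_cutoffMul (hD₀.mono (Set.subset_insert 1 D₀)) (Set.mem_insert 1 D₀)
  have hmeas : Measurable fun (a : α) (p : D × ℕ) ↦
      ∫ w, cutoffMul (p.1 : C(ℂ, ℝ)) p.2 w ∂(Y a).toMeasure :=
    measurable_pi_iff.2 fun p ↦ hY _ (continuous_cutoffMul _ _) ⟨_, cutoffMul_eq_zero _ _⟩
  refine measurable_of_isOpen fun G hG ↦ ?_
  obtain ⟨V, hV, rfl⟩ := hind.isOpen_iff.1 hG
  exact hmeas hV.measurableSet

end RadonMeasure

section

variable {Ω : Type*} [MeasurableSpace Ω] {P : Measure Ω} {ξ : ℕ → Ω → ℂ}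

theorem ae_differentiable_gef (hmeas : ∀ k, Measurable (ξ k))
    (hlaw : ∀ k, P.map (ξ k) = stdComplexGaussian) :
    ∀ᵐ ω ∂P, Differentiable ℂ (gef ξ ω) ∧ gef ξ ω 0 ≠ 0 := by
  filter_upwards [ae_exists_mem_linearGrowthEvent hmeas hlaw, ae_gef_zero_ne_zero hmeas hlaw]
    with ω ⟨c, _, hc⟩ h0
  exact ⟨differentiable_gef hc, h0⟩

/-- Each integral is a limit of integrals of the jointly measurable potential against circular
differences of the test function, so no measurable enumeration of the zeros is needed. -/
theorem aemeasurable_scaledZeroMeasure (hmeas : ∀ k, Measurable (ξ k))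
    (hlaw : ∀ k, P.map (ξ k) = stdComplexGaussian) (r : ℝ) :
    AEMeasurable (scaledZeroMeasure ξ r) P := by
  rcases eq_or_ne r 0 with rfl | hr
  · have h0 : scaledZeroMeasure ξ 0 = fun _ ↦ RadonMeasure.ofMeasure 0 := by
      ext1 ω
      simp [scaledZeroMeasure]
    rw [h0]
    exact aemeasurable_const
  set A : Set Ω := {ω | ¬ (Differentiable ℂ (gef ξ ω) ∧ gef ξ ω 0 ≠ 0)} with hA
  have hPA : P A = 0 := ae_iff.1 (ae_differentiable_gef hmeas hlaw)
  -- The exceptional set need not be measurable; a measurable null superset is removed instead.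
  set N := toMeasurable P A with hN
  have hNm : MeasurableSet N := measurableSet_toMeasurable P A
  have hPN : P N = 0 := by rw [hN, measure_toMeasurable, hPA]
  classical
  refine ⟨N.piecewise (fun _ ↦ RadonMeasure.ofMeasure 0) (scaledZeroMeasure ξ r), ?_, ?_⟩
  · refine RadonMeasure.measurable_of_integral fun ψ hψ ⟨R, hR⟩ ↦ ?_
    have hu : Measurable fun p : Ω × ℂ ↦ scaledLog (gef ξ p.1) r p.2 := by
      unfold scaledLog
      exact (Real.measurable_log.comp ((measurable_gef_uncurry hmeas).comp
        (measurable_fst.prodMk (measurable_snd.const_mul _))).norm).div_const _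
    have hg : ∀ t : ℝ, Measurable fun ω ↦ ∫ w, scaledLog (gef ξ ω) r w *
        (circMean t ψ w - ψ w) := by
      intro t
      have h1 : Measurable fun p : Ω × ℂ ↦ scaledLog (gef ξ p.1) r p.2 *
          (circMean t ψ p.2 - ψ p.2) :=
        hu.mul (((measurable_circMean hψ.measurable).sub hψ.measurable).comp measurable_snd)
      exact (h1.stronglyMeasurable.integral_prod_right' (ν := volume)).measurable
    set t : ℕ → ℝ := fun n ↦ 1 / ((n : ℝ) + 1)
    have ht : Tendsto t atTop (nhdsWithin 0 (Set.Ioi 0)) :=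
      tendsto_nhdsWithin_iff.2 ⟨tendsto_one_div_add_atTop_nhds_zero_nat,
        Eventually.of_forall fun n ↦ by
          change 0 < 1 / ((n : ℝ) + 1)
          positivity⟩
    refine measurable_of_tendsto_metrizable (f := fun n ↦ Nᶜ.indicator fun ω ↦
      2 / (Real.pi * t n ^ 2) * ∫ w, scaledLog (gef ξ ω) r w * (circMean (t n) ψ w - ψ w))
      (fun n ↦ ((hg (t n)).const_mul _).indicator hNm.compl) (tendsto_pi_nhds.2 fun ω ↦ ?_)
    by_cases hω : ω ∈ N
    · rw [Set.piecewise_eq_of_mem _ _ _ hω]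
      have h2 : ∫ w, ψ w ∂(RadonMeasure.ofMeasure 0).toMeasure = 0 := by
        rw [RadonMeasure.ofMeasure, dif_pos (show IsLocallyFiniteMeasure (0 : Measure ℂ) from inferInstance),
           integral_zero_measure]
      rw [h2]
      refine tendsto_const_nhds.congr fun n ↦ ?_
      rw [Set.indicator_of_notMem (not_not.2 hω)]
    · rw [Set.piecewise_eq_of_notMem _ _ _ hω]
      obtain ⟨hd, h0⟩ : Differentiable ℂ (gef ξ ω) ∧ gef ξ ω 0 ≠ 0 := by
        by_contra hcon
        exact hω (subset_toMeasurable P A hcon)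
      have hpot := isLogPotential_scaled hd h0 hr
      have h3 := (hpot.tendsto_integral hψ hR).comp ht
      rw [scaledZeroMeasure, RadonMeasure.ofMeasure, dif_pos hpot.isLocallyFiniteMeasure]
      refine h3.congr fun n ↦ ?_
      rw [Set.indicator_of_mem (show ω ∈ Nᶜ from hω)]
      rfl
  · rw [EventuallyEq, ae_iff]
    refine measure_mono_null (fun ω hω ↦ ?_) hPN
    by_contra hcon
    exact hω (Set.piecewise_eq_of_notMem _ _ _ hcon).symm

end

variable {Ω : Type*} [MeasurableSpace Ω] {P : Measure Ω} [IsProbabilityMeasure P]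
  {ξ : ℕ → Ω → ℂ}

/-- A basic vague neighbourhood constrains finitely many test functions. Each has its own `ρ` and
`δ`, and the corresponding atypical events are summed. -/
theorem tendsto_cond_scaledZeroMeasure_notMem (hmeas : ∀ k, Measurable (ξ k))
    (hlaw : ∀ k, P.map (ξ k) = stdComplexGaussian) (hindep : iIndepFun ξ P)
    {G : Set RadonMeasure} (hG : IsOpen G) (hmem : holeLimitMeasure ∈ G) :
    Tendsto (fun r : ℝ ↦ (P[|holeEvent ξ r]).map (scaledZeroMeasure ξ r) Gᶜ) atTop (nhds 0) := by
  obtain ⟨V, hV, hVG⟩ := mem_comap.1 (RadonMeasure.nhds_eq_comap _ ▸ hG.mem_nhds hmem)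
  rw [nhds_pi, Filter.mem_pi] at hV
  obtain ⟨I, hI, s, hs, hIV⟩ := hV
  have hball : ∀ φ : C_c(ℂ, ℝ), ∃ ρ δ r₀ : ℝ, 2 ≤ ρ ∧ 0 < δ ∧ δ ≤ 1 ∧ ∀ r, r₀ ≤ r →
      ∀ ω ∈ holeEvent ξ r ∩ typicalEvent ξ ρ δ r,
        ∫ w, φ w ∂(scaledZeroMeasure ξ r ω).toMeasure ∈ s φ := by
    intro φ
    obtain ⟨ε, hε, hsub⟩ := Metric.mem_nhds_iff.1 (hs φ)
    obtain ⟨R, hR⟩ := φ.exists_norm_bound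
    obtain ⟨ρ, δ, r₀, hρ, hδ, hδ1, h⟩ := exists_forall_abs_integral_sub_lt ξ
      (φ := fun w ↦ φ w) (map_continuous φ) hR hε
    exact ⟨ρ, δ, r₀, hρ, hδ, hδ1, fun r hr ω hω ↦ hsub (h r hr ω hω)⟩
  choose ρ δ r₀ hρ hδ hδ1 h using hball
  have hlim : Tendsto (fun r ↦ ∑ φ ∈ hI.toFinset,
      P (holeEvent ξ r \ typicalEvent ξ (ρ φ) (δ φ) r) / P (holeEvent ξ r)) atTop (nhds 0) := by
    have := tendsto_finsetSum hI.toFinset fun φ _ ↦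
      tendsto_measure_hole_diff_typical hmeas hlaw hindep (hρ φ) (hδ φ) (hδ1 φ)
    simpa using this
  refine tendsto_of_tendsto_of_tendsto_of_le_of_le' tendsto_const_nhds hlim
    (Eventually.of_forall fun _ ↦ zero_le) ?_
  have hlarge : ∀ᶠ r : ℝ in atTop, ∀ φ ∈ hI.toFinset, r₀ φ ≤ r :=
    (eventually_all_finset _).2 fun φ _ ↦ eventually_ge_atTop (r₀ φ)
  filter_upwards [hlarge] with r hr
  have hX := aemeasurable_scaledZeroMeasure hmeas hlaw r
  have hXr : AEMeasurable (scaledZeroMeasure ξ r) (P.restrict (holeEvent ξ r)) := hX.restrict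
  -- Null measurability of the preimage suffices to evaluate the restriction; neither the hole event
  -- nor the typical events have to be measurable.
  rw [Measure.map_apply_of_aemeasurable (hX.mono_ac cond_absolutelyContinuous)
    hG.measurableSet.compl, ProbabilityTheory.cond, Measure.smul_apply, smul_eq_mul,
    Measure.restrict_apply₀ (hXr.nullMeasurable hG.measurableSet.compl)]
  have hsub : scaledZeroMeasure ξ r ⁻¹' Gᶜ ∩ holeEvent ξ r ⊆
      ⋃ φ ∈ hI.toFinset, holeEvent ξ r \ typicalEvent ξ (ρ φ) (δ φ) r := by
    rintro ω ⟨hωG, hω⟩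
    by_contra hcon
    simp only [Set.mem_iUnion, Set.mem_sdiff, not_exists, not_and, not_not] at hcon
    refine hωG (hVG (hIV fun φ hφ ↦ ?_))
    have hφ' := hI.mem_toFinset.2 hφ
    exact h φ r (hr φ hφ') ω ⟨hω, hcon φ hφ' hω⟩
  calc (P (holeEvent ξ r))⁻¹ * P (scaledZeroMeasure ξ r ⁻¹' Gᶜ ∩ holeEvent ξ r)
      ≤ (P (holeEvent ξ r))⁻¹ * ∑ φ ∈ hI.toFinset,
          P (holeEvent ξ r \ typicalEvent ξ (ρ φ) (δ φ) r) := by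
        refine mul_le_mul_right ?_ _
        exact (measure_mono hsub).trans (measure_biUnion_finset_le _ _)
    _ = _ := by
        rw [Finset.mul_sum]
        refine Finset.sum_congr rfl fun φ _ ↦ ?_
        rw [ENNReal.div_eq_inv_mul]

end

theorem mainTheorem2 {Ω : Type*} [MeasurableSpace Ω] (P : Measure Ω) [IsProbabilityMeasure P]
    (ξ : ℕ → Ω → ℂ) (hmeas : ∀ k, Measurable (ξ k))
    (hlaw : ∀ k, P.map (ξ k) = stdComplexGaussian) (hindep : iIndepFun ξ P) :
    ∃ _ : ∀ r : ℝ, IsProbabilityMeasure (P[|holeEvent ξ r]),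
      TendstoInDistribution (fun (r : ℝ) (ω : Ω) ↦ scaledZeroMeasure ξ r ω) atTop
        (fun _ : Ω ↦ holeLimitMeasure) (fun r : ℝ ↦ P[|holeEvent ξ r]) P := by
  have hprob : ∀ r : ℝ, IsProbabilityMeasure (P[|holeEvent ξ r]) := fun r ↦
    cond_isProbabilityMeasure (measure_holeEvent_ne_zero hmeas hlaw hindep r)
  have hX : ∀ r : ℝ, AEMeasurable (scaledZeroMeasure ξ r) (P[|holeEvent ξ r]) := fun r ↦
    (aemeasurable_scaledZeroMeasure hmeas hlaw r).mono_ac cond_absolutelyContinuous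
  refine ⟨hprob, hX, aemeasurable_const, ?_⟩
  -- The limit law is a point mass, so only open sets containing `holeLimitMeasure` impose a
  -- condition.
  refine tendsto_of_forall_isOpen_le_liminf' fun G hG ↦ ?_
  by_cases hmem : holeLimitMeasure ∈ G
  · have h1 := ENNReal.Tendsto.sub (tendsto_const_nhds (x := (1 : ENNReal)))
      (tendsto_cond_scaledZeroMeasure_notMem hmeas hlaw hindep hG hmem) (Or.inl ENNReal.one_ne_top)
    rw [tsub_zero] at h1
    have h2 : ∀ r : ℝ, 1 - (P[|holeEvent ξ r]).map (scaledZeroMeasure ξ r) Gᶜ =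
        (P[|holeEvent ξ r]).map (scaledZeroMeasure ξ r) G := by
      intro r
      have := Measure.isProbabilityMeasure_map (hX r)
      rw [← prob_compl_eq_one_sub hG.measurableSet.compl, compl_compl]
    simp only [h2] at h1
    have h3 : IsProbabilityMeasure (P.map fun _ : Ω ↦ holeLimitMeasure) :=
      Measure.isProbabilityMeasure_map aemeasurable_const
    have h4 : P.map (fun _ : Ω ↦ holeLimitMeasure) G ≤ 1 := prob_le_one
    exact h4.trans h1.liminf_eq.ge
  · have h1 : P.map (fun _ : Ω ↦ holeLimitMeasure) G = 0 := by
      rw [Measure.map_const, measure_univ, one_smul, Measure.dirac_apply' _ hG.measurableSet,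
        Set.indicator_of_notMem hmem]
    exact h1.le.trans zero_le
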